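/- **Setting.** Let $Z\subset\mathbb{R}^2$ be a finite set (the punctures) and $X=\mathbb{R}^2\setminus Z$. A loop in $X$ is a continuous map $\gamma:[0,1]\to X$ with $\gamma(0)=\gamma(1)$; it is also regarded as a $1$-periodic map $\mathbb{R}\to X$. Two loops are homotopic if they are homotopic as paths with fixed end points, and freely homotopic if they are homotopic through loops. **Edge systems.** Let $\mathcal{T}$ be a collection of open segments and open rays (edges), each given an arbitrary orientation, of the following form. If $Z$ is not collinear, $\mathcal{T}$ consists of the edges of some triangulation of the convex hull of $Z$ with vertex set $Z$, together with the rays bisecting the outer angles at the vertices of the convex hull of $Z$. If $Z$ lies on a line $\ell$, $\mathcal{T}$ consists of the segments between neighbouring points of $Z$ and, for each point of $Z$, the two rays from it perpendicular to $\ell$; the unbounded components of $\ell\setminus Z$ starting at points of $Z$ may be all included or all omitted. For $E\in\mathcal{T}$ let $H_l(E)$, $H_r(E)$ be the open half planes to the left and to the right of the oriented line containing $E$. Let $A$ be a set of symbols, one for each edge. **Words.** An intersection of a loop $\gamma$ with $\mathcal{T}$ consists of an edge $E$ and a maximal compact interval $[s,t]\subset\mathbb{R}$ with $\gamma([s,t])\subset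 E$; intervals that differ by an integer translation are identified, and the representative with $0\le t<1$ is used. The intersection is positive, with letter $a$ (the symbol of $E$), if for some $\varepsilon>0$ we have $\gamma((s-\varepsilon,s))\subset H_l(E)$ and $\gamma((t,t+\varepsilon))\subset H_r(E)$. It is negative, with letter $a^{-1}$, if the same holds with $H_l(E)$ and $H_r(E)$ exchanged. Otherwise it is null and has no letter. If $\gamma$ has finitely many intersections, its word $\mathfrak{w}(\gamma)$ is the sequence of letters of its non-null intersections in increasing order of $t$. The reduced word $\hat{\mathfrak{w}}(\gamma)$ is obtained from it by free reduction. $\mathfrak{W}(\gamma)$ is the set of all cyclic reductions of $\mathfrak{w}(\gamma)$ as a cyclic word: all words obtained by removing pairs of mutually inverse letters that are consecutive, or that are the first and the last letter, until no such pair is left, together with all their cyclic permutations. **Lemma.** Let $\gamma_0,\gamma_1$ be loops in $X$, each with finitely many intersections with $\mathcal{T}$. 1. If $\gamma_0(0)=\gamma_1(0)$ and this point lies on no edge of $\mathcal{T}$, then $\gamma_0$ and $\gamma_1$ are homotopic if and only if $\hat{\mathfrak{w}}(\gamma_0)=\hat{\mathfrak{w}}(\gamma_1)$. 2. $\gamma_0$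 and $\gamma_1$ are freely homotopic if and only if $\mathfrak{W}(\gamma_0)=\mathfrak{W}(\gamma_1)$. -/

import Mathlib

/-- The Euclidean plane. -/
abbrev Plane : Type := EuclideanSpace ℝ (Fin 2)

/-- The multi-punctured plane `ℝ² \ Z`. -/
abbrev PuncturedPlane (Z : Finset Plane) : Type := {x : Plane // x ∉ Z}

/-- The (signed) area of the parallelogram spanned by `d` and `x`; it is positive exactly when `x`
points to the left of the direction `d`. -/
def cross (d x : Plane) : ℝ := d 0 * x 1 - d 1 * x 0

/-- The open ray from `p` in the direction `d`. -/
def openRay (p d : Plane) : Set Plane := {x | ∃ s : ℝ, 0 < s ∧ x = p + s • d}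

/-- `K` is a triangulation of the finite set `Z`: it subdivides the convex hull of `Z` and its
vertices are exactly the points of `Z`. -/
def IsTriangulation (Z : Finset Plane) (K : Geometry.SimplicialComplex ℝ Plane) : Prop :=
  K.vertices = (Z : Set Plane) ∧ K.space = convexHull ℝ (Z : Set Plane)

/-- The open edges of a triangulation. -/
def triangulationEdges (K : Geometry.SimplicialComplex ℝ Plane) : Set (Set Plane) :=
  {E | ∃ p q : Plane, p ≠ q ∧ {p, q} ∈ K.faces ∧ E = openSegment ℝ p q}

/-- The open rays bisecting the outer angles of the convex hull of a non-collinear set `Z`.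
At a vertex `z` of the convex hull the interior angle is spanned by the directions from `z` to two
points `p`, `q` of `Z` such that the cone at `z` through `p` and `q` contains `Z`; the bisector of
the outer angle points opposite to the bisector of the interior angle. -/
def outerBisectors (Z : Finset Plane) : Set (Set Plane) :=
  {E | ∃ z ∈ Z, ∃ p ∈ Z, ∃ q ∈ Z, LinearIndependent ℝ ![p - z, q - z] ∧
    (∀ w ∈ Z, ∃ a b : ℝ, 0 ≤ a ∧ 0 ≤ b ∧ w - z = a • (p - z) + b • (q - z)) ∧
    E = openRay z (-(‖p - z‖⁻¹ • (p - z) + ‖q - z‖⁻¹ • (q - z)))}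

/-- The open segments between neighbouring points of a collinear set `Z`. -/
def consecutiveSegments (Z : Finset Plane) : Set (Set Plane) :=
  {E | ∃ p ∈ Z, ∃ q ∈ Z, p ≠ q ∧ (∀ w ∈ Z, w ∉ openSegment ℝ p q) ∧ E = openSegment ℝ p q}

/-- The open rays from the points of `Z` in the directions `v` and `-v`. -/
def raysAlong (Z : Finset Plane) (v : Plane) : Set (Set Plane) :=
  {E | ∃ p ∈ Z, E = openRay p v ∨ E = openRay p (-v)}

/-- The edge collections of edge systems for `Z`.
* If `Z` is not collinear: the edges of some triangulation of `Z` and the bisectors of the outer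
  angles of the convex hull of `Z`.
* If `Z` lies on a line in the direction `u`: the segments between neighbouring points of `Z` and,
  for each point of `Z`, the two rays perpendicular to the line. The two unbounded components of
  (line `\ Z`), i.e. the rays along the line that avoid `Z`, may or may not be included. -/
inductive IsEdgeCollection (Z : Finset Plane) : Set (Set Plane) → Prop
  | triangulated (hZ : ¬ Collinear ℝ (Z : Set Plane)) (K : Geometry.SimplicialComplex ℝ Plane)
      (hK : IsTriangulation Z K) :
      IsEdgeCollection Z (triangulationEdges K ∪ outerBisectors Z)
  | collinear (u v : Plane) (hu : u ≠ 0) (hv : v ≠ 0) (huv : inner ℝ u v = 0)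
      (hZ : ∀ p ∈ Z, ∀ q ∈ Z, ∃ c : ℝ, q - p = c • u) :
      IsEdgeCollection Z (consecutiveSegments Z ∪ raysAlong Z v)
  | collinearWithEnds (u v : Plane) (hu : u ≠ 0) (hv : v ≠ 0) (huv : inner ℝ u v = 0)
      (hZ : ∀ p ∈ Z, ∀ q ∈ Z, ∃ c : ℝ, q - p = c • u) :
      IsEdgeCollection Z (consecutiveSegments Z ∪ raysAlong Z v ∪
        {E ∈ raysAlong Z u | ∀ w ∈ Z, w ∉ E})

/-- An edge system: an edge collection for `Z`, each of whose edges is given an arbitrary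
orientation by a nonzero vector along the edge. -/
structure EdgeSystem (Z : Finset Plane) where
  /-- the edges, as (relatively open) subsets of the plane -/
  edges : Set (Set Plane)
  isEdgeCollection : IsEdgeCollection Z edges
  /-- the direction in which an edge is oriented -/
  dir : edges → Plane
  dir_ne_zero : ∀ e, dir e ≠ 0
  dir_along : ∀ e : edges, ∀ x ∈ (e : Set Plane), ∀ y ∈ (e : Set Plane), ∃ c : ℝ, y - x = c • dir e

/-- A loop: a path `[0,1] → Y` with equal end points. -/
structure Loop (Y : Type*) [TopologicalSpace Y] where
  /-- the underlying path -/
  toMap : C(unitInterval, Y)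
  closed : toMap 0 = toMap 1

namespace Loop

variable {Y : Type*} [TopologicalSpace Y]

/-- The starting point of a loop. -/
def base (γ : Loop Y) : Y := γ.toMap 0

/-- Two loops are homotopic if they are homotopic as paths, with fixed end points. -/
def Homotopic (γ₀ γ₁ : Loop Y) : Prop :=
  ContinuousMap.HomotopicRel γ₀.toMap γ₁.toMap {0, 1}

/-- Two loops are freely homotopic if they are homotopic through loops. -/
def FreelyHomotopic (γ₀ γ₁ : Loop Y) : Prop :=
  ContinuousMap.HomotopicWith γ₀.toMap γ₁.toMap (fun f => f 0 = f 1)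

/-- A loop regarded as a `1`-periodic map on the real line: `t ↦ γ (t mod 1)`. -/
noncomputable def periodic (γ : Loop Y) (t : ℝ) : Y :=
  γ.toMap ⟨Int.fract t, Int.fract_nonneg t, (Int.fract_lt_one t).le⟩

end Loop

namespace EdgeSystem

variable {Z : Finset Plane} (T : EdgeSystem Z)

/-- The union of all the edges. -/
def support : Set Plane := ⋃₀ T.edges

/-- The open half plane to the left of the oriented line through the edge `e`. -/
def leftSide (e : T.edges) : Set Plane := {x | ∀ p ∈ (e : Set Plane), 0 < cross (T.dir e) (x - p)}

/-- The open half plane to the right of the oriented line through the edge `e`. -/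
def rightSide (e : T.edges) : Set Plane := {x | ∀ p ∈ (e : Set Plane), cross (T.dir e) (x - p) < 0}

/-- `[l, r]` is a maximal interval on which the periodic map `γ` stays in the edge `e`. -/
def IsVisit (γ : Loop (PuncturedPlane Z)) (e : T.edges) (l r : ℝ) : Prop :=
  l ≤ r ∧ (∀ t ∈ Set.Icc l r, (γ.periodic t : Plane) ∈ (e : Set Plane)) ∧
    ∀ l' r' : ℝ, l' ≤ l → r ≤ r' →
      (∀ t ∈ Set.Icc l' r', (γ.periodic t : Plane) ∈ (e : Set Plane)) → l' = l ∧ r' = r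

/-- The collection of intersections of `γ` with the edges, each represented by its edge and its
first time interval `[l, r]` that contains a non-negative number, i.e. the one among its integer
translates with `0 ≤ r < 1`. -/
def visits (γ : Loop (PuncturedPlane Z)) : Set (T.edges × ℝ × ℝ) :=
  {v | T.IsVisit γ v.1 v.2.1 v.2.2 ∧ 0 ≤ v.2.2 ∧ v.2.2 < 1}

/-- Shortly before time `l` the loop is in `A`, and shortly after time `r` it is in `B`. -/
def Passes (γ : Loop (PuncturedPlane Z)) (A B : Set Plane) (l r : ℝ) : Prop :=
  ∃ ε > 0, (∀ t ∈ Set.Ioo (l - ε) l, (γ.periodic t : Plane) ∈ A) ∧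
    ∀ t ∈ Set.Ioo r (r + ε), (γ.periodic t : Plane) ∈ B

/-- The letters: `(e, true)` is the symbol of the edge `e`, and `(e, false)` is its inverse. This is
the convention of `FreeGroup T.edges`. -/
abbrev Letter : Type := T.edges × Bool

/-- The intersection of `γ` that ends at time `r` is a positive intersection with the edge `e` (for
the letter `(e, true)`, from left to right) or a negative one (for `(e, false)`, from right to
left). -/
def CrossesAt (γ : Loop (PuncturedPlane Z)) (r : ℝ) (x : T.Letter) : Prop :=
  ∃ l : ℝ, T.IsVisit γ x.1 l r ∧
    match x.2 with
    | true => Passes γ (T.leftSide x.1) (T.rightSide x.1) l r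
    | false => Passes γ (T.rightSide x.1) (T.leftSide x.1) l r

open Classical in
/-- The letter of the intersection of `γ` that ends at time `r`, and nothing if that intersection is
null. There is at most one such letter, because the edges are pairwise disjoint. -/
noncomputable def letterAt (γ : Loop (PuncturedPlane Z)) (r : ℝ) : Option T.Letter :=
  if h : ∃ x, T.CrossesAt γ r x then some h.choose else none

/-- The word of a loop with finitely many intersections: the letters of its non-null intersections,
in the increasing order of the right end points of their time intervals. -/
noncomputable def word (γ : Loop (PuncturedPlane Z)) (h : (T.visits γ).Finite) : List T.Letter :=
  ((h.image fun v => v.2.2).toFinset.sort (fun a b => a ≤ b)).filterMap (T.letterAt γ)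

open Classical in
/-- The reduced word of a loop. -/
noncomputable def reducedWord (γ : Loop (PuncturedPlane Z)) (h : (T.visits γ).Finite) :
    List T.Letter :=
  FreeGroup.reduce (T.word γ h)

end EdgeSystem

/-- Removing from a word one pair of cyclically consecutive letters that are inverse to each other:
either two consecutive letters, or the first and the last letter. -/
inductive CyclicCancel {α : Type*} : List (α × Bool) → List (α × Bool) → Prop
  | consecutive (u v : List (α × Bool)) (a : α) (b : Bool) :
      CyclicCancel (u ++ (a, b) :: (a, !b) :: v) (u ++ v)
  | ends (u : List (α × Bool)) (a : α) (b : Bool) :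
      CyclicCancel ((a, b) :: (u ++ [(a, !b)])) u

/-- The set of all cyclic reductions of the word `w`, where words are read cyclically: the results
of cancelling cyclically consecutive inverse pairs in `w` until no such pair is left, together with
all their cyclic permutations. -/
def cyclicReductions {α : Type*} (w : List (α × Bool)) : Set (List (α × Bool)) :=
  {x | ∃ y, Relation.ReflTransGen CyclicCancel w y ∧ (∀ z, ¬ CyclicCancel y z) ∧ y.IsRotated x}

/-! The edges are disjoint, closed in the punctured plane, and cut it into convex cells. Up to
homotopy a loop is therefore determined by its sequence of crossings, and the only relations are the
free cancellations. The proof attaches to a loop an element of the free group on the edges, its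
holonomy, and shows that it is a complete invariant.

Invariance: gluing trivial charts with a jump by the generator of `e` across each edge `e` gives a
principal bundle with discrete fibre `FreeGroup T.edges` (`flatGauge`). It is a covering, so maps
from simply connected spaces lift (`FlatGauge.exists_isLift`). For a lift `g` of a loop, `(g 0)⁻¹ *
g 1` is unchanged by homotopies with fixed end points and is conjugated by free ones
(`holonomy_of_homotopy`). A lift is constant off the edges and changes by one letter across each
non-null intersection. So the holonomy is the element spelled by the word if the base point is off
the edges, and is conjugate to it in general (`exists_isLift_of_word`).

Completeness: fix a point `o` and a path from `o` into each cell. This gives every point `x` a path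
class `access o x`. As `x` moves, this class changes by a standard loop exactly when the lift jumps.
Hence a path is determined up to homotopy by its end points and its holonomy (`access_comp_cls`).

Convexity of the cells is where the geometry of edge systems enters. At a puncture the edges leave
no sector of angle greater than `π` (`IsProperEdgeCollection.exists_germ`), so invisibility from a
given point is an open condition (`isOpen_obstructed`). Visible regions are then connected
components of the complement of the edges, and any two points of a component see each other
(`convex_cell`).

What remains is algebra: reduced words correspond to elements of the free group, and sets of cyclic
reductions to its conjugacy classes (`cyclicReductions_eq_iff_isConj`). -/

/-! ### Cyclic words and conjugacy in free groups -/

namespace FreeGroup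

variable {α : Type*}

theorem mk_eq_mk_iff_of_isReduced {y y' : List (α × Bool)} (hy : IsReduced y)
    (hy' : IsReduced y') (h : mk y = mk y') : y = y' := by
  classical
  rw [← hy.reduce_eq, ← hy'.reduce_eq]
  exact reduce.sound h

theorem IsReduced.invRev {L : List (α × Bool)} (h : IsReduced L) : IsReduced (invRev L) := by
  classical
  rw [isReduced_iff_reduce_eq, reduce_invRev, h.reduce_eq]

theorem isCyclicallyReduced_concat_iff {a : α × Bool} {l : List (α × Bool)} :
    IsCyclicallyReduced (l ++ [a]) ↔ IsCyclicallyReduced (a :: l) := by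
  rcases l with _ | ⟨b, m⟩
  · rfl
  · simp only [isCyclicallyReduced_iff, IsReduced, List.isChain_append, List.isChain_cons]
    simp only [List.getLast?_append, List.getLast?_cons, List.head?_cons, List.cons_append]
    simp
    grind

/-- Cancellation could only start at one of the two seams, and the last two hypotheses exclude it
there. Since `y` is not empty, `c` and its inverse do not touch. -/
theorem isReduced_conj {c y : List (α × Bool)} (hc : IsReduced c) (hy : IsReduced y)
    (hne : y ≠ []) (h1 : ∀ x ∈ c.getLast?, ∀ z ∈ y.head?, x.1 = z.1 → x.2 = z.2)
    (h2 : ∀ x ∈ c.getLast?, ∀ z ∈ y.getLast?, x.1 = z.1 → z.2 = !x.2) :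
    IsReduced (c ++ y ++ invRev c) := by
  have hi := hc.invRev
  rw [IsReduced] at *
  rw [List.isChain_append, List.isChain_append]
  refine ⟨⟨hc, hy, h1⟩, hi, ?_⟩
  intro x hx z hz
  have hx' : x ∈ y.getLast? := by
    rw [List.getLast?_append_of_ne_nil _ hne] at hx; exact hx
  rw [invRev, List.head?_reverse, List.getLast?_map] at hz
  simp only [Option.mem_def, Option.map_eq_some_iff] at hz
  obtain ⟨w, hw, rfl⟩ := hz
  intro h
  have := h2 w hw x hx' h.symm
  simp [this]

/-- Induction on the conjugator. If its last letter cancels against either end of `y`, the effect is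
to move one letter of `y` to the other end, and the conjugator gets shorter. If it cancels at
neither end, the conjugate is reduced as written, hence equal to `y'`; but it begins and ends with
mutually inverse letters, so `y'` is not cyclically reduced. -/
theorem IsCyclicallyReduced.isRotated_of_conj {c : List (α × Bool)} :
    ∀ {y y' : List (α × Bool)}, IsReduced c → IsCyclicallyReduced y → IsCyclicallyReduced y' →
      mk c * mk y * (mk c)⁻¹ = mk y' → y.IsRotated y' := by
  induction c using List.reverseRecOn with
  | nil =>
    intro y y' _ hy hy' h
    rw [← one_eq_mk, one_mul, inv_one, mul_one] at h
    rw [mk_eq_mk_iff_of_isReduced hy.1 hy'.1 h]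
  | append_singleton c x ih =>
    intro y y' hc hy hy' h
    have hc' : IsReduced c := by
      rw [IsReduced, List.isChain_append] at hc; exact hc.1
    have hx : mk (c ++ [x]) = mk c * mk [x] := (mul_mk).symm
    rcases y with _ | ⟨a, y2⟩
    · have : mk y' = mk [] := by
        rw [← h, ← one_eq_mk, mul_one, mul_inv_cancel]
      rw [mk_eq_mk_iff_of_isReduced hy'.1 (by simp [IsReduced]) this]
    by_cases hA : a.1 = x.1 ∧ a.2 = !x.2
    · refine List.IsRotated.trans (List.IsRotated.symm ?_)
        (ih hc' (isCyclicallyReduced_concat_iff.2 hy) hy' ?_)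
      · simpa using List.isRotated_append (l := y2) (l' := [a])
      · rw [← h, hx]
        have ha : a = (x.1, !x.2) := Prod.ext hA.1 hA.2
        have e1 : mk (a :: y2) = mk [a] * mk y2 := by rw [mul_mk]; rfl
        have e2 : mk (y2 ++ [a]) = mk y2 * mk [a] := by rw [mul_mk]
        have e3 : mk [a] = (mk [x])⁻¹ := by
          rw [ha, inv_mk]; rfl
        rw [e1, e2, e3]; group
    by_cases hB : x ∈ (a :: y2).getLast?
    · obtain ⟨y3, hy3⟩ : ∃ y3, a :: y2 = y3 ++ [x] := by
        have := List.mem_getLast?_eq_getLast hB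
        obtain ⟨hne, hl⟩ := this
        exact ⟨(a :: y2).dropLast, by rw [hl, List.dropLast_append_getLast]⟩
      rw [hy3] at hy h ⊢
      refine List.IsRotated.trans ?_ (ih hc' (isCyclicallyReduced_concat_iff.1 hy) hy' ?_)
      · simpa using List.isRotated_append (l := y3) (l' := [x])
      · rw [← h, hx]
        have e1 : mk (x :: y3) = mk [x] * mk y3 := by rw [mul_mk]; rfl
        have e2 : mk (y3 ++ [x]) = mk y3 * mk [x] := by rw [mul_mk]
        rw [e1, e2]; group
    exfalso
    have hred : IsReduced ((c ++ [x]) ++ (a :: y2) ++ invRev (c ++ [x])) := by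
      refine isReduced_conj hc hy.1 (by simp) ?_ ?_
      · intro u hu v hv huv
        simp at hu hv
        subst hu hv
        by_contra hne
        exact hA ⟨huv.symm, by cases hx2 : x.2 <;> cases ha2 : a.2 <;> simp_all⟩
      · intro u hu v hv huv
        simp only [List.getLast?_append, List.getLast?_singleton, Option.some_or,
          Option.mem_def, Option.some.injEq] at hu
        subst hu
        have : v ≠ x := fun e => hB (e ▸ hv)
        by_contra hne
        exact this (Prod.ext huv.symm (by cases hx2 : x.2 <;> cases ha2 : v.2 <;> simp_all))
    have heq : (c ++ [x]) ++ (a :: y2) ++ invRev (c ++ [x]) = y' := by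
      refine mk_eq_mk_iff_of_isReduced hred hy'.1 ?_
      rw [← h, inv_mk, mul_mk, mul_mk]
    obtain ⟨b, t, ht⟩ : ∃ b t, c ++ [x] = b :: t := by
      cases c <;> simp
    rw [ht] at heq
    have h2 := hy'.2 (b.1, !b.2) (by
      rw [← heq, invRev_cons, ← List.append_assoc]
      exact List.getLast?_concat) b (by rw [← heq]; simp) rfl
    simp at h2

theorem IsCyclicallyReduced.isRotated_of_isConj {y y' : List (α × Bool)}
    (hy : IsCyclicallyReduced y) (hy' : IsCyclicallyReduced y') (h : IsConj (mk y) (mk y')) :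
    y.IsRotated y' := by
  classical
  obtain ⟨c, hc⟩ := isConj_iff.1 h
  refine isRotated_of_conj (c := c.toWord) isReduced_toWord hy hy' ?_
  rw [mk_toWord, hc]

end FreeGroup

namespace CyclicCancel

variable {α : Type*}

theorem isConj {w y : List (α × Bool)} (h : CyclicCancel w y) :
    IsConj (FreeGroup.mk w) (FreeGroup.mk y) := by
  cases h with
  | consecutive u v a b =>
    rw [show FreeGroup.mk (u ++ (a, b) :: (a, !b) :: v) = FreeGroup.mk (u ++ v) from
      Quot.sound FreeGroup.Red.Step.not]
  | ends u a b =>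
    refine isConj_iff.2 ⟨(FreeGroup.mk [(a, b)])⁻¹, ?_⟩
    have e : FreeGroup.mk ((a, b) :: (y ++ [(a, !b)])) =
        FreeGroup.mk [(a, b)] * FreeGroup.mk y * FreeGroup.mk [(a, !b)] := by
      rw [FreeGroup.mul_mk, FreeGroup.mul_mk]; rfl
    have e2 : FreeGroup.mk [(a, !b)] = (FreeGroup.mk [(a, b)])⁻¹ := by
      rw [FreeGroup.inv_mk]; rfl
    rw [e, e2]; group

theorem length_lt {w y : List (α × Bool)} (h : CyclicCancel w y) : y.length < w.length := by
  cases h <;> simp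

theorem isConj_of_reflTransGen {w y : List (α × Bool)} (h : Relation.ReflTransGen CyclicCancel w y) :
    IsConj (FreeGroup.mk w) (FreeGroup.mk y) := by
  induction h with
  | refl => exact IsConj.refl _
  | tail _ h ih => exact ih.trans h.isConj

theorem isCyclicallyReduced {y : List (α × Bool)} (h : ∀ z, ¬ CyclicCancel y z) :
    FreeGroup.IsCyclicallyReduced y := by
  refine ⟨?_, ?_⟩
  · rw [FreeGroup.IsReduced, List.isChain_iff_forall_rel_of_append_cons_cons]
    intro a b l₁ l₂ hl hab
    by_contra hne
    refine h (l₁ ++ l₂) ?_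
    have : b = (a.1, !a.2) :=
      Prod.ext hab.symm (by cases h1 : a.2 <;> cases h2 : b.2 <;> simp_all)
    rw [hl, this]
    exact .consecutive l₁ l₂ a.1 a.2
  · intro a ha b hb hab
    by_contra hne
    have hA : a = (b.1, !b.2) :=
      Prod.ext hab (by cases h1 : a.2 <;> cases h2 : b.2 <;> simp_all)
    rcases y with _ | ⟨b', t⟩
    · simp at ha
    simp only [List.head?_cons, Option.mem_def, Option.some.injEq] at hb
    subst hb
    rcases List.eq_nil_or_concat t with rfl | ⟨u, c, rfl⟩
    · simp at ha; subst ha; exact hne rfl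
    · rw [List.concat_eq_append] at h
      have : c = a := by
        rw [List.concat_eq_append, ← List.cons_append, List.getLast?_concat] at ha
        simpa using ha
      subst this
      refine h u ?_
      have := CyclicCancel.ends u b'.1 b'.2
      rw [hA]
      exact this

theorem exists_terminal (w : List (α × Bool)) :
    ∃ y, Relation.ReflTransGen CyclicCancel w y ∧ ∀ z, ¬ CyclicCancel y z := by
  induction hn : w.length using Nat.strong_induction_on generalizing w with
  | _ n ih =>
    by_cases h : ∃ z, CyclicCancel w z
    · obtain ⟨z, hz⟩ := h
      obtain ⟨y, hy, hy'⟩ := ih z.length (hn ▸ hz.length_lt) z rfl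
      exact ⟨y, .head hz hy, hy'⟩
    · exact ⟨w, .refl, not_exists.1 h⟩

end CyclicCancel

/-- Cancellations preserve the conjugacy class, and a word without further cancellations is
cyclically reduced. Conjugate cyclically reduced words are rotations of each other, so the set
consists of the rotations of any one cyclically reduced representative of the class. -/
theorem cyclicReductions_eq_iff_isConj {α : Type*} {w₀ w₁ : List (α × Bool)} :
    cyclicReductions w₀ = cyclicReductions w₁ ↔
      IsConj (FreeGroup.mk w₀) (FreeGroup.mk w₁) := by
  have conj_of_mem {w x : List (α × Bool)} (hx : x ∈ cyclicReductions w) :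
      ∃ y, IsConj (FreeGroup.mk w) (FreeGroup.mk y) ∧ FreeGroup.IsCyclicallyReduced y ∧
        y.IsRotated x := by
    obtain ⟨y, h1, h2, h3⟩ := hx
    exact ⟨y, CyclicCancel.isConj_of_reflTransGen h1, CyclicCancel.isCyclicallyReduced h2, h3⟩
  have subset_of_isConj {w w' : List (α × Bool)}
      (h : IsConj (FreeGroup.mk w) (FreeGroup.mk w')) :
      cyclicReductions w ⊆ cyclicReductions w' := by
    intro x hx
    obtain ⟨y, h1, h2, h3⟩ := conj_of_mem hx
    obtain ⟨y', h4, h5⟩ := CyclicCancel.exists_terminal w'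
    refine ⟨y', h4, h5, ?_⟩
    refine List.IsRotated.trans ?_ h3
    exact (CyclicCancel.isCyclicallyReduced h5).isRotated_of_isConj h2
      ((CyclicCancel.isConj_of_reflTransGen h4).symm.trans (h.symm.trans h1))
  constructor
  · intro h
    obtain ⟨y, h4, h5⟩ := CyclicCancel.exists_terminal w₀
    obtain ⟨y', h1, -, h3⟩ := conj_of_mem (w := w₁) (x := y) (by
      rw [← h]; exact ⟨y, h4, h5, .refl _⟩)
    refine (CyclicCancel.isConj_of_reflTransGen h4).trans (IsConj.trans ?_ h1.symm)
    -- A rotation swaps an initial piece with the rest, which is conjugation by that piece.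
    obtain ⟨n, hn, rfl⟩ := List.isRotated_iff_mod.1 h3.symm
    rw [List.rotate_eq_drop_append_take hn]
    nth_rw 1 [← List.take_append_drop n y]
    rw [← FreeGroup.mul_mk, ← FreeGroup.mul_mk]
    exact isConj_iff.2 ⟨(FreeGroup.mk (y.take n))⁻¹, by group⟩
  · intro h
    exact (subset_of_isConj h).antisymm (subset_of_isConj h.symm)

/-! ### Proper edge collections and planar vector algebra -/

/-- `E` is an open segment between two points of `Z` or an open ray starting at a point of `Z`. -/
def IsStraightEdge (Z : Finset Plane) (E : Set Plane) : Prop :=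
  (∃ p ∈ Z, ∃ q ∈ Z, p ≠ q ∧ E = openSegment ℝ p q) ∨ ∃ p ∈ Z, ∃ d : Plane, d ≠ 0 ∧ E = openRay p d

/-- An initial piece of the ray from `z` in the direction `f` is covered by `S`. -/
def IsGerm (S : Set (Set Plane)) (z f : Plane) : Prop :=
  ∃ τ₀ > 0, ∀ τ : ℝ, 0 < τ → τ < τ₀ → z + τ • f ∈ ⋃₀ S

/-- The properties of an edge collection on which the topological argument relies. By the last one,
the edges that start at a puncture cut its neighbourhood into sectors of angle at most `π`. -/
structure IsProperEdgeCollection (Z : Finset Plane) (S : Set (Set Plane)) : Prop where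
  finite : S.Finite
  notMem : ∀ E ∈ S, ∀ x ∈ E, x ∉ Z
  eq_of_mem : ∀ E ∈ S, ∀ E' ∈ S, ∀ x, x ∈ E → x ∈ E' → E = E'
  straight : ∀ E ∈ S, IsStraightEdge Z E
  exists_germ : ∀ z ∈ Z, ∀ d : Plane, d ≠ 0 → ∀ σ : ℝ, σ ≠ 0 →
    ∃ f, (0 < σ * cross d f ∨ ∃ c : ℝ, 0 < c ∧ f = c • d) ∧ IsGerm S z f

theorem Plane.ext {x y : Plane} (h0 : x 0 = y 0) (h1 : x 1 = y 1) : x = y := by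
  ext i; fin_cases i <;> assumption

@[simp] theorem cross_add (d x y : Plane) : cross d (x + y) = cross d x + cross d y := by
  simp only [cross, PiLp.add_apply]; ring

@[simp] theorem cross_sub (d x y : Plane) : cross d (x - y) = cross d x - cross d y := by
  simp only [cross, PiLp.sub_apply]; ring

@[simp] theorem cross_neg (d x : Plane) : cross d (-x) = -cross d x := by
  simp only [cross, PiLp.neg_apply]; ring

@[simp] theorem cross_zero (d : Plane) : cross d 0 = 0 := by
  simp [cross]

@[simp] theorem cross_smul (c : ℝ) (d x : Plane) : cross d (c • x) = c * cross d x := by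
  simp only [cross, PiLp.smul_apply, smul_eq_mul]; ring

@[simp] theorem cross_same (d : Plane) : cross d d = 0 := by
  simp only [cross]; ring

theorem cross_swap (d x : Plane) : cross x d = -cross d x := by
  simp only [cross]; ring

theorem Plane.inner_eq (x y : Plane) : inner ℝ x y = x 0 * y 0 + x 1 * y 1 := by
  simp [PiLp.inner_apply, Fin.sum_univ_two]; ring

theorem Plane.inner_self_pos {x : Plane} (h : x ≠ 0) : 0 < inner ℝ x x :=
  real_inner_self_pos.2 h

/-- The expansion of a vector in the orthogonal basis of `d` and its rotation by a right angle. -/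
theorem inner_mul_cross (d p v : Plane) :
    inner ℝ d d * cross p v = inner ℝ d p * cross d v - cross d p * inner ℝ d v := by
  simp only [Plane.inner_eq, cross]; ring

/-- Cramer's rule without denominators: the coordinates of `C` with respect to `A` and `B`. -/
theorem cross_smul_expand (A B C : Plane) :
    cross A B • C = -cross B C • A + cross A C • B := by
  apply Plane.ext <;> simp only [cross, PiLp.smul_apply, PiLp.add_apply, smul_eq_mul] <;> ring

theorem exists_smul_of_cross_eq_zero {d x : Plane} (hd : d ≠ 0) (h : cross d x = 0) :
    ∃ c : ℝ, x = c • d := by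
  have hp := Plane.inner_self_pos hd
  refine ⟨inner ℝ d x / inner ℝ d d, ?_⟩
  have h' : d 0 * x 1 = d 1 * x 0 := by simp only [cross] at h; linarith
  have key : inner ℝ d d • x = inner ℝ d x • d := by
    apply Plane.ext <;> simp only [PiLp.smul_apply, smul_eq_mul, Plane.inner_eq]
    · linear_combination -(d 1) * h'
    · linear_combination d 0 * h'
  rw [div_eq_inv_mul, mul_smul, ← key, inv_smul_smul₀ hp.ne']

theorem cross_ne_zero_of_inner_eq_zero {u v : Plane} (hu : u ≠ 0) (hv : v ≠ 0)
    (h : inner ℝ u v = 0) : cross u v ≠ 0 := by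
  intro hc
  obtain ⟨c, rfl⟩ := exists_smul_of_cross_eq_zero hu hc
  rw [real_inner_smul_right] at h
  rcases mul_eq_zero.1 h with rfl | h
  · simp at hv
  · exact (Plane.inner_self_pos hu).ne' h

theorem mem_openSegment_iff {p q x : Plane} :
    x ∈ openSegment ℝ p q ↔ ∃ θ : ℝ, 0 < θ ∧ θ < 1 ∧ x = p + θ • (q - p) := by
  rw [openSegment_eq_image']
  constructor
  · rintro ⟨θ, ⟨h0, h1⟩, rfl⟩; exact ⟨θ, h0, h1, rfl⟩
  · rintro ⟨θ, h0, h1, rfl⟩; exact ⟨θ, ⟨h0, h1⟩, rfl⟩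

theorem finite_consecutiveSegments (Z : Finset Plane) : (consecutiveSegments Z).Finite := by
  refine ((Z ×ˢ Z).finite_toSet.image fun pq => openSegment ℝ pq.1 pq.2).subset ?_
  rintro E ⟨p, hp, q, hq, -, -, rfl⟩
  exact ⟨(p, q), by simp [hp, hq], rfl⟩

theorem finite_raysAlong (Z : Finset Plane) (v : Plane) : (raysAlong Z v).Finite := by
  refine ((Z.finite_toSet.image fun p => openRay p v).union
    (Z.finite_toSet.image fun p => openRay p (-v))).subset ?_
  rintro E ⟨p, hp, rfl | rfl⟩
  · exact .inl ⟨p, hp, rfl⟩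
  · exact .inr ⟨p, hp, rfl⟩

theorem mem_raysAlong_iff {Z : Finset Plane} {v : Plane} {E : Set Plane} :
    E ∈ raysAlong Z v ↔ ∃ p ∈ Z, ∃ ε : ℝ, (ε = 1 ∨ ε = -1) ∧ E = openRay p (ε • v) := by
  constructor
  · rintro ⟨p, hp, rfl | rfl⟩
    · exact ⟨p, hp, 1, by simp⟩
    · exact ⟨p, hp, -1, by simp⟩
  · rintro ⟨p, hp, ε, rfl | rfl, rfl⟩
    · exact ⟨p, hp, by simp⟩
    · exact ⟨p, hp, by simp⟩

theorem isGerm_openRay {S : Set (Set Plane)} {z f : Plane} (h : openRay z f ∈ S) : IsGerm S z f :=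
  ⟨1, one_pos, fun τ h0 _ => ⟨_, h, τ, h0, rfl⟩⟩

/-- Two opposite edges at `z` form a line through `z`, which leaves only sectors of angle at most
`π`. -/
theorem exists_germ_of_opposite {S : Set (Set Plane)} {z v : Plane} (hv : v ≠ 0)
    (g1 : IsGerm S z v) (g2 : IsGerm S z (-v)) {d : Plane} (hd : d ≠ 0) {σ : ℝ} (hσ : σ ≠ 0) :
    ∃ f, (0 < σ * cross d f ∨ ∃ c : ℝ, 0 < c ∧ f = c • d) ∧ IsGerm S z f := by
  rcases lt_trichotomy (σ * cross d v) 0 with h | h | h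
  · exact ⟨-v, .inl (by rw [cross_neg]; linarith), g2⟩
  · obtain ⟨c, hc⟩ := exists_smul_of_cross_eq_zero hd ((mul_eq_zero.1 h).resolve_left hσ)
    have hc0 : c ≠ 0 := by rintro rfl; simp at hc; exact hv hc
    rcases lt_or_gt_of_ne hc0 with h | h
    · exact ⟨-v, .inr ⟨-c, by linarith, by rw [hc, neg_smul]⟩, g2⟩
    · exact ⟨v, .inr ⟨c, h, hc⟩, g1⟩
  · exact ⟨v, .inl h, g1⟩

theorem IsGerm.smul {S : Set (Set Plane)} {z f : Plane} (h : IsGerm S z f) {c : ℝ} (hc : 0 < c) :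
    IsGerm S z (c • f) := by
  obtain ⟨τ₀, h0, h⟩ := h
  refine ⟨τ₀ / c, by positivity, fun τ hτ hτ' => ?_⟩
  rw [smul_smul]
  exact h _ (by positivity) ((lt_div_iff₀ hc).1 hτ')

/-! ### Collinear punctures -/

namespace IsEdgeCollection

variable {Z : Finset Plane} {u v : Plane}

/-- In a coordinate `c` on the line these are intervals without marked points inside. Two of them
with a common point must have the same end points, since otherwise an end point of one would lie
inside the other. -/
theorem consecutive_eq_of_mem (hu : u ≠ 0) (hZ : ∀ p ∈ Z, ∀ q ∈ Z, ∃ c : ℝ, q - p = c • u)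
    {E E' : Set Plane} (hE : E ∈ consecutiveSegments Z) (hE' : E' ∈ consecutiveSegments Z)
    {x : Plane} (hx : x ∈ E) (hx' : x ∈ E') : E = E' := by
  obtain ⟨o, ho⟩ : ∃ o, o ∈ Z := by obtain ⟨p, hp, _⟩ := hE; exact ⟨p, hp⟩
  choose! c hc using hZ o ho
  have hinj : ∀ p ∈ Z, ∀ q ∈ Z, c p = c q → p = q := by
    intro p hp q hq h
    have h1 := hc p hp
    rw [h, ← hc q hq] at h1
    exact sub_left_inj.1 h1
  have hsub : ∀ p ∈ Z, ∀ q ∈ Z, q - p = (c q - c p) • u := by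
    intro p hp q hq
    rw [sub_smul, ← hc p hp, ← hc q hq]; abel
  -- The end points are ordered so that the coordinate increases from `p` to `q`.
  have norm : ∀ F ∈ consecutiveSegments Z, x ∈ F → ∃ p ∈ Z, ∃ q ∈ Z, ∃ t, x = o + t • u ∧
      c p < t ∧ t < c q ∧ (∀ w ∈ Z, w ∉ openSegment ℝ p q) ∧ F = openSegment ℝ p q := by
    rintro F ⟨p, hp, q, hq, hpq, hw, rfl⟩ hxF
    have hne : c p ≠ c q := fun h => hpq (hinj p hp q hq h)
    have hx2 := hxF
    obtain ⟨θ, h0, h1, hxe⟩ := mem_openSegment_iff.1 hxF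
    have hxo : x = o + (c p + θ * (c q - c p)) • u := by
      rw [hxe, hsub p hp q hq, add_smul, ← hc p hp, smul_smul]; abel
    rcases lt_or_gt_of_ne hne with hlt | hlt
    · exact ⟨p, hp, q, hq, _, hxo, by nlinarith, by nlinarith, hw, rfl⟩
    · refine ⟨q, hq, p, hp, _, hxo, by nlinarith, by nlinarith, ?_, openSegment_symm ..⟩
      rwa [openSegment_symm]
  have between : ∀ p ∈ Z, ∀ q ∈ Z, ∀ w ∈ Z, c p < c w → c w < c q → w ∈ openSegment ℝ p q := by
    intro p hp q hq w hw h1 h2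
    refine mem_openSegment_iff.2 ⟨(c w - c p) / (c q - c p), div_pos (by linarith) (by linarith),
      (div_lt_one (by linarith)).2 (by linarith), ?_⟩
    rw [hsub p hp q hq, smul_smul, div_mul_cancel₀ _ (by linarith), ← hsub p hp w hw]; abel
  obtain ⟨p, hp, q, hq, t, hxt, h1, h2, hw, rfl⟩ := norm E hE hx
  obtain ⟨p', hp', q', hq', t', hxt', h1', h2', hw', rfl⟩ := norm E' hE' hx'
  have ht : t = t' := smul_left_injective ℝ hu (add_left_cancel (hxt.symm.trans hxt'))
  subst ht
  have e1 : p = p' := by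
    refine hinj p hp p' hp' (le_antisymm ?_ ?_) <;> by_contra! hlt
    · exact hw' p hp (between p' hp' q' hq' p hp hlt (by linarith))
    · exact hw p' hp' (between p hp q hq p' hp' hlt (by linarith))
  have e2 : q = q' := by
    refine hinj q hq q' hq' (le_antisymm ?_ ?_) <;> by_contra! hlt
    · exact hw q' hq' (between p hp q hq q' hq' (by linarith) hlt)
    · exact hw' q hq (between p' hp' q' hq' q hq (by linarith) hlt)
  rw [e1, e2]

theorem collinear_eq_of_mem (hu : u ≠ 0) (hv : v ≠ 0) (huv : inner ℝ u v = 0)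
    (hZ : ∀ p ∈ Z, ∀ q ∈ Z, ∃ c : ℝ, q - p = c • u) {E E' : Set Plane}
    (hE : E ∈ consecutiveSegments Z ∪ raysAlong Z v ∪ {E ∈ raysAlong Z u | ∀ w ∈ Z, w ∉ E})
    (hE' : E' ∈ consecutiveSegments Z ∪ raysAlong Z v ∪ {E ∈ raysAlong Z u | ∀ w ∈ Z, w ∉ E})
    {x : Plane} (hx : x ∈ E) (hx' : x ∈ E') : E = E' := by
  have hcr := cross_ne_zero_of_inner_eq_zero hu hv huv
  have hlin : ∀ a b : ℝ, a • u = b • v → a = 0 ∧ b = 0 := by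
    intro a b h
    have h1 := congrArg (cross u) h
    have h2 := congrArg (cross v) h
    simp only [cross_smul, cross_same, mul_zero] at h1 h2
    rw [cross_swap u v] at h2
    constructor
    · exact (mul_eq_zero.1 h2).resolve_right (by simpa using hcr)
    · exact (mul_eq_zero.1 h1.symm).resolve_right (by simpa using hcr)
  have cross_onLine : ∀ F, (F ∈ consecutiveSegments Z ∨ F ∈ raysAlong Z u) → ∀ F' ∈ raysAlong Z v,
      x ∈ F → x ∈ F' → False := by
    intro F hF F' hF' hxF hxF'
    obtain ⟨p', hp', ε', hε', rfl⟩ := mem_raysAlong_iff.1 hF'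
    obtain ⟨s', hs', hxs'⟩ := hxF'
    have : ∃ p ∈ Z, ∃ t : ℝ, x = p + t • u := by
      rcases hF with ⟨p, hp, q, hq, -, -, rfl⟩ | hF
      · obtain ⟨θ, -, -, h⟩ := mem_openSegment_iff.1 hxF
        obtain ⟨c, hc⟩ := hZ p hp q hq
        exact ⟨p, hp, θ * c, by rw [h, hc, smul_smul]⟩
      · obtain ⟨p, hp, ε, -, rfl⟩ := mem_raysAlong_iff.1 hF
        obtain ⟨s, -, h⟩ := hxF
        exact ⟨p, hp, s * ε, by rw [h, smul_smul]⟩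
    obtain ⟨p, hp, t, ht⟩ := this
    obtain ⟨c, hc⟩ := hZ p hp p' hp'
    have : (t - c) • u = (s' * ε') • v := by
      rw [sub_smul, ← hc, mul_smul, ← sub_eq_iff_eq_add'.2 hxs', ht]; abel
    have h2 := (hlin _ _ this).2
    rcases hε' with rfl | rfl <;> · simp at h2; exact hs'.ne' h2
  have end_consecutive : ∀ F ∈ consecutiveSegments Z, ∀ F' ∈ raysAlong Z u, (∀ w ∈ Z, w ∉ F') →
      x ∈ F → x ∈ F' → False := by
    rintro F ⟨p, hp, q, hq, -, -, rfl⟩ F' hF' hw hxF hxF'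
    obtain ⟨p', hp', ε', hε', rfl⟩ := mem_raysAlong_iff.1 hF'
    obtain ⟨s, hs, hxs⟩ := hxF'
    obtain ⟨θ, h0, h1, hθ⟩ := mem_openSegment_iff.1 hxF
    have hε2 : ε' * ε' = 1 := by rcases hε' with rfl | rfl <;> norm_num
    -- A ray along the line that avoids `Z` has all of `Z` at or behind its starting point, hence
    -- also every segment between points of `Z`.
    have out : ∀ w ∈ Z, ∀ c : ℝ, w - p' = c • u → ε' * c ≤ 0 := by
      intro w hwZ c hc
      by_contra! hpos
      refine hw w hwZ ⟨ε' * c, hpos, ?_⟩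
      rw [smul_smul, mul_right_comm, hε2, one_mul, ← hc]; abel
    obtain ⟨c, hc⟩ := hZ p' hp' p hp
    obtain ⟨e, he⟩ := hZ p' hp' q hq
    have k1 := out p hp c hc
    have k2 := out q hq e he
    have : (s * ε') • u = (c + θ * (e - c)) • u := by
      rw [mul_smul, ← sub_eq_iff_eq_add'.2 hxs, add_smul, mul_smul, sub_smul, ← hc, ← he, hθ]
      module
    have h3 := smul_left_injective ℝ hu this
    have h4 : s = (1 - θ) * (ε' * c) + θ * (ε' * e) := by
      linear_combination ε' * h3 - s * hε2
    nlinarith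
  rcases hE with (hE | hE) | ⟨hE, hEw⟩ <;> rcases hE' with (hE' | hE') | ⟨hE', hEw'⟩
  · exact consecutive_eq_of_mem hu hZ hE hE' hx hx'
  · exact (cross_onLine E (.inl hE) E' hE' hx hx').elim
  · exact (end_consecutive E hE E' hE' hEw' hx hx').elim
  · exact (cross_onLine E' (.inl hE') E hE hx' hx).elim
  · obtain ⟨p, hp, ε, hε, rfl⟩ := mem_raysAlong_iff.1 hE
    obtain ⟨p', hp', ε', hε', rfl⟩ := mem_raysAlong_iff.1 hE'
    obtain ⟨s, hs, hxs⟩ := hx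
    obtain ⟨s', hs', hxs'⟩ := hx'
    obtain ⟨c, hc⟩ := hZ p hp p' hp'
    have : c • u = (s * ε - s' * ε') • v := by
      rw [sub_smul, mul_smul, mul_smul, ← hc, ← sub_eq_iff_eq_add'.2 hxs,
        ← sub_eq_iff_eq_add'.2 hxs']; abel
    obtain ⟨rfl, h2⟩ := hlin _ _ this
    rw [zero_smul, sub_eq_zero] at hc
    rw [hc]
    rcases hε with rfl | rfl <;> rcases hε' with rfl | rfl <;> first | rfl | (exfalso; linarith)
  · exact (cross_onLine E' (.inr hE') E hE hx' hx).elim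
  · exact (end_consecutive E' hE' E hE hEw hx' hx).elim
  · exact (cross_onLine E (.inr hE) E' hE' hx hx').elim
  · obtain ⟨p, hp, ε, hε, rfl⟩ := mem_raysAlong_iff.1 hE
    obtain ⟨p', hp', ε', hε', rfl⟩ := mem_raysAlong_iff.1 hE'
    obtain ⟨s, hs, hxs⟩ := hx
    obtain ⟨s', hs', hxs'⟩ := hx'
    obtain ⟨c, hc⟩ := hZ p hp p' hp'
    have : c • u = (s * ε - s' * ε') • u := by
      rw [sub_smul, mul_smul, mul_smul, ← hc, ← sub_eq_iff_eq_add'.2 hxs,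
        ← sub_eq_iff_eq_add'.2 hxs']; abel
    have h2 := smul_left_injective ℝ hu this
    have hε2 : ε * ε = 1 := by rcases hε with rfl | rfl <;> norm_num
    have hε2' : ε' * ε' = 1 := by rcases hε' with rfl | rfl <;> norm_num
    -- Neither ray contains the starting point of the other. Rays with a common point and opposite
    -- directions would violate this, and for equal directions it forces equal starting points.
    have k1 : ε * c ≤ 0 := by
      by_contra! hpos
      refine hEw p' hp' ⟨ε * c, hpos, ?_⟩
      rw [smul_smul, mul_right_comm, hε2, one_mul, ← hc]; abel
    have k2 : 0 ≤ ε' * c := by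
      by_contra! hneg
      refine hEw' p hp ⟨-(ε' * c), by linarith, ?_⟩
      rw [smul_smul, neg_mul, mul_right_comm, hε2', one_mul, neg_smul, ← hc]; abel
    have hee : ε = ε' := by
      rcases hε with rfl | rfl <;> rcases hε' with rfl | rfl <;> first | rfl | (exfalso; linarith)
    subst hee
    have hc0 : c = 0 := by
      have := le_antisymm k1 k2
      calc c = ε * (ε * c) := by rw [← mul_assoc, hε2, one_mul]
        _ = 0 := by rw [this, mul_zero]
    rw [hc0, zero_smul, sub_eq_zero] at hc
    rw [hc]

theorem isProper_collinearWithEnds (hu : u ≠ 0) (hv : v ≠ 0) (huv : inner ℝ u v = 0)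
    (hZ : ∀ p ∈ Z, ∀ q ∈ Z, ∃ c : ℝ, q - p = c • u) :
    IsProperEdgeCollection Z
      (consecutiveSegments Z ∪ raysAlong Z v ∪ {E ∈ raysAlong Z u | ∀ w ∈ Z, w ∉ E}) where
  finite := ((finite_consecutiveSegments Z).union (finite_raysAlong Z v)).union
    ((finite_raysAlong Z u).subset (Set.sep_subset _ _))
  notMem := by
    rintro E ((⟨p, hp, q, hq, -, hw, rfl⟩ | hE) | ⟨-, hw⟩) x hx hxZ
    · exact hw x hxZ hx
    · obtain ⟨p, hp, ε, hε, rfl⟩ := mem_raysAlong_iff.1 hE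
      obtain ⟨s, hs, rfl⟩ := hx
      obtain ⟨c, hc⟩ := hZ p hp _ hxZ
      have := congrArg (cross u) hc
      rcases hε with rfl | rfl <;>
        simp [hs.ne', cross_ne_zero_of_inner_eq_zero hu hv huv] at this
    · exact hw x hxZ hx
  eq_of_mem E hE E' hE' x hx hx' := collinear_eq_of_mem hu hv huv hZ hE hE' hx hx'
  straight := by
    rintro E ((⟨p, hp, q, hq, hpq, -, rfl⟩ | ⟨p, hp, rfl | rfl⟩) | ⟨⟨p, hp, rfl | rfl⟩, -⟩)
    · exact .inl ⟨p, hp, q, hq, hpq, rfl⟩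
    · exact .inr ⟨p, hp, v, hv, rfl⟩
    · exact .inr ⟨p, hp, -v, neg_ne_zero.2 hv, rfl⟩
    · exact .inr ⟨p, hp, u, hu, rfl⟩
    · exact .inr ⟨p, hp, -u, neg_ne_zero.2 hu, rfl⟩
  exists_germ z hz _ hd _ hσ := exists_germ_of_opposite hv
    (isGerm_openRay (.inl (.inr ⟨z, hz, .inl rfl⟩)))
    (isGerm_openRay (.inl (.inr ⟨z, hz, .inr rfl⟩))) hd hσ

theorem isProper_collinear (hu : u ≠ 0) (hv : v ≠ 0) (huv : inner ℝ u v = 0)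
    (hZ : ∀ p ∈ Z, ∀ q ∈ Z, ∃ c : ℝ, q - p = c • u) :
    IsProperEdgeCollection Z (consecutiveSegments Z ∪ raysAlong Z v) where
  finite := (isProper_collinearWithEnds hu hv huv hZ).finite.subset Set.subset_union_left
  notMem E hE := (isProper_collinearWithEnds hu hv huv hZ).notMem E (.inl hE)
  eq_of_mem E hE E' hE' :=
    (isProper_collinearWithEnds hu hv huv hZ).eq_of_mem E (.inl hE) E' (.inl hE')
  straight E hE := (isProper_collinearWithEnds hu hv huv hZ).straight E (.inl hE)
  exists_germ z hz _ hd _ hσ := exists_germ_of_opposite hv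
    (isGerm_openRay (.inr ⟨z, hz, .inl rfl⟩)) (isGerm_openRay (.inr ⟨z, hz, .inr rfl⟩)) hd hσ

end IsEdgeCollection

/-! ### Edges of a triangulation -/

namespace IsTriangulation

variable {Z : Finset Plane} {K : Geometry.SimplicialComplex ℝ Plane}

theorem subset_of_mem_faces (hK : IsTriangulation Z K) {s : Finset Plane} (hs : s ∈ K.faces) :
    s ⊆ Z := by
  intro x hx
  have : x ∈ K.vertices :=
    K.down_closed hs (Finset.singleton_subset_iff.2 hx) (Finset.singleton_nonempty x)
  rw [hK.1] at this
  exact this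

theorem finite_faces (hK : IsTriangulation Z K) : K.faces.Finite :=
  Z.powerset.finite_toSet.subset fun _ hs => by
    simpa using hK.subset_of_mem_faces hs

theorem mem_face_iff (hK : IsTriangulation Z K) {s : Finset Plane} (hs : s ∈ K.faces) {z : Plane}
    (hz : z ∈ Z) : z ∈ convexHull ℝ (s : Set Plane) ↔ z ∈ s :=
  K.vertex_mem_convexHull_iff (by rw [hK.1]; exact hz) hs

theorem openSegment_subset_hull (hK : IsTriangulation Z K) {E : Set Plane}
    (hE : E ∈ triangulationEdges K) : E ⊆ convexHull ℝ (Z : Set Plane) := by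
  obtain ⟨p, q, -, hs, rfl⟩ := hE
  rw [← hK.2]
  refine ((openSegment_subset_segment ..).trans ?_).trans (K.convexHull_subset_space hs)
  rw [Finset.coe_pair, convexHull_pair]

theorem finite_edges (hK : IsTriangulation Z K) : (triangulationEdges K).Finite := by
  refine ((Z ×ˢ Z).finite_toSet.image fun pq => openSegment ℝ pq.1 pq.2).subset ?_
  rintro E ⟨p, q, -, hs, rfl⟩
  have := hK.subset_of_mem_faces hs
  exact ⟨(p, q), by simp [this (Finset.mem_insert_self p _),
    this (Finset.mem_insert_of_mem (Finset.mem_singleton_self q))], rfl⟩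

theorem notMem_edge (hK : IsTriangulation Z K) {E : Set Plane} (hE : E ∈ triangulationEdges K)
    {x : Plane} (hx : x ∈ E) : x ∉ Z := by
  intro hxZ
  obtain ⟨p, q, hpq, hs, rfl⟩ := hE
  have : x ∈ convexHull ℝ (({p, q} : Finset Plane) : Set Plane) := by
    rw [Finset.coe_pair, convexHull_pair]
    exact openSegment_subset_segment _ _ _ hx
  rw [hK.mem_face_iff hs hxZ, Finset.mem_insert, Finset.mem_singleton] at this
  rcases this with rfl | rfl
  · exact hpq (left_mem_openSegment_iff.1 hx)
  · exact hpq (right_mem_openSegment_iff.1 hx)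

/-- Two faces meet in the hull of their common vertices. A point inside an edge is neither of its
end points, so both end points must be common. -/
theorem edge_eq_of_mem {E E' : Set Plane} (hE : E ∈ triangulationEdges K)
    (hE' : E' ∈ triangulationEdges K) {x : Plane} (hx : x ∈ E) (hx' : x ∈ E') : E = E' := by
  obtain ⟨p, q, hpq, hs, rfl⟩ := hE
  obtain ⟨p', q', hpq', hs', rfl⟩ := hE'
  have hmem : ∀ {a b : Plane}, x ∈ openSegment ℝ a b →
      x ∈ convexHull ℝ (({a, b} : Finset Plane) : Set Plane) := by
    intro a b h
    rw [Finset.coe_pair, convexHull_pair]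
    exact openSegment_subset_segment _ _ _ h
  have hint := K.inter_subset_convexHull hs hs' ⟨hmem hx, hmem hx'⟩
  rw [Finset.coe_pair, Finset.coe_pair] at hint
  have single : ∀ {a : Plane}, ({p, q} ∩ {p', q'} : Set Plane) ⊆ {a} → x = a := by
    intro a h
    simpa using convexHull_mono (𝕜 := ℝ) h hint
  have hp : p ∈ ({p', q'} : Set Plane) := by
    by_contra hn
    have : x = q := single (by
      rintro y ⟨rfl | rfl, h2⟩
      · exact (hn h2).elim
      · rfl)
    subst this
    exact hpq (right_mem_openSegment_iff.1 hx)
  have hq : q ∈ ({p', q'} : Set Plane) := by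
    by_contra hn
    have : x = p := single (by
      rintro y ⟨rfl | rfl, h2⟩
      · rfl
      · exact (hn h2).elim)
    subst this
    exact hpq (left_mem_openSegment_iff.1 hx)
  rcases hp with rfl | rfl <;> rcases hq with rfl | rfl
  · exact (hpq rfl).elim
  · rfl
  · exact openSegment_symm ..
  · exact (hpq rfl).elim

end IsTriangulation

/-! ### Bisectors of the outer angles -/

section Bisector

/-- The direction of the interior bisector of the angle spanned by `P` and `Q`. -/
noncomputable def bisector (P Q : Plane) : Plane := ‖P‖⁻¹ • P + ‖Q‖⁻¹ • Q

/-- By Cauchy–Schwarz the unit vector along one generator has inner product at least `-‖B‖` with the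
other generator `B`, and this is compensated by the contribution of `B` itself. Hence the cone lies
in the half plane defined by its bisector. -/
theorem inner_bisector_nonneg (P Q : Plane) {a b : ℝ} (ha : 0 ≤ a) (hb : 0 ≤ b) :
    0 ≤ inner ℝ (bisector P Q) (a • P + b • Q) := by
  have unit_le : ∀ A B : Plane, -‖B‖ ≤ inner ℝ (‖A‖⁻¹ • A) B := by
    intro A B
    have h := abs_real_inner_le_norm (‖A‖⁻¹ • A) B
    have h1 : ‖(‖A‖⁻¹ • A)‖ ≤ 1 := by
      rw [norm_smul, norm_inv, norm_norm]
      exact inv_mul_le_one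
    have := (abs_le.1 h).1
    nlinarith [norm_nonneg B]
  have self : ∀ A : Plane, inner ℝ (‖A‖⁻¹ • A) A = ‖A‖ := by
    intro A
    rw [real_inner_smul_left, real_inner_self_eq_norm_sq]
    rcases eq_or_ne (‖A‖) 0 with h | h
    · simp [h]
    · field_simp
  rw [bisector, inner_add_right, real_inner_smul_right, real_inner_smul_right, inner_add_left,
    inner_add_left, self, self]
  nlinarith [unit_le P Q, unit_le Q P]

theorem cross_ne_zero_of_linearIndependent {P Q : Plane} (h : LinearIndependent ℝ ![P, Q]) :
    cross P Q ≠ 0 := by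
  intro hc
  have hP : P ≠ 0 := h.ne_zero 0
  obtain ⟨c, hc⟩ := exists_smul_of_cross_eq_zero hP hc
  have := LinearIndependent.pair_iff.1 h c (-1) (by rw [hc]; module)
  norm_num at this

theorem linearIndependent_of_cross_ne_zero {P Q : Plane} (h : cross P Q ≠ 0) :
    LinearIndependent ℝ ![P, Q] := by
  refine LinearIndependent.pair_iff.2 fun s t hst => ?_
  have h1 := congrArg (cross P) hst
  have h2 := congrArg (cross Q) hst
  simp only [cross_add, cross_smul, cross_same, cross_zero, mul_zero, zero_add, add_zero,
    cross_swap P Q, mul_eq_zero, neg_eq_zero, h, or_false] at h1 h2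
  exact ⟨h2, h1⟩

theorem bisector_ne_zero {P Q : Plane} (h : cross P Q ≠ 0) : bisector P Q ≠ 0 := by
  intro h0
  have hQ : Q ≠ 0 := by rintro rfl; simp at h
  have := congrArg (cross P) h0
  simp [bisector, cross_same, h, hQ] at this

theorem bisector_comm (P Q : Plane) : bisector P Q = bisector Q P := add_comm _ _

theorem bisector_smul {a b : ℝ} (ha : 0 < a) (hb : 0 < b) (P Q : Plane) :
    bisector (a • P) (b • Q) = bisector P Q := by
  have : ∀ {c : ℝ} (_ : 0 < c) (A : Plane), ‖c • A‖⁻¹ • c • A = ‖A‖⁻¹ • A := by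
    intro c hc A
    rw [norm_smul, smul_smul, Real.norm_of_nonneg hc.le, mul_inv, mul_right_comm,
      inv_mul_cancel₀ hc.ne', one_mul]
  rw [bisector, bisector, this ha, this hb]

/-- Two planar cones that contain the generators of each other have the same bisector. -/
theorem bisector_eq_of_cone {P Q P' Q' : Plane} (h : LinearIndependent ℝ ![P, Q])
    (h' : LinearIndependent ℝ ![P', Q'])
    {a b c d a' b' c' d' : ℝ} (ha : 0 ≤ a) (hb : 0 ≤ b) (hc : 0 ≤ c) (hd : 0 ≤ d) (ha' : 0 ≤ a')
    (hb' : 0 ≤ b') (hc' : 0 ≤ c') (hd' : 0 ≤ d') (e1 : P' = a • P + b • Q)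
    (e2 : Q' = c • P + d • Q) (e3 : P = a' • P' + b' • Q') (e4 : Q = c' • P' + d' • Q') :
    bisector P' Q' = bisector P Q := by
  have hP' : P' ≠ 0 := h'.ne_zero 0
  have hQ' : Q' ≠ 0 := h'.ne_zero 1
  have indep := LinearIndependent.pair_iff.1 h
  -- The two coordinate changes are inverse matrices with non-negative entries. The off-diagonal
  -- entries of their product are sums of non-negative terms equal to zero, so every term vanishes.
  -- Thus `P'` and `Q'` are positive multiples of `P` and `Q`, in one order or the other.
  have k1 := indep (a' * a + b' * c - 1) (a' * b + b' * d) (by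
    have : (0 : Plane) = (a' • P' + b' • Q') - P := by rw [← e3, sub_self]
    rw [this, e1, e2]; module)
  have k2 := indep (c' * a + d' * c) (c' * b + d' * d - 1) (by
    have : (0 : Plane) = (c' • P' + d' • Q') - Q := by rw [← e4, sub_self]
    rw [this, e1, e2]; module)
  obtain ⟨k11, k12⟩ := k1
  obtain ⟨k21, k22⟩ := k2
  have m1 : a' * b = 0 := by nlinarith [mul_nonneg ha' hb, mul_nonneg hb' hd]
  have m2 : b' * d = 0 := by nlinarith [mul_nonneg ha' hb, mul_nonneg hb' hd]
  have m3 : c' * a = 0 := by nlinarith [mul_nonneg hc' ha, mul_nonneg hd' hc]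
  have m4 : d' * c = 0 := by nlinarith [mul_nonneg hc' ha, mul_nonneg hd' hc]
  rcases mul_eq_zero.1 m1 with rfl | rfl
  · have hc0 : c ≠ 0 := by rintro rfl; norm_num at k11
    have hd0 : d' = 0 := (mul_eq_zero.1 m4).resolve_right hc0
    subst hd0
    have hb0 : b ≠ 0 := by rintro rfl; norm_num at k22
    have hc'0 : c' ≠ 0 := by rintro rfl; norm_num at k22
    have hb'0 : b' ≠ 0 := by rintro rfl; norm_num at k11
    have ha0 : a = 0 := (mul_eq_zero.1 m3).resolve_left hc'0
    have hd0 : d = 0 := (mul_eq_zero.1 m2).resolve_left hb'0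
    subst ha0 hd0
    rw [e1, e2, zero_smul, zero_add, zero_smul, add_zero, bisector_comm,
      bisector_smul (hc.lt_of_ne' hc0) (hb.lt_of_ne' hb0)]
  · have ha0 : a ≠ 0 := by rintro rfl; simp at e1; exact hP' e1
    have hc0 : c' = 0 := (mul_eq_zero.1 m3).resolve_right ha0
    subst hc0
    have hd0 : d ≠ 0 := by rintro rfl; norm_num at k22
    have hd'0 : d' ≠ 0 := by rintro rfl; norm_num at k22
    have hc0 : c = 0 := (mul_eq_zero.1 m4).resolve_left hd'0
    subst hc0
    rw [e1, e2, zero_smul, zero_smul, zero_add, add_zero,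
      bisector_smul (ha.lt_of_ne' ha0) (hd.lt_of_ne' hd0)]

variable {Z : Finset Plane}

theorem mem_outerBisectors_iff {E : Set Plane} : E ∈ outerBisectors Z ↔
    ∃ z ∈ Z, ∃ p ∈ Z, ∃ q ∈ Z, LinearIndependent ℝ ![p - z, q - z] ∧
    (∀ w ∈ Z, ∃ a b : ℝ, 0 ≤ a ∧ 0 ≤ b ∧ w - z = a • (p - z) + b • (q - z)) ∧
    E = openRay z (-bisector (p - z) (q - z)) := Iff.rfl

theorem inner_bisector_nonneg_of_mem_convexHull {z p q : Plane}
    (hcone : ∀ w ∈ Z, ∃ a b : ℝ, 0 ≤ a ∧ 0 ≤ b ∧ w - z = a • (p - z) + b • (q - z))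
    {w : Plane} (hw : w ∈ convexHull ℝ (Z : Set Plane)) :
    0 ≤ inner ℝ (bisector (p - z) (q - z)) (w - z) := by
  have : convexHull ℝ (Z : Set Plane) ⊆
      {w | inner ℝ (bisector (p - z) (q - z)) z ≤ inner ℝ (bisector (p - z) (q - z)) w} := by
    refine convexHull_min (fun w hw => ?_)
      (convex_halfSpace_ge (innerₛₗ ℝ (bisector (p - z) (q - z))).isLinear _)
    obtain ⟨a, b, ha, hb, h⟩ := hcone w hw
    have := inner_bisector_nonneg (p - z) (q - z) ha hb
    rw [← h, inner_sub_right] at this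
    exact sub_nonneg.1 this
  rw [inner_sub_right]
  exact sub_nonneg.2 (this hw)

theorem finite_outerBisectors (Z : Finset Plane) : (outerBisectors Z).Finite := by
  refine ((Z ×ˢ Z ×ˢ Z).finite_toSet.image fun t =>
    openRay t.1 (-bisector (t.2.1 - t.1) (t.2.2 - t.1))).subset ?_
  rintro E ⟨z, hz, p, hp, q, hq, -, -, rfl⟩
  exact ⟨(z, p, q), by simp [hz, hp, hq], rfl⟩

/-- The interior bisector defines a half plane through `z` that contains the hull, while the
opposite ray leaves this half plane at once. -/
theorem notMem_convexHull_of_mem_outerBisectors {E : Set Plane} (hE : E ∈ outerBisectors Z)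
    {x : Plane} (hx : x ∈ E) : x ∉ convexHull ℝ (Z : Set Plane) := by
  intro hxh
  obtain ⟨z, hz, p, hp, q, hq, hli, hcone, rfl⟩ := mem_outerBisectors_iff.1 hE
  obtain ⟨s, hs, rfl⟩ := hx
  have h := inner_bisector_nonneg_of_mem_convexHull hcone hxh
  have hB := Plane.inner_self_pos (bisector_ne_zero (cross_ne_zero_of_linearIndependent hli))
  rw [add_sub_cancel_left, real_inner_smul_right, inner_neg_right] at h
  nlinarith

/-- If rays from `z` and `z'` meet, then `z' - z` is a difference of positive multiples of the two
interior bisectors. The supporting half planes at `z` and `z'` give `⟨z' - z, z' - z⟩ ≤ 0`, so `z =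
z'`. Both descriptions then generate the same cone, which has only one bisector. -/
theorem outerBisectors_eq_of_mem {E E' : Set Plane} (hE : E ∈ outerBisectors Z)
    (hE' : E' ∈ outerBisectors Z) {x : Plane} (hx : x ∈ E) (hx' : x ∈ E') : E = E' := by
  obtain ⟨z, hz, p, hp, q, hq, hli, hcone, rfl⟩ := mem_outerBisectors_iff.1 hE
  obtain ⟨z', hz', p', hp', q', hq', hli', hcone', rfl⟩ := mem_outerBisectors_iff.1 hE'
  obtain ⟨s, hs, hxs⟩ := hx
  obtain ⟨s', hs', hxs'⟩ := hx'
  have hzz : z = z' := by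
    have h1 := inner_bisector_nonneg_of_mem_convexHull hcone (subset_convexHull ℝ _ hz')
    have h2 := inner_bisector_nonneg_of_mem_convexHull hcone' (subset_convexHull ℝ _ hz)
    have h3 : z' - z = s' • bisector (p' - z') (q' - z') - s • bisector (p - z) (q - z) := by
      have : z + s • -bisector (p - z) (q - z) = z' + s' • -bisector (p' - z') (q' - z') :=
        hxs.symm.trans hxs'
      linear_combination (norm := module) -this
    by_contra hne
    have h4 := Plane.inner_self_pos (sub_ne_zero.2 (Ne.symm hne))
    nth_rw 1 [h3] at h4
    rw [inner_sub_left, real_inner_smul_left, real_inner_smul_left] at h4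
    rw [← neg_sub z' z, inner_neg_right] at h2
    nlinarith
  subst hzz
  obtain ⟨a, b, ha, hb, e1⟩ := hcone p' hp'
  obtain ⟨c, d, hc, hd, e2⟩ := hcone q' hq'
  obtain ⟨a', b', ha', hb', e3⟩ := hcone' p hp
  obtain ⟨c', d', hc', hd', e4⟩ := hcone' q hq
  rw [bisector_eq_of_cone hli hli' ha hb hc hd ha' hb' hc' hd' e1 e2 e3 e4]

end Bisector

/-! ### Sectors at the vertices of a triangulation -/

namespace IsTriangulation

variable {Z : Finset Plane} {K : Geometry.SimplicialComplex ℝ Plane}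

theorem isGerm_of_pair_mem_faces {z q : Plane} (hzq : z ≠ q) (h : {z, q} ∈ K.faces)
    (B : Set (Set Plane)) : IsGerm (triangulationEdges K ∪ B) z (q - z) := by
  refine ⟨1, one_pos, fun τ h0 h1 => ⟨_, .inl ⟨z, q, hzq, h, rfl⟩, ?_⟩⟩
  exact mem_openSegment_iff.2 ⟨τ, h0, h1, rfl⟩

/-- Close to a vertex `z`, a triangulated set is covered by the faces at `z`. -/
theorem exists_face_of_inward (hK : IsTriangulation Z K) {z d : Plane} (hz : z ∈ Z) {ε : ℝ}
    (hε : 0 < ε) (hd : z + ε • d ∈ convexHull ℝ (Z : Set Plane)) :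
    ∃ s ∈ K.faces, z ∈ s ∧ ∃ ε' : ℝ, 0 < ε' ∧ z + ε' • d ∈ convexHull ℝ (s : Set Plane) := by
  -- The finitely many faces that miss `z` form a closed set not containing `z`, so points close
  -- enough to `z` lie only in faces at `z`.
  have hclosed : IsClosed (⋃ s ∈ {s ∈ K.faces | z ∉ s}, convexHull ℝ (s : Set Plane)) :=
    (hK.finite_faces.subset (Set.sep_subset _ _)).isClosed_biUnion fun s _ =>
      s.finite_toSet.isClosed_convexHull ℝ
  have hzn : z ∉ ⋃ s ∈ {s ∈ K.faces | z ∉ s}, convexHull ℝ (s : Set Plane) := by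
    simp only [Set.mem_iUnion, not_exists]
    rintro s ⟨hs, hzs⟩ h
    exact hzs ((hK.mem_face_iff hs hz).1 h)
  have hcont : Filter.Tendsto (fun t : ℝ => z + t • d) (nhdsWithin 0 (Set.Ioi 0)) (nhds z) := by
    have : Continuous fun t : ℝ => z + t • d := by fun_prop
    have h2 := (this.tendsto 0).mono_left (nhdsWithin_le_nhds (s := Set.Ioi 0))
    simpa using h2
  have h1 := hcont.eventually (hclosed.isOpen_compl.mem_nhds hzn)
  have h2 : ∀ᶠ t : ℝ in nhdsWithin 0 (Set.Ioi 0), t ∈ Set.Ioo 0 ε := Ioo_mem_nhdsGT hε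
  obtain ⟨t, ht1, ht0, htε⟩ := (h1.and h2).exists
  have hmem : z + t • d ∈ convexHull ℝ (Z : Set Plane) := by
    have := (convex_convexHull ℝ (Z : Set Plane)).add_smul_sub_mem
      (subset_convexHull ℝ _ hz) hd (t := t / ε)
      ⟨by positivity, (div_le_one hε).2 htε.le⟩
    rwa [add_sub_cancel_left, smul_smul, div_mul_cancel₀ _ hε.ne'] at this
  rw [← hK.2] at hmem
  obtain ⟨s, hs, hxs⟩ := K.mem_space_iff.1 hmem
  refine ⟨s, hs, ?_, t, ht0, hxs⟩
  by_contra hzs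
  exact ht1 (Set.mem_biUnion (show s ∈ {s ∈ K.faces | z ∉ s} from ⟨hs, hzs⟩) hxs)

/-- A short vector along `d` ends in a face at `z`, so it is a non-negative combination of the edge
directions of that face. These cannot all be on the wrong closed side of `d` without one being a
positive multiple of `d`. -/
theorem exists_germ_of_inward (hK : IsTriangulation Z K) (B : Set (Set Plane)) {z d : Plane}
    (hz : z ∈ Z) (hd0 : d ≠ 0) {ε : ℝ} (hε : 0 < ε)
    (hd : z + ε • d ∈ convexHull ℝ (Z : Set Plane)) {σ : ℝ} (hσ : σ ≠ 0) :
    ∃ q ∈ Z, (0 < σ * cross d (q - z) ∨ ∃ c : ℝ, 0 < c ∧ q - z = c • d) ∧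
      IsGerm (triangulationEdges K ∪ B) z (q - z) := by
  obtain ⟨s, hs, hzs, ε', hε', hmem⟩ := hK.exists_face_of_inward hz hε hd
  obtain ⟨w, hw0, hw1, hw⟩ := Finset.mem_convexHull'.1 hmem
  have hsum : ε' • d = ∑ y ∈ s, w y • (y - z) := by
    simp_rw [smul_sub, Finset.sum_sub_distrib, hw, ← Finset.sum_smul, hw1]
    module
  have germ : ∀ q ∈ s, q ≠ z → q ∈ Z ∧ IsGerm (triangulationEdges K ∪ B) z (q - z) := by
    intro q hq hne
    refine ⟨hK.subset_of_mem_faces hs hq, isGerm_of_pair_mem_faces hne.symm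
      (K.down_closed hs ?_ (Finset.insert_nonempty ..)) B⟩
    intro y hy
    rcases Finset.mem_insert.1 hy with rfl | hy
    · exact hzs
    · rw [Finset.mem_singleton.1 hy]; exact hq
  by_contra! hcon
  have hle : ∀ q ∈ s, σ * cross d (q - z) ≤ 0 := by
    intro q hq
    rcases eq_or_ne q z with rfl | hne
    · simp
    · by_contra! hpos
      exact hcon q (germ q hq hne).1 (.inl hpos) (germ q hq hne).2
  have hcol : ∀ q ∈ s, ∀ c : ℝ, q - z = c • d → c ≤ 0 := by
    intro q hq c hc
    by_contra! hpos
    refine hcon q (germ q hq ?_).1 (.inr ⟨c, hpos, hc⟩) (germ q hq ?_).2 <;>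
    · rintro rfl
      rw [sub_self, eq_comm, smul_eq_zero] at hc
      exact hc.elim hpos.ne' hd0
  have hdd := Plane.inner_self_pos hd0
  have hinner : ε' * inner ℝ d d = ∑ y ∈ s, w y * inner ℝ d (y - z) := by
    rw [← real_inner_smul_right, hsum, inner_sum]
    simp_rw [real_inner_smul_right]
  have hcross : (0 : ℝ) = ∑ y ∈ s, w y * (σ * cross d (y - z)) := by
    have := congrArg (fun x => σ * cross d x) hsum
    have hlin : ∀ t : Finset Plane, cross d (∑ y ∈ t, w y • (y - z)) =
        ∑ y ∈ t, w y * cross d (y - z) := by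
      intro t
      induction t using Finset.induction_on with
      | empty => simp
      | insert a t ha ih => rw [Finset.sum_insert ha, Finset.sum_insert ha, cross_add, ih, cross_smul]
    simp only [hlin, cross_smul, cross_same, mul_zero, Finset.mul_sum] at this
    rw [this]
    exact Finset.sum_congr rfl fun y _ => by ring
  -- The components transverse to `d` have one sign and sum to zero. So every contributing edge
  -- direction is a non-positive multiple of `d`, and their sum cannot be a positive one.
  have hzero : ∀ y ∈ s, w y * (σ * cross d (y - z)) = 0 :=
    (Finset.sum_eq_zero_iff_of_nonpos fun y hy =>
      mul_nonpos_of_nonneg_of_nonpos (hw0 y hy) (hle y hy)).1 hcross.symm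
  have hnonpos : ∑ y ∈ s, w y * inner ℝ d (y - z) ≤ 0 := by
    refine Finset.sum_nonpos fun y hy => ?_
    rcases mul_eq_zero.1 (hzero y hy) with h | h
    · rw [h, zero_mul]
    · obtain ⟨c, hc⟩ := exists_smul_of_cross_eq_zero hd0 ((mul_eq_zero.1 h).resolve_left hσ)
      rw [hc, real_inner_smul_right]
      exact mul_nonpos_of_nonneg_of_nonpos (hw0 y hy)
        (mul_nonpos_of_nonpos_of_nonneg (hcol y hy c hc) hdd.le)
  have := mul_pos hε' hdd
  linarith

end IsTriangulation

/-- If some direction `d` is not in the cone generated by `Z - z`, then this cone has a boundary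
ray on the side `σ` that is spanned by a point of `Z`. -/
theorem exists_extreme {Z : Finset Plane} {z d : Plane} (hZ : ∃ w ∈ Z, w ≠ z) (hd : d ≠ 0)
    (hcone : ∀ p ∈ Z, ∀ q ∈ Z, ∀ a b k : ℝ, 0 ≤ a → 0 ≤ b → 0 < k →
      a • (p - z) + b • (q - z) ≠ k • d) {σ : ℝ} (hσ : σ ≠ 0) :
    ∃ p ∈ Z, p ≠ z ∧ ∀ v ∈ Z, 0 ≤ σ * cross (p - z) (v - z) := by
  have hdd := Plane.inner_self_pos hd
  -- Up to positive scaling, `X` is the coordinate along `d` and `Y` the transverse one, positive on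
  -- the side `σ`. The quotient `X / Y` is a multiple of the cotangent of the angle with `d`, so
  -- extreme directions are found by maximising it.
  let X (v : Plane) : ℝ := inner ℝ d (v - z)
  let Y (v : Plane) : ℝ := σ * cross d (v - z)
  have key : ∀ p v : Plane, inner ℝ d d * (σ * cross (p - z) (v - z)) = X p * Y v - Y p * X v := by
    intro p v
    simp only [X, Y]
    linear_combination σ * inner_mul_cross d (p - z) (v - z)
  have expand : ∀ v : Plane, Y v = 0 → ∃ c : ℝ, v - z = c • d ∧ X v = c * inner ℝ d d := by
    intro v hv
    obtain ⟨c, hc⟩ := exists_smul_of_cross_eq_zero hd ((mul_eq_zero.1 hv).resolve_left hσ)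
    exact ⟨c, hc, by simp only [X]; rw [hc, real_inner_smul_right]⟩
  have Xneg : ∀ v ∈ Z, Y v = 0 → X v ≤ 0 := by
    intro v hv hY
    obtain ⟨c, hc, hX⟩ := expand v hY
    by_contra! hpos
    have hc0 : 0 < c := by rw [hX] at hpos; exact pos_of_mul_pos_left hpos hdd.le
    exact hcone v hv v hv 1 0 c (by norm_num) le_rfl hc0 (by rw [hc]; module)
  suffices h : ∃ p ∈ Z, p ≠ z ∧ ∀ v ∈ Z, 0 ≤ X p * Y v - Y p * X v by
    obtain ⟨p, hp, hpz, h⟩ := h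
    refine ⟨p, hp, hpz, fun v hv => ?_⟩
    have := h v hv
    rw [← key] at this
    exact nonneg_of_mul_nonneg_right this hdd
  have ne_of_Y : ∀ v, Y v ≠ 0 → v ≠ z := by
    rintro v h rfl
    simp [Y] at h
  by_cases hA : ∃ v ∈ Z, 0 < Y v
  · obtain ⟨p, hp, hmax⟩ := (Z.filter fun v => 0 < Y v).exists_max_image (fun v => X v / Y v)
      (by obtain ⟨v, hv, h⟩ := hA; exact ⟨v, by simp [hv, h]⟩)
    obtain ⟨hpZ, hpY⟩ := Finset.mem_filter.1 hp
    refine ⟨p, hpZ, ne_of_Y p hpY.ne', fun v hv => ?_⟩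
    rcases lt_trichotomy (Y v) 0 with hY | hY | hY
    · by_contra! hneg
      have hcr : cross d (-Y v • (p - z) + Y p • (v - z)) = 0 := by
        simp only [cross_add, cross_smul, Y]; ring
      obtain ⟨c, hc⟩ := exists_smul_of_cross_eq_zero hd hcr
      have hin := congrArg (inner ℝ d) hc
      rw [inner_add_right, real_inner_smul_right, real_inner_smul_right,
        real_inner_smul_right] at hin
      have hc0 : 0 < c := by
        have : 0 < c * inner ℝ d d := by
          rw [← hin]; simp only [X] at hneg; linarith
        exact pos_of_mul_pos_left this hdd.le
      exact hcone p hpZ v hv _ _ c (by linarith) hpY.le hc0 hc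
    · rw [hY, mul_zero, zero_sub]
      nlinarith [Xneg v hv hY]
    · have := hmax v (Finset.mem_filter.2 ⟨hv, hY⟩)
      rw [div_le_div_iff₀ hY hpY] at this
      linarith
  · push Not at hA
    by_cases hB : ∃ v ∈ Z, v ≠ z ∧ Y v = 0
    · obtain ⟨p, hpZ, hpz, hY⟩ := hB
      refine ⟨p, hpZ, hpz, fun v hv => ?_⟩
      rw [hY, zero_mul, sub_zero]
      exact mul_nonneg_of_nonpos_of_nonpos (Xneg p hpZ hY) (hA v hv)
    · push Not at hB
      obtain ⟨w, hw, hwz⟩ := hZ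
      have neg : ∀ v ∈ Z, v ≠ z → Y v < 0 := fun v hv hvz => (hA v hv).lt_of_ne (hB v hv hvz)
      -- All directions are strictly on the side opposite to `σ`; the same maximum now selects the
      -- one at the largest angle from `d`.
      obtain ⟨p, hp, hmax⟩ := (Z.filter fun v => v ≠ z).exists_max_image (fun v => X v / Y v)
        ⟨w, by simp [hw, hwz]⟩
      obtain ⟨hpZ, hpz⟩ := Finset.mem_filter.1 hp
      refine ⟨p, hpZ, hpz, fun v hv => ?_⟩
      rcases eq_or_ne v z with rfl | hvz
      · simp [X, Y]
      · have := hmax v (Finset.mem_filter.2 ⟨hv, hvz⟩)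
        rw [← neg_div_neg_eq, ← neg_div_neg_eq (X p),
          div_le_div_iff₀ (by linarith [neg v hv hvz]) (by linarith [neg p hpZ hpz])] at this
        linarith

namespace IsTriangulation

variable {Z : Finset Plane} {K : Geometry.SimplicialComplex ℝ Plane}

/-- If `d` points into the hull, a face at `z` provides the edge. Otherwise `z` is on the boundary
and the cone of `Z` at `z` has two extreme rays, both covered by edges near `z`. If they are
opposite they form a line. If they are independent, the outer bisector is an edge, and zero is a
positive combination of the three directions, so they are not contained in a closed half plane
except along its boundary. -/
theorem exists_germ (hK : IsTriangulation Z K) (hZ : ¬ Collinear ℝ (Z : Set Plane)) {z d : Plane}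
    (hz : z ∈ Z) (hd : d ≠ 0) {σ : ℝ} (hσ : σ ≠ 0) :
    ∃ f, (0 < σ * cross d f ∨ ∃ c : ℝ, 0 < c ∧ f = c • d) ∧
      IsGerm (triangulationEdges K ∪ outerBisectors Z) z f := by
  by_cases hin : ∃ ε : ℝ, 0 < ε ∧ z + ε • d ∈ convexHull ℝ (Z : Set Plane)
  · obtain ⟨ε, hε, h⟩ := hin
    obtain ⟨q, -, h1, h2⟩ := hK.exists_germ_of_inward (outerBisectors Z) hz hd hε h hσ
    exact ⟨_, h1, h2⟩
  push Not at hin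
  have hcone : ∀ p ∈ Z, ∀ q ∈ Z, ∀ a b k : ℝ, 0 ≤ a → 0 ≤ b → 0 < k →
      a • (p - z) + b • (q - z) ≠ k • d := by
    intro p hp q hq a b k ha hb hk h
    have hconv := convex_convexHull ℝ (Z : Set Plane)
    have hz' := subset_convexHull ℝ (Z : Set Plane) hz
    -- Dividing by `a + b + 1` keeps the coefficients in `[0, 1]`. The midpoint of the two resulting
    -- points is `z` plus a positive multiple of `d`, which `hin` forbids in the hull.
    have step : ∀ w ∈ Z, ∀ c, 0 ≤ c → c ≤ a + b → z + (c / (a + b + 1)) • (w - z) ∈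
        convexHull ℝ (Z : Set Plane) := fun w hw c h0 h1 =>
      hconv.add_smul_sub_mem hz' (subset_convexHull ℝ _ hw)
        ⟨by positivity, (div_le_one (by positivity)).2 (by linarith)⟩
    have := hconv.add_smul_sub_mem (step p hp a ha (by linarith)) (step q hq b hb (by linarith))
      (t := 1 / 2) ⟨by norm_num, by norm_num⟩
    refine hin (k / (2 * (a + b + 1))) (by positivity) ?_
    convert! this using 1
    have e : (k / (2 * (a + b + 1))) • d = (1 / (2 * (a + b + 1))) • (k • d) := by
      rw [smul_smul]; congr 1; ring
    rw [e, ← h]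
    have hne : a + b + 1 ≠ 0 := by positivity
    match_scalars <;> field_simp <;> ring
  have hne : ∃ w ∈ Z, w ≠ z := by
    by_contra! hall
    refine hZ ?_
    have : (Z : Set Plane) ⊆ {z} := fun w hw => hall w hw
    exact (collinear_singleton ℝ z).subset this
  have extreme : ∀ σ' : ℝ, σ' ≠ 0 → ∃ p ∈ Z, p ≠ z ∧ (∀ v ∈ Z, 0 ≤ σ' * cross (p - z) (v - z)) ∧
      IsGerm (triangulationEdges K ∪ outerBisectors Z) z (p - z) := by
    intro σ' hσ'
    obtain ⟨p, hp, hpz, hext⟩ := exists_extreme hne hd hcone hσ'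
    refine ⟨p, hp, hpz, hext, ?_⟩
    have hmem : z + (1 : ℝ) • (p - z) ∈ convexHull ℝ (Z : Set Plane) := by
      rw [one_smul, add_sub_cancel]; exact subset_convexHull ℝ _ hp
    -- The search is made on the side beyond the extreme ray. No point of `Z` is there, so the edge
    -- found runs along the ray itself.
    obtain ⟨q, hq, hor, hgerm⟩ := hK.exists_germ_of_inward (outerBisectors Z) hz
      (sub_ne_zero.2 hpz) one_pos hmem (neg_ne_zero.2 hσ')
    rcases hor with h | ⟨c, hc, h⟩
    · have := hext q hq
      linarith
    · rw [h] at hgerm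
      have := hgerm.smul (inv_pos.2 hc)
      rwa [inv_smul_smul₀ hc.ne'] at this
  obtain ⟨p, hp, hpz, hpext, hpg⟩ := extreme 1 one_ne_zero
  obtain ⟨q, hq, hqz, hqext, hqg⟩ := extreme (-1) (by norm_num)
  simp only [one_mul, neg_mul, Left.nonneg_neg_iff] at hpext hqext
  have hP := sub_ne_zero.2 hpz
  rcases (hpext q hq).eq_or_lt with hD | hD
  · obtain ⟨c, hc⟩ := exists_smul_of_cross_eq_zero hP hD.symm
    rcases lt_trichotomy c 0 with hc0 | rfl | hc0
    · have hg : IsGerm (triangulationEdges K ∪ outerBisectors Z) z (-(p - z)) := by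
        rw [hc] at hqg
        have := hqg.smul (inv_pos.2 (neg_pos.2 hc0))
        rwa [smul_smul, inv_neg, neg_mul, inv_mul_cancel₀ hc0.ne, neg_one_smul] at this
      exact exists_germ_of_opposite hP hpg hg hd hσ
    · rw [zero_smul, sub_eq_zero] at hc
      exact (hqz hc).elim
    -- The two extreme rays coincide, which squeezes all of `Z` onto one line.
    · refine (hZ ?_).elim
      rw [collinear_iff_of_mem (show z ∈ (Z : Set Plane) from hz)]
      refine ⟨p - z, fun v hv => ?_⟩
      have h1 := hpext v hv
      have h2 := hqext v hv
      rw [hc, cross_swap, cross_smul, cross_swap] at h2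
      have h3 : cross (p - z) (v - z) = 0 := by nlinarith
      obtain ⟨r, hr⟩ := exists_smul_of_cross_eq_zero hP h3
      exact ⟨r, by rw [← hr]; simp⟩
  · have hbis : IsGerm (triangulationEdges K ∪ outerBisectors Z) z
        (-bisector (p - z) (q - z)) := by
      refine isGerm_openRay (.inr (mem_outerBisectors_iff.2 ⟨z, hz, p, hp, q, hq,
        linearIndependent_of_cross_ne_zero hD.ne', fun v hv => ?_, rfl⟩))
      refine ⟨-cross (q - z) (v - z) / cross (p - z) (q - z),
        cross (p - z) (v - z) / cross (p - z) (q - z),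
        div_nonneg (by linarith [hqext v hv]) hD.le, div_nonneg (hpext v hv) hD.le, ?_⟩
      rw [div_eq_inv_mul, div_eq_inv_mul, mul_smul, mul_smul, ← smul_add, ← cross_smul_expand,
        inv_smul_smul₀ hD.ne']
    by_contra! hcon
    have c1 : σ * cross d (p - z) ≤ 0 := by
      by_contra! h; exact hcon _ (.inl h) hpg
    have c2 : σ * cross d (q - z) ≤ 0 := by
      by_contra! h; exact hcon _ (.inl h) hqg
    have c3 : σ * cross d (-bisector (p - z) (q - z)) ≤ 0 := by
      by_contra! h; exact hcon _ (.inl h) hbis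
    have i1 : 0 < ‖p - z‖⁻¹ := inv_pos.2 (norm_pos_iff.2 hP)
    have i2 : 0 < ‖q - z‖⁻¹ := inv_pos.2 (norm_pos_iff.2 (sub_ne_zero.2 hqz))
    simp only [bisector, cross_neg, cross_add, cross_smul] at c3
    have k1 : σ * cross d (p - z) = 0 := by nlinarith
    have k2 : σ * cross d (q - z) = 0 := by nlinarith
    obtain ⟨a, ha⟩ := exists_smul_of_cross_eq_zero hd ((mul_eq_zero.1 k1).resolve_left hσ)
    obtain ⟨b, hb⟩ := exists_smul_of_cross_eq_zero hd ((mul_eq_zero.1 k2).resolve_left hσ)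
    rw [ha, hb, cross_smul, cross_swap, cross_smul, cross_same] at hD
    simp at hD

theorem isProper (hK : IsTriangulation Z K) (hZ : ¬ Collinear ℝ (Z : Set Plane)) :
    IsProperEdgeCollection Z (triangulationEdges K ∪ outerBisectors Z) where
  finite := hK.finite_edges.union (finite_outerBisectors Z)
  notMem := by
    rintro E (hE | hE) x hx hxZ
    · exact hK.notMem_edge hE hx hxZ
    · exact notMem_convexHull_of_mem_outerBisectors hE hx (subset_convexHull ℝ _ hxZ)
  eq_of_mem := by
    rintro E (hE | hE) E' (hE' | hE') x hx hx'
    · exact edge_eq_of_mem hE hE' hx hx'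
    · exact (notMem_convexHull_of_mem_outerBisectors hE' hx'
        (hK.openSegment_subset_hull hE hx)).elim
    · exact (notMem_convexHull_of_mem_outerBisectors hE hx
        (hK.openSegment_subset_hull hE' hx')).elim
    · exact outerBisectors_eq_of_mem hE hE' hx hx'
  straight := by
    rintro E (⟨p, q, hpq, hs, rfl⟩ | hE)
    · have := hK.subset_of_mem_faces hs
      exact .inl ⟨p, this (Finset.mem_insert_self p _), q,
        this (Finset.mem_insert_of_mem (Finset.mem_singleton_self q)), hpq, rfl⟩
    · obtain ⟨z, hz, p, -, q, -, hli, -, rfl⟩ := mem_outerBisectors_iff.1 hE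
      exact .inr ⟨z, hz, _,
        neg_ne_zero.2 (bisector_ne_zero (cross_ne_zero_of_linearIndependent hli)), rfl⟩
  exists_germ _ hz _ hd _ hσ := hK.exists_germ hZ hz hd hσ

end IsTriangulation

theorem IsEdgeCollection.isProper {Z : Finset Plane} {S : Set (Set Plane)}
    (h : IsEdgeCollection Z S) : IsProperEdgeCollection Z S := by
  cases h with
  | triangulated hZ K hK => exact hK.isProper hZ
  | collinear u v hu hv huv hZ => exact isProper_collinear hu hv huv hZ
  | collinearWithEnds u v hu hv huv hZ => exact isProper_collinearWithEnds hu hv huv hZ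

/-! ### Local structure of an edge system -/

section Topology

open Topology Filter

theorem continuous_cross (d : Plane) : Continuous (cross d) := by
  unfold cross; fun_prop

theorem continuous_cross_left (x : Plane) : Continuous fun d => cross d x := by
  unfold cross; fun_prop

namespace IsStraightEdge

variable {Z : Finset Plane} {E : Set Plane}

theorem convex (h : IsStraightEdge Z E) : Convex ℝ E := by
  rcases h with ⟨p, -, q, -, -, rfl⟩ | ⟨p, -, d, -, rfl⟩
  · exact convex_openSegment p q
  · rintro x ⟨s, hs, rfl⟩ y ⟨t, ht, rfl⟩ a b ha hb hab
    refine ⟨a * s + b * t, ?_, ?_⟩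
    · rcases ha.eq_or_lt with rfl | ha
      · rw [zero_add] at hab; subst hab; simpa using ht
      · have := mul_pos ha hs
        have := mul_nonneg hb ht.le
        linarith
    · rw [← eq_sub_iff_add_eq] at hab
      subst hab
      module

theorem nonempty (h : IsStraightEdge Z E) : E.Nonempty := by
  rcases h with ⟨p, -, q, -, -, rfl⟩ | ⟨p, -, d, -, rfl⟩
  · exact ⟨_, mem_openSegment_iff.2 ⟨1 / 2, by norm_num, by norm_num, rfl⟩⟩
  · exact ⟨_, 1, one_pos, rfl⟩

/-- The end points missing from an edge are punctures. In particular edges are closed in the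
punctured plane. -/
theorem isClosed_union (h : IsStraightEdge Z E) : IsClosed (E ∪ (Z : Set Plane)) := by
  rcases h with ⟨p, hp, q, hq, -, rfl⟩ | ⟨p, hp, d, hd, rfl⟩
  · have : openSegment ℝ p q ∪ (Z : Set Plane) = segment ℝ p q ∪ Z := by
      rw [← insert_endpoints_openSegment]
      ext x
      simp only [Set.mem_union, Set.mem_insert_iff, Finset.mem_coe]
      constructor
      · tauto
      · rintro ((rfl | rfl | h) | h) <;> tauto
    rw [this]
    refine IsClosed.union ?_ Z.finite_toSet.isClosed
    rw [← convexHull_pair]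
    exact (Set.toFinite {p, q}).isClosed_convexHull ℝ
  · have : openRay p d ∪ (Z : Set Plane) = (fun s : ℝ => p + s • d) '' Set.Ici 0 ∪ Z := by
      ext x
      simp only [Set.mem_union, Set.mem_image, Set.mem_Ici, Finset.mem_coe]
      constructor
      · rintro (⟨s, hs, rfl⟩ | h)
        · exact .inl ⟨s, hs.le, rfl⟩
        · exact .inr h
      · rintro (⟨s, hs, rfl⟩ | h)
        · rcases hs.eq_or_lt with rfl | hs
          · right; simpa using hp
          · exact .inl ⟨s, hs, rfl⟩
        · exact .inr h
    rw [this]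
    refine IsClosed.union ?_ Z.finite_toSet.isClosed
    have hemb : IsClosedEmbedding fun s : ℝ => p + s • d :=
      (Homeomorph.addLeft p).isClosedEmbedding.comp (isClosedEmbedding_smul_left hd)
    exact hemb.isClosedMap _ isClosed_Ici

theorem exists_direction (h : IsStraightEdge Z E) : ∃ d : Plane, d ≠ 0 ∧
    ∀ x ∈ E, ∃ ε > 0, ∀ t : ℝ, |t| < ε → x + t • d ∈ E := by
  rcases h with ⟨p, -, q, -, hpq, rfl⟩ | ⟨p, -, d, hd, rfl⟩
  · refine ⟨q - p, sub_ne_zero.2 hpq.symm, fun x hx => ?_⟩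
    obtain ⟨θ, h0, h1, rfl⟩ := mem_openSegment_iff.1 hx
    refine ⟨min θ (1 - θ), lt_min h0 (by linarith), fun t ht => ?_⟩
    obtain ⟨h2, h3⟩ := lt_min_iff.1 ht
    have := abs_lt.1 h2
    have := abs_lt.1 h3
    exact mem_openSegment_iff.2 ⟨θ + t, by linarith, by linarith, by module⟩
  · refine ⟨d, hd, ?_⟩
    rintro x ⟨s, hs, rfl⟩
    exact ⟨s, hs, fun t ht => ⟨s + t, by linarith [(abs_lt.1 ht).1], by module⟩⟩

end IsStraightEdge

namespace EdgeSystem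

variable {Z : Finset Plane} (T : EdgeSystem Z)

theorem proper : IsProperEdgeCollection Z T.edges := T.isEdgeCollection.isProper

theorem straight (e : T.edges) : IsStraightEdge Z (e : Set Plane) := T.proper.straight e e.2

/-- The complement of the punctures and the edges. -/
def free : Set Plane := {x | x ∉ Z ∧ x ∉ T.support}

variable {T}

theorem notMem_punctures {e : T.edges} {x : Plane} (hx : x ∈ (e : Set Plane)) : x ∉ Z :=
  T.proper.notMem e e.2 x hx

theorem mem_support_of_mem {e : T.edges} {x : Plane} (hx : x ∈ (e : Set Plane)) : x ∈ T.support :=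
  ⟨e, e.2, hx⟩

theorem mem_support_iff {x : Plane} : x ∈ T.support ↔ ∃ e : T.edges, x ∈ (e : Set Plane) := by
  simp [support, Set.mem_sUnion]

theorem edge_unique {e e' : T.edges} {x : Plane} (hx : x ∈ (e : Set Plane))
    (hx' : x ∈ (e' : Set Plane)) : e' = e :=
  Subtype.ext (T.proper.eq_of_mem e' e'.2 e e.2 x hx' hx)

theorem isClosed_union_of_subset {S : Set (Set Plane)} (hS : S ⊆ T.edges) :
    IsClosed ((Z : Set Plane) ∪ ⋃₀ S) := by
  have : (Z : Set Plane) ∪ ⋃₀ S = (Z : Set Plane) ∪ ⋃ E ∈ S, (E ∪ (Z : Set Plane)) := by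
    ext x
    simp only [Set.mem_union, Set.mem_sUnion, Set.mem_iUnion]
    constructor
    · rintro (h | ⟨E, hE, hx⟩)
      · exact .inl h
      · exact .inr ⟨E, hE, .inl hx⟩
    · rintro (h | ⟨E, hE, hx | hx⟩)
      · exact .inl h
      · exact .inr ⟨E, hE, hx⟩
      · exact .inl hx
  rw [this]
  exact Z.finite_toSet.isClosed.union ((T.proper.finite.subset hS).isClosed_biUnion
    fun E hE => (T.proper.straight E (hS hE)).isClosed_union)

theorem isOpen_free : IsOpen T.free := by
  have : T.free = ((Z : Set Plane) ∪ ⋃₀ T.edges)ᶜ := by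
    ext x; simp [free, support]
  rw [this]
  exact (isClosed_union_of_subset subset_rfl).isOpen_compl

theorem cross_eq_zero_of_mem {e : T.edges} {x y : Plane} (hx : x ∈ (e : Set Plane))
    (hy : y ∈ (e : Set Plane)) : cross (T.dir e) (y - x) = 0 := by
  obtain ⟨c, hc⟩ := T.dir_along e x hx y hy
  rw [hc, cross_smul, cross_same, mul_zero]

theorem cross_sub_eq {e : T.edges} {x x' : Plane} (hx : x ∈ (e : Set Plane))
    (hx' : x' ∈ (e : Set Plane)) (y : Plane) :
    cross (T.dir e) (y - x) = cross (T.dir e) (y - x') := by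
  have := cross_eq_zero_of_mem hx hx'
  rw [cross_sub] at *
  rw [cross_sub]
  linarith

theorem mem_leftSide_iff {e : T.edges} {x : Plane} (hx : x ∈ (e : Set Plane)) {y : Plane} :
    y ∈ T.leftSide e ↔ 0 < cross (T.dir e) (y - x) :=
  ⟨fun h => h x hx, fun h p hp => by rwa [cross_sub_eq hp hx]⟩

theorem mem_rightSide_iff {e : T.edges} {x : Plane} (hx : x ∈ (e : Set Plane)) {y : Plane} :
    y ∈ T.rightSide e ↔ cross (T.dir e) (y - x) < 0 :=
  ⟨fun h => h x hx, fun h p hp => by rwa [cross_sub_eq hp hx]⟩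

theorem exists_segment_along {e : T.edges} {x : Plane} (hx : x ∈ (e : Set Plane)) :
    ∃ ε > 0, ∀ t : ℝ, |t| < ε → x + t • T.dir e ∈ (e : Set Plane) := by
  obtain ⟨d, hd, h⟩ := (T.straight e).exists_direction
  obtain ⟨ε, hε, hx'⟩ := h x hx
  obtain ⟨c, hc⟩ := T.dir_along e x hx _ (hx' (ε / 2) (by rw [abs_of_pos] <;> linarith))
  rw [add_sub_cancel_left] at hc
  have hc0 : c ≠ 0 := by
    rintro rfl
    rw [zero_smul, smul_eq_zero] at hc
    exact hc.elim (by intro h; linarith) hd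
  have hdir : T.dir e = (c⁻¹ * (ε / 2)) • d := by
    rw [mul_smul, hc, inv_smul_smul₀ hc0]
  have hk : 0 < |c⁻¹ * (ε / 2)| := abs_pos.2 (mul_ne_zero (inv_ne_zero hc0) (by linarith))
  refine ⟨ε / |c⁻¹ * (ε / 2)|, by positivity, fun t ht => ?_⟩
  rw [hdir, smul_smul]
  refine hx' _ ?_
  rw [abs_mul]
  exact (lt_div_iff₀ hk).1 ht

/-- Near a point of an edge, there are no punctures and no other edges, and the edge coincides with
its line. -/
theorem exists_ball {e : T.edges} {x : Plane} (hx : x ∈ (e : Set Plane)) :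
    ∃ r > 0, ∀ y ∈ Metric.ball x r, y ∉ Z ∧ (∀ e' : T.edges, y ∈ (e' : Set Plane) → e' = e) ∧
      (cross (T.dir e) (y - x) = 0 → y ∈ (e : Set Plane)) := by
  have h1 : ∀ᶠ y in 𝓝 x, y ∈ ((Z : Set Plane) ∪ ⋃₀ (T.edges \ {(e : Set Plane)}))ᶜ := by
    refine (isClosed_union_of_subset (T := T) Set.sdiff_subset).isOpen_compl.mem_nhds ?_
    rintro (h | ⟨E, ⟨hE, hne⟩, hxE⟩)
    · exact notMem_punctures hx h
    · exact hne (T.proper.eq_of_mem E hE e e.2 x hxE hx)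
  obtain ⟨ε, hε, hseg⟩ := exists_segment_along hx
  have hdd := Plane.inner_self_pos (T.dir_ne_zero e)
  have h2 : ∀ᶠ y in 𝓝 x, |inner ℝ (T.dir e) (y - x) / inner ℝ (T.dir e) (T.dir e)| < ε := by
    have : Continuous fun y =>
        |inner ℝ (T.dir e) (y - x) / inner ℝ (T.dir e) (T.dir e)| := by fun_prop
    exact (this.tendsto x).eventually_lt_const (by simpa using hε)
  obtain ⟨r, hr, h⟩ := Metric.eventually_nhds_iff_ball.1 (h1.and h2)
  refine ⟨r, hr, fun y hy => ⟨fun hyZ => (h y hy).1 (.inl hyZ), fun e' he' => ?_, fun hc => ?_⟩⟩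
  · by_contra hne
    exact (h y hy).1 (.inr ⟨e', ⟨e'.2, fun h => hne (Subtype.ext h)⟩, he'⟩)
  · obtain ⟨c, hc⟩ := exists_smul_of_cross_eq_zero (T.dir_ne_zero e) hc
    have hb := (h y hy).2
    rw [hc, real_inner_smul_right, mul_div_assoc, div_self hdd.ne', mul_one] at hb
    rw [← add_sub_cancel x y, hc]
    exact hseg c hb

end EdgeSystem

/-! ### Visibility and convexity of the cells -/

theorem mem_segment_iff_add {p q x : Plane} :
    x ∈ segment ℝ p q ↔ ∃ θ : ℝ, 0 ≤ θ ∧ θ ≤ 1 ∧ x = p + θ • (q - p) := by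
  rw [segment_eq_image']
  constructor
  · rintro ⟨θ, ⟨h0, h1⟩, rfl⟩; exact ⟨θ, h0, h1, rfl⟩
  · rintro ⟨θ, h0, h1, rfl⟩; exact ⟨θ, ⟨h0, h1⟩, rfl⟩

/-- The complement is the projection of a closed set along the compact unit interval. -/
theorem isOpen_setOf_segment_subset {U : Set Plane} (hU : IsOpen U) (x : Plane) :
    IsOpen {y | segment ℝ x y ⊆ U} := by
  have hc : IsClosed {p : unitInterval × Plane | x + (p.1 : ℝ) • (p.2 - x) ∈ Uᶜ} :=
    hU.isClosed_compl.preimage (by fun_prop)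
  have := (isClosedMap_snd_of_compactSpace _ hc).isOpen_compl
  convert! this using 1
  ext y
  simp only [Set.mem_ofPred_eq, Set.mem_compl_iff, Set.mem_image, Prod.exists, exists_eq_right,
    not_exists, not_not, Set.subset_def, mem_segment_iff_add]
  constructor
  · exact fun h t => h _ ⟨t, t.2.1, t.2.2, rfl⟩
  · rintro h _ ⟨t, h0, h1, rfl⟩
    exact h ⟨t, h0, h1⟩

namespace EdgeSystem

variable {Z : Finset Plane} {T : EdgeSystem Z}

theorem not_segment_subset_free_of_mem {e : T.edges} {x y m : Plane} {t : ℝ} (h0 : 0 ≤ t)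
    (h1 : t ≤ 1) (hm : x + t • (y - x) = m) (hme : m ∈ (e : Set Plane)) :
    ¬ segment ℝ x y ⊆ T.free := fun h =>
  (h (mem_segment_iff_add.2 ⟨t, h0, h1, hm.symm⟩)).2 (mem_support_of_mem hme)

/-- If the first obstacle on the segment from `x` to `y` is an edge, then all nearby segments are
obstructed. -/
theorem eventually_obstructed_of_edge {x y : Plane} {s : ℝ} (hs0 : 0 < s) (hs1 : s < 1)
    (hfree : ∀ t : ℝ, 0 ≤ t → t < s → x + t • (y - x) ∈ T.free) {e : T.edges}
    (hm : x + s • (y - x) ∈ (e : Set Plane)) :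
    ∀ᶠ y' in 𝓝 y, ¬ segment ℝ x y' ⊆ T.free := by
  obtain ⟨r, hr, hball⟩ := exists_ball hm
  set m := x + s • (y - x) with hmdef
  by_cases hc : cross (T.dir e) (y - x) = 0
  -- A segment parallel to the edge would already run in the edge shortly before `m`.
  · exfalso
    have hcont : Continuous fun t : ℝ => x + t • (y - x) := by fun_prop
    have h1 : ∀ᶠ t in 𝓝[<] s, x + t • (y - x) ∈ Metric.ball m r :=
      (hcont.tendsto s).mono_left nhdsWithin_le_nhds (Metric.ball_mem_nhds _ hr)
    obtain ⟨t, ht, h0, hts⟩ := (h1.and (Ioo_mem_nhdsLT hs0)).exists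
    refine (hfree t h0.le hts).2 (mem_support_of_mem (e := e) ((hball _ ht).2.2 ?_))
    have : x + t • (y - x) - m = (t - s) • (y - x) := by rw [hmdef]; module
    rw [this, cross_smul, hc, mul_zero]
  -- `τ y'` is the parameter at which the line from `x` to `y'` meets the line of the edge. It
  -- depends continuously on `y'`, so the meeting point stays close to `m` and hence in the edge.
  · let τ (y' : Plane) : ℝ := cross (T.dir e) (m - x) / cross (T.dir e) (y' - x)
    have hτc : ContinuousAt τ y := by
      refine ContinuousAt.div continuousAt_const ?_ hc
      exact ((continuous_cross _).comp (continuous_id.sub continuous_const)).continuousAt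
    have hτy : τ y = s := by
      simp only [τ, hmdef]
      rw [add_sub_cancel_left, cross_smul, mul_div_assoc, div_self hc, mul_one]
    have hpc : ContinuousAt (fun y' => x + τ y' • (y' - x)) y := by fun_prop
    have e1 : ∀ᶠ y' in 𝓝 y, τ y' ∈ Set.Ioo (0 : ℝ) 1 :=
      hτc.eventually (Ioo_mem_nhds (hτy.symm ▸ hs0) (hτy.symm ▸ hs1))
    have e2 : ∀ᶠ y' in 𝓝 y, x + τ y' • (y' - x) ∈ Metric.ball m r := by
      refine hpc.eventually_mem ?_
      simp only [hτy]
      exact Metric.ball_mem_nhds _ hr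
    have e3 : ∀ᶠ y' in 𝓝 y, cross (T.dir e) (y' - x) ≠ 0 :=
      ((continuous_cross _).comp (continuous_id.sub continuous_const)).continuousAt.eventually_ne hc
    filter_upwards [e1, e2, e3] with y' h1 h2 h3
    refine not_segment_subset_free_of_mem (e := e) h1.1.le h1.2.le rfl ((hball _ h2).2.2 ?_)
    have : cross (T.dir e) (x + τ y' • (y' - x) - m) =
        τ y' * cross (T.dir e) (y' - x) - cross (T.dir e) (m - x) := by
      simp only [cross_sub, cross_add, cross_smul]; ring
    rw [this, div_mul_cancel₀ _ h3, sub_self]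

/-- If the first obstacle on the segment from `x` to `y` is a puncture, then all nearby segments
are obstructed. -/
theorem eventually_obstructed_of_puncture {x y : Plane} {s : ℝ} (hs0 : 0 < s) (hs1 : s < 1)
    (hfree : ∀ t : ℝ, 0 ≤ t → t < s → x + t • (y - x) ∈ T.free)
    (hm : x + s • (y - x) ∈ Z) :
    ∀ᶠ y' in 𝓝 y, ¬ segment ℝ x y' ⊆ T.free := by
  set z := x + s • (y - x) with hz
  have hxy : x - y ≠ 0 := by
    intro h
    have hx := hfree 0 le_rfl hs0
    rw [← neg_sub, h, neg_zero, smul_zero, add_zero] at hz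
    rw [zero_smul, add_zero, ← hz] at hx
    exact hx.1 hm
  set d := x - y with hd
  have hdd := Plane.inner_self_pos hxy
  have hyz : y - z = -(1 - s) • d := by rw [hz, hd]; module
  -- A segment that passes the puncture `z` on the side `σ` has to cross an edge that leaves `z` on
  -- that side. Such an edge exists because no sector exceeds `π`.
  have side : ∀ σ : ℝ, σ ≠ 0 → ∀ᶠ y' in 𝓝 y, 0 < σ * cross d (y' - z) →
      ¬ segment ℝ x y' ⊆ T.free := by
    intro σ hσ
    obtain ⟨f, hor, τ₀, hτ₀, hgerm⟩ := T.proper.exists_germ z hm d hxy σ hσ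
    -- The edge cannot run from `z` back towards `x`, where the segment is free.
    have hf : 0 < σ * cross d f := by
      rcases hor with h | ⟨c, hc, rfl⟩
      · exact h
      · exfalso
        set τ := min (τ₀ / 2) (s / (2 * c)) with hτ
        have hτ0 : 0 < τ := lt_min (by positivity) (by positivity)
        have hτs : τ * c < s := by
          have : τ * c ≤ s / (2 * c) * c := by gcongr; exact min_le_right _ _
          have h2 : s / (2 * c) * c = s / 2 := by field_simp
          linarith
        have hτc : 0 < τ * c := by positivity
        have := hfree (s - τ * c) (by linarith) (by linarith)
        refine this.2 ?_
        have h3 := hgerm τ hτ0 (by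
          have : τ ≤ τ₀ / 2 := min_le_left _ _
          linarith)
        have h4 : x + (s - τ * c) • (y - x) = z + τ • c • d := by rw [hz, hd]; module
        rw [h4]
        exact h3
    have hcA : ContinuousAt (fun y' : Plane => cross (y' - x) f) y :=
      ((continuous_cross_left f).comp (continuous_id.sub continuous_const)).continuousAt
    have hAy : cross (y - x) f = -cross d f := by
      rw [hd, cross_swap, cross_swap f (x - y), ← neg_sub x y, cross_neg]
    have hf0 : cross d f ≠ 0 := by intro h; rw [h, mul_zero] at hf; exact hf.false
    have hAne : cross (y - x) f ≠ 0 := by rw [hAy]; exact neg_ne_zero.2 hf0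
    -- Cramer's rule for `x + t • (y' - x) = z + τ • f`. At `y' = y` the solution is `t = s`, `τ =
    -- 0`.
    let t (y' : Plane) : ℝ := cross f (x - z) / cross (y' - x) f
    let τ (y' : Plane) : ℝ := cross (y' - x) (x - z) / cross (y' - x) f
    have hxz : x - z = s • d := by rw [hz, hd]; module
    have htc : ContinuousAt t y := ContinuousAt.div continuousAt_const hcA hAne
    have hτc : ContinuousAt τ y := ContinuousAt.div
      ((continuous_cross_left _).comp (continuous_id.sub continuous_const)).continuousAt hcA hAne
    have hty : t y = s := by
      simp only [t]
      rw [hAy, hxz, cross_smul, cross_swap, mul_neg, neg_div_neg_eq, mul_div_assoc, div_self hf0,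
        mul_one]
    have hτy : τ y = 0 := by
      simp only [τ]
      have : y - x = -d := by rw [hd, neg_sub]
      rw [hxz, cross_smul, cross_swap, this, cross_neg, cross_same]; simp
    have e1 : ∀ᶠ y' in 𝓝 y, t y' ∈ Set.Ioo (0 : ℝ) 1 :=
      htc.eventually (Ioo_mem_nhds (hty.symm ▸ hs0) (hty.symm ▸ hs1))
    have e2 : ∀ᶠ y' in 𝓝 y, τ y' < τ₀ := hτc.eventually_lt_const (by rw [hτy]; exact hτ₀)
    have e3 : ∀ᶠ y' in 𝓝 y, σ * cross (y' - x) f < 0 :=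
      (continuousAt_const.mul hcA).eventually_lt_const (by
        change σ * cross (y - x) f < 0
        rw [hAy]; linarith)
    filter_upwards [e1, e2, e3] with y' h1 h2 h3 hside
    have hA0 : cross (y' - x) f ≠ 0 := by intro h; rw [h, mul_zero] at h3; exact h3.false
    have hτ0 : 0 < τ y' := by
      have hnum : cross (y' - x) (x - z) = -(s * cross d (y' - z)) := by
        have : y' - x = (y' - z) - s • d := by rw [← hxz]; abel
        rw [hxz, cross_smul, cross_swap, this, cross_sub, cross_smul, cross_same]
        ring
      have : τ y' = (s * (σ * cross d (y' - z))) / -(σ * cross (y' - x) f) := by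
        simp only [τ]; rw [hnum]; field_simp
      rw [this]
      exact div_pos (mul_pos hs0 hside) (by linarith)
    have hmem := hgerm (τ y') hτ0 h2
    rw [← support, mem_support_iff] at hmem
    obtain ⟨e, he⟩ := hmem
    refine not_segment_subset_free_of_mem h1.1.le h1.2.le ?_ he
    have key := cross_smul_expand (y' - x) f (x - z)
    have k2 : x - z = -(t y' • (y' - x)) + τ y' • f := by
      simp only [t, τ]
      rw [div_eq_inv_mul, div_eq_inv_mul, mul_smul, mul_smul, ← smul_neg, ← neg_smul, ← smul_add,
        ← key, inv_smul_smul₀ hA0]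
    linear_combination (norm := module) k2
  have e0 : ∀ᶠ y' in 𝓝 y, inner ℝ d (y' - z) < 0 := by
    have : Continuous fun y' => inner ℝ d (y' - z) := by fun_prop
    refine (this.tendsto y).eventually_lt_const ?_
    rw [hyz, real_inner_smul_right]
    nlinarith
  filter_upwards [side 1 one_ne_zero, side (-1) (by norm_num), e0] with y' h1 h2 h3
  rcases lt_trichotomy (cross d (y' - z)) 0 with h | h | h
  · exact h2 (by linarith)
  -- If `y'` is on the line through `x` and `z`, it is behind `z` as seen from `x`, and the segment
  -- runs into the puncture.
  · obtain ⟨c, hc⟩ := exists_smul_of_cross_eq_zero hxy h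
    rw [hc, real_inner_smul_right] at h3
    have hc0 : c < 0 := by by_contra! h; nlinarith
    intro hsub
    refine (hsub (mem_segment_iff_add.2 ⟨s / (s - c), by apply div_nonneg <;> linarith,
      (div_le_one (by linarith)).2 (by linarith), ?_⟩)).1 hm
    have hx : x = z + s • d := by rw [hz, hd]; module
    have hy' : y' = z + c • d := by rw [← hc]; abel
    rw [hy', hx]
    have : s - c ≠ 0 := by linarith
    match_scalars <;> field_simp <;> ring
  · exact h1 (by linarith)

/-- Obstruction of segments with a fixed free end point is an open condition. -/
theorem isOpen_obstructed {x : Plane} (hx : x ∈ T.free) :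
    IsOpen {y | y ∈ T.free ∧ ¬ segment ℝ x y ⊆ T.free} := by
  rw [isOpen_iff_mem_nhds]
  rintro y ⟨hy, hxy⟩
  refine (isOpen_free.eventually_mem hy).and ?_
  let C : Set ℝ := Set.Icc 0 1 ∩ {t | x + t • (y - x) ∈ (T.free)ᶜ}
  have hC : IsCompact C := isCompact_Icc.inter_right
    (isOpen_free.isClosed_compl.preimage (by fun_prop : Continuous fun t : ℝ => x + t • (y - x)))
  have hne : C.Nonempty := by
    rw [Set.not_subset] at hxy
    obtain ⟨m, hm, hmf⟩ := hxy
    obtain ⟨t, h0, h1, rfl⟩ := mem_segment_iff_add.1 hm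
    exact ⟨t, ⟨h0, h1⟩, hmf⟩
  obtain ⟨s, ⟨⟨hs0, hs1⟩, hs⟩, hleast⟩ := hC.exists_isLeast hne
  have hs0' : 0 < s := hs0.lt_of_ne (by rintro rfl; simp [hx] at hs)
  have hs1' : s < 1 := hs1.lt_of_ne (by rintro rfl; simp [hy] at hs)
  have hfree : ∀ t : ℝ, 0 ≤ t → t < s → x + t • (y - x) ∈ T.free := by
    intro t h0 hts
    by_contra hn
    have := hleast ⟨⟨h0, by linarith⟩, hn⟩
    linarith
  by_cases hZ : x + s • (y - x) ∈ Z
  · exact eventually_obstructed_of_puncture hs0' hs1' hfree hZ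
  · have : x + s • (y - x) ∈ T.support := by
      by_contra h
      exact hs ⟨hZ, h⟩
    obtain ⟨e, he⟩ := mem_support_iff.1 this
    exact eventually_obstructed_of_edge hs0' hs1' hfree he

variable (T) in
/-- The points of the complement of the edges that are visible from `x`. -/
def cell (x : Plane) : Set Plane := {y | segment ℝ x y ⊆ T.free}

theorem isOpen_cell (x : Plane) : IsOpen (T.cell x) := isOpen_setOf_segment_subset isOpen_free x

theorem cell_subset_free {x : Plane} : T.cell x ⊆ T.free := fun y hy => hy (right_mem_segment ℝ x y)

theorem mem_cell_self {x : Plane} (hx : x ∈ T.free) : x ∈ T.cell x := by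
  simpa [cell] using hx

theorem mem_cell_comm {x y : Plane} : y ∈ T.cell x ↔ x ∈ T.cell y := by
  rw [cell, cell, Set.mem_ofPred_eq, Set.mem_ofPred_eq, segment_symm]

/-- The points visible from `x` and the obstructed ones are two disjoint open sets that cover the
free points. -/
theorem subset_cell_of_isPreconnected {S : Set Plane} (hS : IsPreconnected S) (hSf : S ⊆ T.free)
    {x y : Plane} (hx : x ∈ T.free) (hy : y ∈ S) (hxy : y ∈ T.cell x) : S ⊆ T.cell x := by
  refine hS.subset_left_of_subset_union (isOpen_cell x) (isOpen_obstructed hx) ?_ ?_ ⟨y, hy, hxy⟩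
  · rw [Set.disjoint_left]
    exact fun w h1 h2 => h2.2 h1
  · intro w hw
    by_cases h : segment ℝ x w ⊆ T.free
    · exact .inl h
    · exact .inr ⟨hSf hw, h⟩

theorem isPreconnected_cell {x : Plane} : IsPreconnected (T.cell x) := by
  rcases (T.cell x).eq_empty_or_nonempty with h | ⟨w, hw⟩
  · rw [h]; exact isPreconnected_empty
  · have hx : x ∈ T.free := hw (left_mem_segment ℝ x w)
    refine (StarConvex.isPathConnected (a := x) ?_ (mem_cell_self hx)).isConnected.isPreconnected
    intro y hy a b ha hb hab
    refine ((convex_segment x y).segment_subset (left_mem_segment ℝ x y) ?_).trans hy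
    exact ⟨a, b, ha, hb, hab, rfl⟩

/-- A cell is connected and contains every connected free set that it meets, so visibility is an
equivalence relation on the free points. -/
theorem cell_eq_of_mem {x y : Plane} (h : y ∈ T.cell x) : T.cell y = T.cell x := by
  have hx : x ∈ T.free := h (left_mem_segment ℝ x y)
  have hy : y ∈ T.free := cell_subset_free h
  refine Set.Subset.antisymm ?_ ?_
  · exact subset_cell_of_isPreconnected isPreconnected_cell cell_subset_free hx (mem_cell_self hy) h
  · exact subset_cell_of_isPreconnected isPreconnected_cell cell_subset_free hy (mem_cell_self hx)
      (mem_cell_comm.1 h)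

theorem convex_cell {x : Plane} : Convex ℝ (T.cell x) := by
  rw [convex_iff_segment_subset]
  intro y hy w hw
  have hx : x ∈ T.free := hy (left_mem_segment ℝ x y)
  rw [← cell_eq_of_mem hy] at hw
  exact subset_cell_of_isPreconnected (convex_segment y w).isPreconnected hw hx
    (left_mem_segment ℝ y w) hy

end EdgeSystem

/-! ### Flat gauges, lifts and holonomy -/

/-- A flat principal structure on `X` with the discrete structure group `G`, given by local
gauges `gauge i` on open sets whose quotients are locally constant. -/
structure FlatGauge (X G ι : Type*) [TopologicalSpace X] [Group G] where
  /-- the domains of the local gauges -/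
  domain : ι → Set X
  isOpen_domain : ∀ i, IsOpen (domain i)
  /-- a gauge defined at the given point -/
  index : X → ι
  mem_domain : ∀ x, x ∈ domain (index x)
  /-- the local gauges -/
  gauge : ι → X → G
  gauge_index : ∀ x, gauge (index x) x = 1
  eventually_eq : ∀ i j, ∀ x ∈ domain i ∩ domain j,
    ∀ᶠ y in 𝓝 x, (gauge i y)⁻¹ * gauge j y = (gauge i x)⁻¹ * gauge j x

namespace FlatGauge

variable {X G ι : Type*} [TopologicalSpace X] [Group G] (S : FlatGauge X G ι)

/-- The principal bundle of a flat gauge. -/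
def core [TopologicalSpace G] [DiscreteTopology G] : FiberBundleCore ι X G where
  baseSet := S.domain
  isOpen_baseSet := S.isOpen_domain
  indexAt := S.index
  mem_baseSet_at := S.mem_domain
  -- Transitions multiply on the right, so left multiplications act on the bundle.
  coordChange i j x g := g * (S.gauge i x)⁻¹ * S.gauge j x
  coordChange_self i x _ v := by group
  continuousOn_coordChange i j := by
    rintro ⟨x, v⟩ ⟨hx, -⟩
    refine ContinuousAt.continuousWithinAt ?_
    refine (continuousAt_const (y := v * (S.gauge i x)⁻¹ * S.gauge j x)).congr ?_
    rw [nhds_prod_eq, nhds_discrete G]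
    filter_upwards [(S.eventually_eq i j x hx).prod_mk (eventually_pure.2 (rfl : v = v))]
      with p hp
    obtain ⟨h1, h2⟩ := hp
    simp only [mul_assoc, h1, ← h2]
  coordChange_comp i j k x _ v := by group

/-- `g` is a lift of `f` to the covering space defined by the flat gauge. -/
def IsLift {A : Type*} [TopologicalSpace A] (f : A → X) (g : A → G) : Prop :=
  ∀ a₀, ∀ᶠ a in 𝓝 a₀, g a * S.gauge (S.index (f a₀)) (f a) = g a₀

variable {S} {A B : Type*} [TopologicalSpace A] [TopologicalSpace B]

theorem IsLift.comp {f : A → X} {g : A → G} (h : S.IsLift f g) {u : B → A} (hu : Continuous u) :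
    S.IsLift (f ∘ u) (g ∘ u) :=
  fun b => hu.continuousAt.eventually (h (u b))

/-- In `g' * g⁻¹` the gauge factors cancel, so this quotient is locally constant. -/
theorem IsLift.exists_eq_mul [PreconnectedSpace A] {f : A → X} {g g' : A → G}
    (h : S.IsLift f g) (h' : S.IsLift f g') : ∃ c, ∀ a, g' a = c * g a := by
  rcases isEmpty_or_nonempty A with hA | ⟨⟨a₁⟩⟩
  · exact ⟨1, fun a => hA.elim a⟩
  have hloc : IsLocallyConstant fun a => g' a * (g a)⁻¹ := by
    rw [IsLocallyConstant.iff_eventually_eq]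
    intro a
    filter_upwards [h a, h' a] with b hb hb'
    rw [← hb, ← hb']; group
  refine ⟨g' a₁ * (g a₁)⁻¹, fun a => ?_⟩
  rw [← hloc.apply_eq_of_preconnectedSpace a a₁]; group

/-- For discrete `G` the bundle is a covering space. The fibre component of a continuous lift is
locally constant in each trivialisation, which is the condition in `IsLift`. -/
theorem exists_isLift (S : FlatGauge X G ι) [SimplyConnectedSpace A] [LocallyPathConnectedSpace A]
    (f : C(A, X)) : ∃ g : A → G, S.IsLift f g := by
  let _ : TopologicalSpace G := ⊥
  have : DiscreteTopology G := ⟨rfl⟩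
  obtain ⟨a₀⟩ : Nonempty A := inferInstance
  have cov : IsCoveringMap (Bundle.TotalSpace.proj (F := G) (E := S.core.Fiber)) :=
    FiberBundle.isCoveringMap
  obtain ⟨F, ⟨-, hF⟩, -⟩ := cov.existsUnique_continuousMap_lifts f a₀ ⟨f a₀, (1 : G)⟩ rfl
  have hp (a : A) : (F a).proj = f a := congrFun hF a
  let u (a : A) : G := (F a).2
  refine ⟨u, fun a₁ => ?_⟩
  have h1 := ((FiberBundle.continuousAt_totalSpace (F := G) (E := S.core.Fiber) F).1
    (F.continuous.continuousAt (x := a₁))).2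
  have h2 : ∀ᶠ a in 𝓝 a₁, ((trivializationAt G S.core.Fiber (F a₁).proj) (F a)).2 =
      ((trivializationAt G S.core.Fiber (F a₁).proj) (F a₁)).2 := by
    have := h1.eventually (p := fun y => y =
      ((trivializationAt G S.core.Fiber (F a₁).proj) (F a₁)).2) (by rw [nhds_discrete]; exact rfl)
    exact this
  have key (a : A) : ((trivializationAt G S.core.Fiber (F a₁).proj) (F a)).2 =
      u a * S.gauge (S.index (f a₁)) (f a) := by
    change u a * (S.gauge (S.index (F a).proj) (F a).proj)⁻¹ *
      S.gauge (S.index (F a₁).proj) (F a).proj = _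
    rw [S.gauge_index, hp, hp]; simp
  filter_upwards [h2] with a ha
  rw [key, key, S.gauge_index, mul_one] at ha
  exact ha

/-- The holonomies of freely homotopic loops are conjugate, and those of loops that are homotopic
with fixed end points are equal. -/
theorem IsLift.holonomy_of_homotopy (S : FlatGauge X G ι) (H : C(unitInterval × unitInterval, X))
    (hH : ∀ s, H (s, 0) = H (s, 1)) {g₀ g₁ : unitInterval → G}
    (h₀ : S.IsLift (fun t => H (0, t)) g₀) (h₁ : S.IsLift (fun t => H (1, t)) g₁) :
    IsConj ((g₀ 0)⁻¹ * g₀ 1) ((g₁ 0)⁻¹ * g₁ 1) ∧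
      ((∀ s, H (s, 0) = H (0, 0)) → (g₀ 0)⁻¹ * g₀ 1 = (g₁ 0)⁻¹ * g₁ 1) := by
  obtain ⟨g, hg⟩ : ∃ g, S.IsLift H g := by
    -- The homotopy is extended to the plane by clamping both coordinates, lifted there, and
    -- restricted to the square again.
    let π : ℝ → unitInterval := Set.projIcc 0 1 zero_le_one
    have hπ : Continuous π := continuous_projIcc
    obtain ⟨g, hg⟩ := exists_isLift (A := ℝ × ℝ) S (H.comp ⟨fun p => (π p.1, π p.2), by fun_prop⟩)
    have := hg.comp (u := fun p : unitInterval × unitInterval => ((p.1 : ℝ), (p.2 : ℝ)))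
      (by fun_prop)
    refine ⟨fun p => g (p.1, p.2), fun p => ?_⟩
    simpa [π] using this p
  have k₀ : S.IsLift (fun t => H (0, t)) (fun t => g (0, t)) :=
    hg.comp (u := fun t => ((0 : unitInterval), t)) (by fun_prop)
  have k₁ : S.IsLift (fun t => H (1, t)) (fun t => g (1, t)) :=
    hg.comp (u := fun t => ((1 : unitInterval), t)) (by fun_prop)
  have l₀ : S.IsLift (fun s => H (s, 0)) (fun s => g (s, 0)) :=
    hg.comp (u := fun s => (s, (0 : unitInterval))) (by fun_prop)
  have l₁ : S.IsLift (fun s => H (s, 0)) (fun s => g (s, 1)) := by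
    have := hg.comp (u := fun s => (s, (1 : unitInterval))) (by fun_prop)
    simp only [Function.comp_def, ← hH] at this
    exact this
  obtain ⟨c₀, hc₀⟩ := h₀.exists_eq_mul k₀
  obtain ⟨c₁, hc₁⟩ := h₁.exists_eq_mul k₁
  obtain ⟨a, ha⟩ := l₀.exists_eq_mul l₁
  -- The sides `t = 0` and `t = 1` of the square carry the same path, so their lifts differ by a
  -- constant left factor `a`. Every loop of the homotopy then has as holonomy the conjugate of `a`
  -- by the lift of its base point.
  have e₀ : (g₀ 0)⁻¹ * g₀ 1 = (g (0, 0))⁻¹ * a * g (0, 0) := by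
    rw [mul_assoc, ← ha, hc₀, hc₀]; group
  have e₁ : (g₁ 0)⁻¹ * g₁ 1 = (g (1, 0))⁻¹ * a * g (1, 0) := by
    rw [mul_assoc, ← ha, hc₁, hc₁]; group
  refine ⟨?_, fun hconst => ?_⟩
  · rw [e₀, e₁]
    exact isConj_iff.2 ⟨(g (1, 0))⁻¹ * g (0, 0), by group⟩
  -- If the base point does not move, the lift along it is constant, and so is the conjugating
  -- element.
  · have m : S.IsLift (fun s : unitInterval => H (s, 0)) (fun _ => (1 : G)) := by
      intro s
      refine Eventually.of_forall fun t => ?_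
      beta_reduce
      rw [hconst s, hconst t, S.gauge_index, mul_one]
    obtain ⟨b, hb⟩ := m.exists_eq_mul l₀
    rw [e₀, e₁, hb 0, hb 1]

end FlatGauge

/-! ### Sides of edges and base points of cells -/

namespace EdgeSystem

variable {Z : Finset Plane} {T : EdgeSystem Z}

variable (T) in
/-- The part of a ball around a point `x` of the edge `e` that lies strictly on the side `σ`. -/
def halfBall (e : T.edges) (σ : ℝ) (x : Plane) (r : ℝ) : Set Plane :=
  {y | y ∈ Metric.ball x r ∧ 0 < σ * cross (T.dir e) (y - x)}

theorem convex_halfBall (e : T.edges) (σ : ℝ) (x : Plane) (r : ℝ) :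
    Convex ℝ (T.halfBall e σ x r) := by
  rintro y ⟨hy1, hy⟩ w ⟨hw1, hw⟩ a b ha hb hab
  refine ⟨convex_ball x r hy1 hw1 ha hb hab, ?_⟩
  have : cross (T.dir e) (a • y + b • w - x) =
      a * cross (T.dir e) (y - x) + b * cross (T.dir e) (w - x) := by
    simp only [cross_sub, cross_add, cross_smul]
    linear_combination (cross (T.dir e) x) * hab
  rw [this, mul_add, mul_left_comm, mul_left_comm σ b]
  rcases ha.eq_or_lt with rfl | ha
  · rw [zero_add] at hab; subst hab; simpa using hw
  · have := mul_pos ha hy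
    have := mul_nonneg hb hw.le
    linarith

theorem halfBall_nonempty (e : T.edges) {σ : ℝ} (hσ : σ ≠ 0) (x : Plane) {r : ℝ} (hr : 0 < r) :
    (T.halfBall e σ x r).Nonempty := by
  let n : Plane := !₂[-(T.dir e 1), T.dir e 0]
  have hn : cross (T.dir e) n = inner ℝ (T.dir e) (T.dir e) := by
    rw [Plane.inner_eq]; simp [n, cross]
  have hdd := Plane.inner_self_pos (T.dir_ne_zero e)
  have hcont : Continuous fun t : ℝ => x + (t * σ) • n := by fun_prop
  have h1 : ∀ᶠ t in 𝓝[>] (0 : ℝ), x + (t * σ) • n ∈ Metric.ball x r :=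
    ((hcont.tendsto 0).mono_left nhdsWithin_le_nhds) (by
      simpa using Metric.ball_mem_nhds x hr)
  obtain ⟨t, ht, ht0⟩ := (h1.and self_mem_nhdsWithin).exists
  refine ⟨_, ht, ?_⟩
  rw [add_sub_cancel_left, cross_smul, hn]
  have : σ * (t * σ * inner ℝ (T.dir e) (T.dir e)) =
      t * (σ * σ) * inner ℝ (T.dir e) (T.dir e) := by ring
  rw [this]
  have h0 : 0 < t := ht0
  have := mul_self_pos.2 hσ
  positivity

theorem exists_halfBall_subset_free {e : T.edges} {x : Plane} (hx : x ∈ (e : Set Plane)) :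
    ∃ r > 0, ∀ σ, T.halfBall e σ x r ⊆ T.free := by
  obtain ⟨r, hr, h⟩ := exists_ball hx
  refine ⟨r, hr, fun σ y hy => ⟨(h y hy.1).1, fun hys => ?_⟩⟩
  obtain ⟨e', he'⟩ := mem_support_iff.1 hys
  have := (h y hy.1).2.1 e' he'
  subst this
  have h2 := hy.2
  rw [cross_eq_zero_of_mem hx he', mul_zero] at h2
  exact h2.false

/-- Each side of an edge is, locally, contained in a single cell. -/
theorem exists_side_cell (e : T.edges) {σ : ℝ} (hσ : σ ≠ 0) :
    ∃ b ∈ T.free, ∀ x ∈ (e : Set Plane), ∃ r > 0, T.halfBall e σ x r ⊆ T.cell b := by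
  obtain ⟨x₀, hx₀⟩ := (T.straight e).nonempty
  obtain ⟨r₀, hr₀, hfree₀⟩ := exists_halfBall_subset_free hx₀
  obtain ⟨b, hb⟩ := halfBall_nonempty e hσ x₀ hr₀
  have hbf := hfree₀ σ hb
  refine ⟨b, hbf, ?_⟩
  let P (x : (e : Set Plane)) : Prop := ∃ r > 0, T.halfBall e σ x r ⊆ T.cell b
  have mono : ∀ {x : Plane} {r r' : ℝ}, r ≤ r' → T.halfBall e σ x r ⊆ T.halfBall e σ x r' :=
    fun h y hy => ⟨Metric.ball_subset_ball h hy.1, hy.2⟩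
  have spread : ∀ {x : Plane} {r : ℝ} {w : Plane}, T.halfBall e σ x r ⊆ T.free →
      w ∈ T.halfBall e σ x r → w ∈ T.cell b → T.halfBall e σ x r ⊆ T.cell b :=
    fun h hw hwb =>
      subset_cell_of_isPreconnected (convex_halfBall e σ _ _).isPreconnected h hbf hw hwb
  -- Half balls at nearby points of the edge overlap, so they belong to the same cell; the edge is
  -- connected.
  have hP : IsLocallyConstant P := by
    rw [IsLocallyConstant.iff_eventually_eq]
    intro x
    obtain ⟨r, hr, hfree⟩ := exists_halfBall_subset_free x.2
    have : ∀ᶠ x' : (e : Set Plane) in 𝓝 x, (x' : Plane) ∈ Metric.ball (x : Plane) (r / 2) :=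
      continuous_subtype_val.continuousAt.eventually_mem (Metric.ball_mem_nhds _ (by linarith))
    filter_upwards [this] with x' hx'
    have hsub : ∀ {s : ℝ}, s ≤ r / 2 → T.halfBall e σ x' s ⊆ T.halfBall e σ x r := by
      intro s hs y hy
      refine ⟨?_, ?_⟩
      · have h1 := hy.1
        rw [Metric.mem_ball] at *
        linarith [dist_triangle y (x' : Plane) (x : Plane)]
      · rw [cross_sub_eq x.2 x'.2]; exact hy.2
    refine propext ⟨?_, ?_⟩
    · rintro ⟨s, hs, h⟩
      obtain ⟨w, hw⟩ := halfBall_nonempty e hσ (x' : Plane) (lt_min hs (half_pos hr))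
      exact ⟨r, hr, spread (hfree σ) (hsub (min_le_right _ _) hw) (h (mono (min_le_left _ _) hw))⟩
    · rintro ⟨s, hs, h⟩
      obtain ⟨w, hw⟩ := halfBall_nonempty e hσ (x : Plane) (lt_min hs hr)
      exact ⟨r / 2, half_pos hr, (hsub le_rfl).trans
        (spread (hfree σ) (mono (min_le_right _ _) hw) (h (mono (min_le_left _ _) hw)))⟩
  intro x hx
  have : PreconnectedSpace (e : Set Plane) :=
    isPreconnected_iff_preconnectedSpace.1 (T.straight e).convex.isPreconnected
  have h := hP.apply_eq_of_preconnectedSpace ⟨x₀, hx₀⟩ ⟨x, hx⟩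
  have h0 : P ⟨x₀, hx₀⟩ := ⟨r₀, hr₀, spread (hfree₀ σ) hb (mem_cell_self hbf)⟩
  rw [h] at h0
  exact h0

/-- A representative of a set of points. -/
noncomputable def pick (s : Set Plane) : Plane :=
  open Classical in if h : s.Nonempty then h.some else 0

theorem pick_mem {s : Set Plane} (h : s.Nonempty) : pick s ∈ s := by
  rw [pick, dif_pos h]; exact h.some_mem

variable (T) in
/-- The base point of the cell on the side `σ` of the edge `e`. -/
noncomputable def sideBase (e : T.edges) (σ : ℝ) : Plane :=
  open Classical in if hσ : σ ≠ 0 then pick (T.cell (exists_side_cell e hσ).choose) else 0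

/-- The middle clause holds because `pick` depends only on the cell as a set. It makes the base
point independent of the edge from which the cell is reached. -/
theorem sideBase_spec (e : T.edges) {σ : ℝ} (hσ : σ ≠ 0) : T.sideBase e σ ∈ T.free ∧
    pick (T.cell (T.sideBase e σ)) = T.sideBase e σ ∧
    ∀ x ∈ (e : Set Plane), ∃ r > 0, T.halfBall e σ x r ⊆ T.cell (T.sideBase e σ) := by
  obtain ⟨h1, h2⟩ := (exists_side_cell e hσ).choose_spec
  have hmem := pick_mem ⟨_, mem_cell_self h1⟩
  have heq := cell_eq_of_mem hmem
  rw [sideBase, dif_pos hσ]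
  refine ⟨cell_subset_free hmem, ?_, ?_⟩
  · rw [heq]
  · rw [heq]; exact h2

/-- A point of an edge is visible from the base points of both sides of the edge. -/
theorem segment_sideBase_subset {e : T.edges} {σ : ℝ} (hσ : σ ≠ 0) {x : Plane}
    (hx : x ∈ (e : Set Plane)) : segment ℝ (T.sideBase e σ) x ⊆ {w | w ∉ Z} := by
  obtain ⟨hb, -, h⟩ := sideBase_spec e hσ
  obtain ⟨r, hr, hr'⟩ := h x hx
  have hcl : x ∈ closure (T.cell (T.sideBase e σ)) := by
    rw [Metric.mem_closure_iff]
    intro ε hε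
    obtain ⟨y, hy⟩ := halfBall_nonempty e hσ x (lt_min hr hε)
    refine ⟨y, hr' ⟨Metric.ball_subset_ball (min_le_left _ _) hy.1, hy.2⟩, ?_⟩
    rw [dist_comm]
    exact (Metric.mem_ball.1 hy.1).trans_le (min_le_right _ _)
  -- A segment from an interior point of a convex set to a point of its closure stays in the
  -- interior up to its last point.
  have hop : openSegment ℝ (T.sideBase e σ) x ⊆ T.free := by
    refine Set.Subset.trans ?_ (interior_subset.trans
      (cell_subset_free (T := T) (x := T.sideBase e σ)))
    refine convex_cell.openSegment_interior_closure_subset_interior ?_ hcl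
    rw [(isOpen_cell _).interior_eq]
    exact mem_cell_self hb
  rw [← insert_endpoints_openSegment]
  rintro w (rfl | rfl | hw)
  · exact hb.1
  · exact notMem_punctures hx
  · exact (hop hw).1

variable (T) in
/-- The base point of the cell of `x`, or of the cell to the left of `x` if `x` is on an edge. -/
noncomputable def basePt (x : Plane) : Plane :=
  open Classical in
  if h : ∃ e : T.edges, x ∈ (e : Set Plane) then T.sideBase h.choose 1 else pick (T.cell x)

theorem basePt_of_mem {e : T.edges} {x : Plane} (hx : x ∈ (e : Set Plane)) :
    T.basePt x = T.sideBase e 1 := by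
  have h : ∃ e : T.edges, x ∈ (e : Set Plane) := ⟨e, hx⟩
  rw [basePt, dif_pos h, edge_unique hx h.choose_spec]

theorem basePt_of_mem_free {x : Plane} (hx : x ∈ T.free) : T.basePt x = pick (T.cell x) := by
  rw [basePt, dif_neg]
  rintro ⟨e, he⟩
  exact hx.2 (mem_support_of_mem he)

theorem mem_free_or_exists {x : Plane} (hx : x ∉ Z) :
    x ∈ T.free ∨ ∃ e : T.edges, x ∈ (e : Set Plane) := by
  by_cases h : x ∈ T.support
  · exact .inr (mem_support_iff.1 h)
  · exact .inl ⟨hx, h⟩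

theorem basePt_mem_cell {x : Plane} (hx : x ∈ T.free) : T.basePt x ∈ T.cell x := by
  rw [basePt_of_mem_free hx]
  exact pick_mem ⟨x, mem_cell_self hx⟩

theorem basePt_eq_of_mem_cell {x y : Plane} (hy : y ∈ T.cell x) : T.basePt y = T.basePt x := by
  rw [basePt_of_mem_free (cell_subset_free hy), cell_eq_of_mem hy,
    basePt_of_mem_free (hy (left_mem_segment ℝ x y))]

theorem segment_subset_of_mem_cell {x y : Plane} (hy : y ∈ T.cell x) :
    segment ℝ x y ⊆ {w | w ∉ Z} := fun _ hw => (hy hw).1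

theorem segment_basePt_subset {x : Plane} (hx : x ∉ Z) :
    segment ℝ (T.basePt x) x ⊆ {w | w ∉ Z} := by
  rcases mem_free_or_exists (T := T) hx with h | ⟨e, he⟩
  · exact segment_subset_of_mem_cell (mem_cell_comm.1 (basePt_mem_cell h))
  · rw [basePt_of_mem he]
    exact segment_sideBase_subset one_ne_zero he

theorem basePt_of_mem_cell_sideBase {e : T.edges} {σ : ℝ} (hσ : σ ≠ 0) {y : Plane}
    (hy : y ∈ T.cell (T.sideBase e σ)) : T.basePt y = T.sideBase e σ := by
  rw [basePt_of_mem_free (cell_subset_free hy), cell_eq_of_mem hy, (sideBase_spec e hσ).2.1]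

/-- The base points near a point of an edge. -/
theorem exists_ball_basePt {e : T.edges} {x : Plane} (hx : x ∈ (e : Set Plane)) :
    ∃ r > 0, ∀ y ∈ Metric.ball x r, y ∉ Z ∧
      (0 ≤ cross (T.dir e) (y - x) → T.basePt y = T.sideBase e 1) ∧
      (cross (T.dir e) (y - x) ≤ 0 → segment ℝ (T.sideBase e (-1)) y ⊆ {w | w ∉ Z}) ∧
      (cross (T.dir e) (y - x) < 0 → T.basePt y = T.sideBase e (-1)) := by
  obtain ⟨r₀, hr₀, h₀⟩ := exists_ball hx
  obtain ⟨r₁, hr₁, h₁⟩ := (sideBase_spec e one_ne_zero).2.2 x hx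
  obtain ⟨r₂, hr₂, h₂⟩ := (sideBase_spec e (σ := -1) (by norm_num)).2.2 x hx
  refine ⟨min r₀ (min r₁ r₂), by positivity, fun y hy => ?_⟩
  simp only [Metric.mem_ball, lt_min_iff] at hy
  obtain ⟨y0, y1, y2⟩ := hy
  obtain ⟨hyZ, -, hye⟩ := h₀ y y0
  have right : cross (T.dir e) (y - x) < 0 → y ∈ T.cell (T.sideBase e (-1)) :=
    fun hc => h₂ ⟨y2, by linarith⟩
  refine ⟨hyZ, fun hc => ?_, fun hc => ?_, fun hc => ?_⟩
  · rcases hc.eq_or_lt with hc | hc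
    · exact basePt_of_mem (hye hc.symm)
    · exact basePt_of_mem_cell_sideBase one_ne_zero (h₁ ⟨y1, by linarith⟩)
  · rcases hc.eq_or_lt with hc | hc
    · exact segment_sideBase_subset (by norm_num) (hye hc)
    · exact segment_subset_of_mem_cell (right hc)
  · exact basePt_of_mem_cell_sideBase (by norm_num) (right hc)

end EdgeSystem

/-! ### The gauge that records crossings -/

namespace EdgeSystem

variable {Z : Finset Plane} {T : EdgeSystem Z}

theorem notMem_leftSide_of_mem_rightSide {e : T.edges} {y : Plane} (h : y ∈ T.rightSide e) :
    y ∉ T.leftSide e := by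
  obtain ⟨x, hx⟩ := (T.straight e).nonempty
  rw [mem_leftSide_iff hx]
  rw [mem_rightSide_iff hx] at h
  exact h.not_gt

theorem notMem_side_of_mem {e : T.edges} {y : Plane} (h : y ∈ (e : Set Plane)) :
    y ∉ T.leftSide e ∧ y ∉ T.rightSide e := by
  rw [mem_leftSide_iff h, mem_rightSide_iff h]
  simp

theorem isOpen_leftSide (e : T.edges) : IsOpen (T.leftSide e) := by
  obtain ⟨x, hx⟩ := (T.straight e).nonempty
  have : T.leftSide e = {y | 0 < cross (T.dir e) (y - x)} := Set.ext fun y => mem_leftSide_iff hx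
  rw [this]
  exact isOpen_lt continuous_const ((continuous_cross _).comp (by fun_prop))

theorem isOpen_rightSide (e : T.edges) : IsOpen (T.rightSide e) := by
  obtain ⟨x, hx⟩ := (T.straight e).nonempty
  have : T.rightSide e = {y | cross (T.dir e) (y - x) < 0} := Set.ext fun y => mem_rightSide_iff hx
  rw [this]
  exact isOpen_lt ((continuous_cross _).comp (by fun_prop)) continuous_const

/-- The points of an edge have neighbourhoods that consist of points of the edge and of points off
all edges that are on one of its sides. -/
theorem eventually_mem_or_side {e : T.edges} {x : Plane} (hx : x ∈ (e : Set Plane)) :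
    ∀ᶠ y in 𝓝 x, y ∈ (e : Set Plane) ∨
      (y ∈ T.free ∧ (y ∈ T.leftSide e ∨ y ∈ T.rightSide e)) := by
  obtain ⟨r, hr, h⟩ := exists_ball hx
  refine Metric.eventually_nhds_iff_ball.2 ⟨r, hr, fun y hy => ?_⟩
  obtain ⟨h1, h2, h3⟩ := h y hy
  by_cases hye : y ∈ (e : Set Plane)
  · exact .inl hye
  refine .inr ⟨(mem_free_or_exists h1).resolve_right ?_, ?_⟩
  · rintro ⟨e', he'⟩
    exact hye (h2 e' he' ▸ he')
  · rw [mem_leftSide_iff hx, mem_rightSide_iff hx]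
    exact (lt_or_gt_of_ne fun hc => hye (h3 hc)).symm

variable (T) in
/-- The domains of the local gauges. -/
def gaugeDomain : Option T.edges → Set (PuncturedPlane Z)
  | none => {x | (x : Plane) ∈ T.free}
  | some e => {x | (x : Plane) ∈ (e : Set Plane) ∨
      ((x : Plane) ∈ T.free ∧ ((x : Plane) ∈ T.leftSide e ∨ (x : Plane) ∈ T.rightSide e))}

open Classical in
variable (T) in
/-- The local gauges: the trivial one off the edges, and near an edge the one that
jumps from the edge to its right side by the inverse of the generator of the edge. -/
noncomputable def localGauge : Option T.edges → PuncturedPlane Z → FreeGroup T.edges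
  | none, _ => 1
  | some e, x => if (x : Plane) ∈ T.rightSide e then (FreeGroup.of e)⁻¹ else 1

open Classical in
variable (T) in
/-- The index of the edge through a point, if there is one. -/
noncomputable def edgeAt (x : PuncturedPlane Z) : Option T.edges :=
  if h : ∃ e : T.edges, (x : Plane) ∈ (e : Set Plane) then some h.choose else none

theorem edgeAt_of_mem {e : T.edges} {x : PuncturedPlane Z} (hx : (x : Plane) ∈ (e : Set Plane)) :
    T.edgeAt x = some e := by
  have h : ∃ e : T.edges, (x : Plane) ∈ (e : Set Plane) := ⟨e, hx⟩
  rw [edgeAt, dif_pos h, edge_unique hx h.choose_spec]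

theorem edgeAt_of_mem_free {x : PuncturedPlane Z} (hx : (x : Plane) ∈ T.free) :
    T.edgeAt x = none := by
  rw [edgeAt, dif_neg]
  rintro ⟨e, he⟩
  exact hx.2 (mem_support_of_mem he)

theorem localGauge_of_mem_rightSide {e : T.edges} {x : PuncturedPlane Z}
    (hx : (x : Plane) ∈ T.rightSide e) : T.localGauge (some e) x = (FreeGroup.of e)⁻¹ :=
  if_pos hx

theorem localGauge_of_notMem_rightSide {e : T.edges} {x : PuncturedPlane Z}
    (hx : (x : Plane) ∉ T.rightSide e) : T.localGauge (some e) x = 1 :=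
  if_neg hx

theorem isOpen_gaugeDomain (i : Option T.edges) : IsOpen (T.gaugeDomain i) := by
  cases i with
  | none => exact isOpen_free.preimage continuous_subtype_val
  | some e =>
    rw [isOpen_iff_mem_nhds]
    rintro x (hx | ⟨hx, hs⟩)
    · exact continuous_subtype_val.continuousAt.eventually (eventually_mem_or_side hx)
    · have h1 : ∀ᶠ y in 𝓝 (x : Plane), y ∈ T.free := isOpen_free.mem_nhds hx
      have h2 : ∀ᶠ y in 𝓝 (x : Plane), y ∈ T.leftSide e ∪ T.rightSide e :=
        ((isOpen_leftSide e).union (isOpen_rightSide e)).mem_nhds hs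
      filter_upwards [continuous_subtype_val.continuousAt.eventually (h1.and h2)] with y hy
      exact Or.inr hy

theorem eventually_localGauge_eq {i : Option T.edges} {x : PuncturedPlane Z}
    (hx : x ∈ T.gaugeDomain i) (hf : (x : Plane) ∈ T.free) :
    ∀ᶠ y in 𝓝 x, T.localGauge i y = T.localGauge i x := by
  cases i with
  | none => exact Eventually.of_forall fun _ => rfl
  | some e =>
    rcases hx with hx | ⟨-, hs | hs⟩
    · exact (hf.2 (mem_support_of_mem hx)).elim
    · have h1 : ∀ᶠ y : PuncturedPlane Z in 𝓝 x, (y : Plane) ∈ T.leftSide e :=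
        continuous_subtype_val.continuousAt.eventually_mem ((isOpen_leftSide e).mem_nhds hs)
      filter_upwards [h1] with y hy
      rw [localGauge_of_notMem_rightSide fun h => notMem_leftSide_of_mem_rightSide h hy,
        localGauge_of_notMem_rightSide fun h => notMem_leftSide_of_mem_rightSide h hs]
    · have h1 : ∀ᶠ y : PuncturedPlane Z in 𝓝 x, (y : Plane) ∈ T.rightSide e :=
        continuous_subtype_val.continuousAt.eventually_mem ((isOpen_rightSide e).mem_nhds hs)
      filter_upwards [h1] with y hy
      rw [localGauge_of_mem_rightSide hy, localGauge_of_mem_rightSide hs]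

variable (T) in
/-- The flat gauge on the punctured plane whose holonomy records the crossings of the edges. -/
noncomputable def flatGauge : FlatGauge (PuncturedPlane Z) (FreeGroup T.edges) (Option T.edges) where
  domain := T.gaugeDomain
  isOpen_domain := isOpen_gaugeDomain
  index := T.edgeAt
  mem_domain x := by
    rcases mem_free_or_exists (T := T) x.2 with h | ⟨e, he⟩
    · rw [edgeAt_of_mem_free h]; exact h
    · rw [edgeAt_of_mem he]; exact .inl he
  gauge := T.localGauge
  gauge_index x := by
    rcases mem_free_or_exists (T := T) x.2 with h | ⟨e, he⟩
    · rw [edgeAt_of_mem_free h]; rfl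
    · rw [edgeAt_of_mem he, localGauge_of_notMem_rightSide (notMem_side_of_mem he).2]
  eventually_eq i j x hx := by
    rcases eq_or_ne i j with rfl | hij
    · simp
    -- Domains of different gauges overlap only off the edges, since a point of an edge lies in the
    -- domain of that edge's gauge only. Off the edges all gauges are locally constant.
    have hf : (x : Plane) ∈ T.free := by
      refine (mem_free_or_exists (T := T) x.2).resolve_right ?_
      rintro ⟨e, he⟩
      have key : ∀ i, x ∈ T.gaugeDomain i → i = some e := by
        rintro (_ | e') h
        · exact (h.2 (mem_support_of_mem he)).elim
        · rcases h with h | ⟨h, -⟩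
          · rw [edge_unique he h]
          · exact (h.2 (mem_support_of_mem he)).elim
      exact hij ((key i hx.1).trans (key j hx.2).symm)
    filter_upwards [eventually_localGauge_eq hx.1 hf, eventually_localGauge_eq hx.2 hf] with y h1 h2
    rw [h1, h2]

variable {A : Type*} [TopologicalSpace A] {f : A → PuncturedPlane Z} {g : A → FreeGroup T.edges}

theorem eventually_eq_of_isLift_of_mem_free (h : T.flatGauge.IsLift f g) {a₀ : A}
    (ha : (f a₀ : Plane) ∈ T.free) : ∀ᶠ a in 𝓝 a₀, g a = g a₀ := by
  have := h a₀
  simp only [flatGauge, edgeAt_of_mem_free ha, localGauge, mul_one] at this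
  exact this

/-- Near the edge, `g` times the gauge is constant, and the gauge is the inverse generator exactly
on the right side. -/
theorem eventually_of_isLift_of_mem (h : T.flatGauge.IsLift f g) {a₀ : A} {e : T.edges}
    (ha : (f a₀ : Plane) ∈ (e : Set Plane)) :
    ∀ᶠ a in 𝓝 a₀, ((f a : Plane) ∈ T.rightSide e → g a = g a₀ * FreeGroup.of e) ∧
      ((f a : Plane) ∉ T.rightSide e → g a = g a₀) := by
  filter_upwards [h a₀] with a h
  simp only [flatGauge, edgeAt_of_mem ha] at h
  refine ⟨fun hr => ?_, fun hr => ?_⟩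
  · rw [localGauge_of_mem_rightSide hr] at h
    rw [← h]; group
  · rw [localGauge_of_notMem_rightSide hr, mul_one] at h
    exact h

end EdgeSystem

/-! ### Intersections of a loop and its lift -/

/-- A function that is locally constant along a connected set of its domain is constant on it. -/
theorem IsPreconnected.eq_of_eventually_eq {A B : Type*} [TopologicalSpace A] {s : Set A}
    (hs : IsPreconnected s) {g : A → B} (h : ∀ a ∈ s, ∀ᶠ b in 𝓝[s] a, g b = g a) {a b : A}
    (ha : a ∈ s) (hb : b ∈ s) : g a = g b := by
  have : PreconnectedSpace s := Subtype.preconnectedSpace hs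
  have hloc : IsLocallyConstant fun x : s => g x := by
    rw [IsLocallyConstant.iff_eventually_eq]
    rintro ⟨x, hx⟩
    have := h x hx
    rw [nhdsWithin_eq_map_subtype_coe hx] at this
    exact this
  exact hloc.apply_eq_of_preconnectedSpace ⟨a, ha⟩ ⟨b, hb⟩

/-- The component of a point of a closed set of real numbers is a compact interval if there are
points off the set on both sides. -/
theorem IsClosed.exists_Icc_subset {P : Set ℝ} (hP : IsClosed P) {c t d : ℝ} (hc : c ∉ P)
    (ht : t ∈ P) (hd : d ∉ P) (hct : c < t) (htd : t < d) :
    ∃ l r, c < l ∧ l ≤ t ∧ t ≤ r ∧ r < d ∧ Set.Icc l r ⊆ P ∧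
      ∀ l' r', l' ≤ l → r ≤ r' → Set.Icc l' r' ⊆ P → l' = l ∧ r' = r := by
  set C := connectedComponentIn P t
  have hCP : C ⊆ P := connectedComponentIn_subset P t
  have hconn : IsConnected C := isConnected_connectedComponentIn_iff.2 ht
  have htC : t ∈ C := mem_connectedComponentIn ht
  have hord := hconn.isPreconnected.ordConnected
  have hCb : C ⊆ Set.Icc c d := fun x hx =>
    ⟨le_of_not_gt fun h => hc (hCP (hord.out hx htC ⟨h.le, hct.le⟩)),
      le_of_not_gt fun h => hd (hCP (hord.out htC hx ⟨htd.le, h.le⟩))⟩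
  have hclosed : IsClosed C := by
    have : C = Subtype.val '' connectedComponent (⟨t, ht⟩ : P) := connectedComponentIn_eq_image ht
    rw [this]
    exact hP.isClosedEmbedding_subtypeVal.isClosedMap _ isClosed_connectedComponent
  have hcomp : IsCompact C := isCompact_Icc.of_isClosed_subset hclosed hCb
  have hI : C = Set.Icc (sInf C) (sSup C) := eq_Icc_of_connected_compact hconn hcomp
  have hl : sInf C ∈ C := hcomp.sInf_mem hconn.nonempty
  have hr : sSup C ∈ C := hcomp.sSup_mem hconn.nonempty
  rw [hI] at htC
  refine ⟨sInf C, sSup C, (hCb hl).1.lt_of_ne fun h => hc (hCP (h ▸ hl)), htC.1, htC.2,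
    (hCb hr).2.lt_of_ne fun h => hd (hCP (h ▸ hr)), hI ▸ hCP, fun l' r' h1 h2 h3 => ?_⟩
  have hsub : Set.Icc l' r' ⊆ C := isPreconnected_Icc.subset_connectedComponentIn
    ⟨h1.trans htC.1, htC.2.trans h2⟩ h3
  rw [hI] at hsub
  have hle : l' ≤ r' := h1.trans (htC.1.trans (htC.2.trans h2))
  exact ⟨le_antisymm h1 (hsub ⟨le_rfl, hle⟩).1, le_antisymm (hsub ⟨hle, le_rfl⟩).2 h2⟩

namespace Loop

variable {Y : Type*} [TopologicalSpace Y] (γ : Loop Y)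

theorem continuous_periodic : Continuous γ.periodic := by
  have h := ContinuousOn.comp_fract'' (α := ℝ) (f := Set.IccExtend zero_le_one γ.toMap)
    (γ.toMap.continuous.Icc_extend' (h := zero_le_one)).continuousOn
    (by simpa using γ.closed)
  refine h.congr fun t => ?_
  exact Set.IccExtend_of_mem _ _ _

theorem periodic_coe (t : unitInterval) : γ.periodic t = γ.toMap t := by
  rcases eq_or_ne t 1 with rfl | ht
  · rw [← γ.closed]
    simp [periodic]
  · have : Int.fract (t : ℝ) = t :=
      Int.fract_eq_self.2 ⟨t.2.1, t.2.2.lt_of_ne fun h => ht (Subtype.ext h)⟩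
    rw [periodic]
    congr 1
    exact Subtype.ext this

theorem periodic_add_int (t : ℝ) (n : ℤ) : γ.periodic (t + n) = γ.periodic t := by
  simp [periodic]

end Loop

namespace EdgeSystem

variable {Z : Finset Plane} {T : EdgeSystem Z} {γ : Loop (PuncturedPlane Z)}

theorem mem_free_iff {x : PuncturedPlane Z} : (x : Plane) ∈ T.free ↔ (x : Plane) ∉ T.support :=
  ⟨fun h => h.2, fun h => ⟨x.2, h⟩⟩

theorem continuous_coe_periodic (γ : Loop (PuncturedPlane Z)) :
    Continuous fun t => (γ.periodic t : Plane) :=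
  continuous_subtype_val.comp γ.continuous_periodic

theorem isClosed_preimage (γ : Loop (PuncturedPlane Z)) (e : T.edges) :
    IsClosed {t | (γ.periodic t : Plane) ∈ (e : Set Plane)} := by
  have : {t | (γ.periodic t : Plane) ∈ (e : Set Plane)} =
      (fun t => (γ.periodic t : Plane)) ⁻¹' ((e : Set Plane) ∪ Z) := by
    ext t
    have := (γ.periodic t).2
    simp [this]
  rw [this]
  exact (T.straight e).isClosed_union.preimage (continuous_coe_periodic γ)

theorem exists_isVisit {c t d : ℝ} (hc : (γ.periodic c : Plane) ∉ T.support)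
    (ht : (γ.periodic t : Plane) ∈ T.support) (hd : (γ.periodic d : Plane) ∉ T.support)
    (hct : c < t) (htd : t < d) : ∃ e l r, T.IsVisit γ e l r ∧ c < l ∧ l ≤ t ∧ t ≤ r ∧ r < d := by
  obtain ⟨e, he⟩ := mem_support_iff.1 ht
  obtain ⟨l, r, h1, h2, h3, h4, h5, h6⟩ := (isClosed_preimage γ e).exists_Icc_subset
    (fun h => hc (mem_support_of_mem h)) he (fun h => hd (mem_support_of_mem h)) hct htd
  exact ⟨e, l, r, ⟨h2.trans h3, h5, h6⟩, h1, h2, h3, h4⟩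

namespace IsVisit

variable {e e' : T.edges} {l r l' r' : ℝ}

theorem mem_left (h : T.IsVisit γ e l r) : (γ.periodic l : Plane) ∈ (e : Set Plane) :=
  h.2.1 l ⟨le_rfl, h.1⟩

theorem mem_right (h : T.IsVisit γ e l r) : (γ.periodic r : Plane) ∈ (e : Set Plane) :=
  h.2.1 r ⟨h.1, le_rfl⟩

/-- Visits that meet are equal. -/
theorem eq_of_mem (h : T.IsVisit γ e l r) (h' : T.IsVisit γ e' l' r') {t : ℝ}
    (ht : t ∈ Set.Icc l r) (ht' : t ∈ Set.Icc l' r') : e' = e ∧ l' = l ∧ r' = r := by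
  obtain rfl := edge_unique (h.2.1 t ht) (h'.2.1 t ht')
  have key : ∀ s ∈ Set.Icc (min l l') (max r r'), (γ.periodic s : Plane) ∈ (e' : Set Plane) := by
    intro s hs
    rcases le_total s t with hst | hst
    · rcases min_le_iff.1 hs.1 with h1 | h1
      · exact h.2.1 s ⟨h1, hst.trans ht.2⟩
      · exact h'.2.1 s ⟨h1, hst.trans ht'.2⟩
    · rcases le_max_iff.1 hs.2 with h1 | h1
      · exact h.2.1 s ⟨ht.1.trans hst, h1⟩
      · exact h'.2.1 s ⟨ht'.1.trans hst, h1⟩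
  have a := h.2.2 _ _ (min_le_left _ _) (le_max_left _ _) key
  have b := h'.2.2 _ _ (min_le_right _ _) (le_max_right _ _) key
  exact ⟨rfl, b.1.symm.trans a.1, b.2.symm.trans a.2⟩

theorem add_int (h : T.IsVisit γ e l r) (n : ℤ) : T.IsVisit γ e (l + n) (r + n) := by
  refine ⟨by linarith [h.1], fun t ht => ?_, fun l' r' hl hr H => ?_⟩
  · have := h.2.1 (t - n) ⟨by linarith [ht.1], by linarith [ht.2]⟩
    rwa [← γ.periodic_add_int _ n, sub_add_cancel] at this
  · have := h.2.2 (l' - n) (r' - n) (by linarith) (by linarith) fun t ht => by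
      have := H (t + n) ⟨by linarith [ht.1], by linarith [ht.2]⟩
      rwa [γ.periodic_add_int] at this
    exact ⟨by linarith [this.1], by linarith [this.2]⟩

end IsVisit

theorem passes_iff {A B : Set Plane} {l r : ℝ} : Passes γ A B l r ↔
    (∀ᶠ t in 𝓝[<] l, (γ.periodic t : Plane) ∈ A) ∧
      ∀ᶠ t in 𝓝[>] r, (γ.periodic t : Plane) ∈ B := by
  constructor
  · rintro ⟨ε, hε, h1, h2⟩
    exact ⟨eventually_of_mem (Ioo_mem_nhdsLT (by linarith)) h1,
      eventually_of_mem (Ioo_mem_nhdsGT (by linarith)) h2⟩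
  · rintro ⟨h1, h2⟩
    obtain ⟨a, ha, h1⟩ := (mem_nhdsLT_iff_exists_Ioo_subset' (sub_one_lt l)).1 h1
    obtain ⟨b, hb, h2⟩ := (mem_nhdsGT_iff_exists_Ioo_subset' (lt_add_one r)).1 h2
    have ha : a < l := ha
    have hb : r < b := hb
    refine ⟨min (l - a) (b - r), lt_min (by linarith) (by linarith), fun t ht => h1 ⟨?_, ht.2⟩,
      fun t ht => h2 ⟨ht.1, ?_⟩⟩
    · linarith [ht.1, min_le_left (l - a) (b - r)]
    · linarith [ht.2, min_le_right (l - a) (b - r)]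

theorem IsVisit.crossesAt_iff {e : T.edges} {l r : ℝ} (h : T.IsVisit γ e l r) {x : T.Letter} :
    T.CrossesAt γ r x ↔ x.1 = e ∧
      match x.2 with
      | true => Passes γ (T.leftSide e) (T.rightSide e) l r
      | false => Passes γ (T.rightSide e) (T.leftSide e) l r := by
  constructor
  · rintro ⟨l', h1, h2⟩
    obtain ⟨he, rfl, -⟩ := h.eq_of_mem h1 ⟨h.1, le_rfl⟩ ⟨h1.1, le_rfl⟩
    rw [he] at h2
    exact ⟨he, h2⟩
  · rintro ⟨he, h2⟩
    refine ⟨l, he ▸ h, ?_⟩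
    rw [he]
    exact h2

/-- A loop that is off the edges just before or just after a time at which it is in an edge is on one
side of that edge. -/
theorem eventually_side {e : T.edges} {t : ℝ} (ht : (γ.periodic t : Plane) ∈ (e : Set Plane))
    {F : Filter ℝ} (hF : F = 𝓝[<] t ∨ F = 𝓝[>] t)
    (h : ∀ᶠ s in F, (γ.periodic s : Plane) ∉ T.support) :
    (∀ᶠ s in F, (γ.periodic s : Plane) ∈ T.leftSide e) ∨
      ∀ᶠ s in F, (γ.periodic s : Plane) ∈ T.rightSide e := by
  have hle : F ≤ 𝓝 t := by
    rcases hF with rfl | rfl <;> exact nhdsWithin_le_nhds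
  have h1 : ∀ᶠ s in F, (γ.periodic s : Plane) ∈ T.leftSide e ∪ T.rightSide e := by
    filter_upwards [h, hle ((continuous_coe_periodic γ).continuousAt.eventually
      (eventually_mem_or_side ht))] with s hs hs'
    rcases hs' with hs' | hs'
    · exact (hs (mem_support_of_mem hs')).elim
    · exact hs'.2
  have h2 : ∃ a b : ℝ, Set.Ioo a b ∈ F ∧
      ∀ s ∈ Set.Ioo a b, (γ.periodic s : Plane) ∈ T.leftSide e ∪ T.rightSide e := by
    rcases hF with rfl | rfl
    · obtain ⟨a, ha, h⟩ := (mem_nhdsLT_iff_exists_Ioo_subset' (sub_one_lt t)).1 h1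
      exact ⟨a, t, Ioo_mem_nhdsLT ha, h⟩
    · obtain ⟨b, hb, h⟩ := (mem_nhdsGT_iff_exists_Ioo_subset' (lt_add_one t)).1 h1
      exact ⟨t, b, Ioo_mem_nhdsGT hb, h⟩
  obtain ⟨a, b, hab, h2⟩ := h2
  have hdisj : Disjoint (T.leftSide e) (T.rightSide e) :=
    Set.disjoint_right.2 fun _ => notMem_leftSide_of_mem_rightSide
  have key := IsPreconnected.subset_or_subset (isOpen_leftSide e) (isOpen_rightSide e) hdisj
    (Set.image_subset_iff.2 h2)
    (isPreconnected_Ioo.image _ (continuous_coe_periodic γ).continuousOn)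
  exact key.imp (fun h => eventually_of_mem hab fun s hs => h ⟨s, hs, rfl⟩)
    fun h => eventually_of_mem hab fun s hs => h ⟨s, hs, rfl⟩

theorem letterAt_eq_some {r : ℝ} {x : T.Letter} (hx : T.CrossesAt γ r x)
    (hu : ∀ y, T.CrossesAt γ r y → y = x) : T.letterAt γ r = some x := by
  have h : ∃ x, T.CrossesAt γ r x := ⟨x, hx⟩
  rw [letterAt, dif_pos h, hu _ h.choose_spec]

theorem letterAt_eq_none {r : ℝ} (h : ∀ x, ¬ T.CrossesAt γ r x) : T.letterAt γ r = none :=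
  dif_neg (not_exists.2 h)

theorem not_eventually_both_sides {e : T.edges} {F : Filter ℝ} [F.NeBot]
    (h : ∀ᶠ s in F, (γ.periodic s : Plane) ∈ T.leftSide e)
    (h' : ∀ᶠ s in F, (γ.periodic s : Plane) ∈ T.rightSide e) : False := by
  obtain ⟨s, hs, hs'⟩ := (h.and h').exists
  exact notMem_leftSide_of_mem_rightSide hs' hs

variable {g : ℝ → FreeGroup T.edges}

theorem eq_of_isLift_of_Icc (hg : T.flatGauge.IsLift γ.periodic g) {c d : ℝ} (hcd : c ≤ d)
    (h : ∀ t ∈ Set.Icc c d, (γ.periodic t : Plane) ∉ T.support) : g c = g d :=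
  isPreconnected_Icc.eq_of_eventually_eq (s := Set.Icc c d)
    (fun t ht => nhdsWithin_le_nhds
      (eventually_eq_of_isLift_of_mem_free hg (mem_free_iff.2 (h t ht))))
    ⟨le_rfl, hcd⟩ ⟨hcd, le_rfl⟩

/-- Along an intersection the lift is multiplied by the letter of the intersection. -/
theorem IsVisit.eventually_lift_eq (hg : T.flatGauge.IsLift γ.periodic g) {e : T.edges} {l r : ℝ}
    (h : T.IsVisit γ e l r) (hl : ∀ᶠ t in 𝓝[<] l, (γ.periodic t : Plane) ∉ T.support)
    (hr : ∀ᶠ t in 𝓝[>] r, (γ.periodic t : Plane) ∉ T.support) :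
    ∃ a, (∀ᶠ t in 𝓝[<] l, g t = a) ∧
      ∀ᶠ t in 𝓝[>] r, g t = a * FreeGroup.mk (T.letterAt γ r).toList := by
  -- During the visit the loop is never strictly to the right of the edge, so the lift does not
  -- jump.
  have hlr : g l = g r := by
    refine isPreconnected_Icc.eq_of_eventually_eq (s := Set.Icc l r) (fun t ht => ?_)
      ⟨le_rfl, h.1⟩ ⟨h.1, le_rfl⟩
    filter_upwards [nhdsWithin_le_nhds (eventually_of_isLift_of_mem hg (h.2.1 t ht)),
      self_mem_nhdsWithin] with s hs hs'
    exact hs.2 (notMem_side_of_mem (h.2.1 s hs')).2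
  have gl := nhdsWithin_le_nhds (s := Set.Iio l) (eventually_of_isLift_of_mem hg h.mem_left)
  have gr := nhdsWithin_le_nhds (s := Set.Ioi r) (eventually_of_isLift_of_mem hg h.mem_right)
  have left_of {F : Filter ℝ} {b : FreeGroup T.edges}
      (H : ∀ᶠ t in F, ((γ.periodic t : Plane) ∈ T.rightSide e → g t = b * FreeGroup.of e) ∧
        ((γ.periodic t : Plane) ∉ T.rightSide e → g t = b))
      (hs : ∀ᶠ t in F, (γ.periodic t : Plane) ∈ T.leftSide e) : ∀ᶠ t in F, g t = b := by
    filter_upwards [H, hs] with t h1 h2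
    exact h1.2 fun h => notMem_leftSide_of_mem_rightSide h h2
  have right_of {F : Filter ℝ} {b : FreeGroup T.edges}
      (H : ∀ᶠ t in F, ((γ.periodic t : Plane) ∈ T.rightSide e → g t = b * FreeGroup.of e) ∧
        ((γ.periodic t : Plane) ∉ T.rightSide e → g t = b))
      (hs : ∀ᶠ t in F, (γ.periodic t : Plane) ∈ T.rightSide e) :
      ∀ᶠ t in F, g t = b * FreeGroup.of e := by
    filter_upwards [H, hs] with t h1 h2
    exact h1.1 h2
  have cross := @h.crossesAt_iff
  -- There are four combinations of the sides before and after. The lift is `g l` on the left and `g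
  -- l * FreeGroup.of e` on the right, so the change is trivial, the generator, its inverse, or
  -- trivial.
  rcases eventually_side h.mem_left (.inl rfl) hl with sl | sl <;>
    rcases eventually_side h.mem_right (.inr rfl) hr with sr | sr
  · refine ⟨g l, left_of gl sl, ?_⟩
    rw [letterAt_eq_none, hlr]
    · simpa [← FreeGroup.one_eq_mk] using left_of gr sr
    · rintro ⟨e', _ | _⟩ hx
      · exact not_eventually_both_sides sl (passes_iff.1 (cross.1 hx).2).1
      · exact not_eventually_both_sides sr (passes_iff.1 (cross.1 hx).2).2
  · refine ⟨g l, left_of gl sl, ?_⟩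
    rw [letterAt_eq_some (x := (e, true)) (cross.2 ⟨rfl, passes_iff.2 ⟨sl, sr⟩⟩), hlr]
    · exact right_of gr sr
    · rintro ⟨e', _ | _⟩ hx
      · exact (not_eventually_both_sides sl (passes_iff.1 (cross.1 hx).2).1).elim
      · exact Prod.ext (cross.1 hx).1 rfl
  · refine ⟨g l * FreeGroup.of e, right_of gl sl, ?_⟩
    rw [letterAt_eq_some (x := (e, false)) (cross.2 ⟨rfl, passes_iff.2 ⟨sl, sr⟩⟩), hlr]
    · have : FreeGroup.mk (some (e, false)).toList = (FreeGroup.of e)⁻¹ := rfl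
      rw [this, mul_inv_cancel_right]
      exact left_of gr sr
    · rintro ⟨e', _ | _⟩ hx
      · exact Prod.ext (cross.1 hx).1 rfl
      · exact (not_eventually_both_sides (passes_iff.1 (cross.1 hx).2).1 sl).elim
  · refine ⟨g l * FreeGroup.of e, right_of gl sl, ?_⟩
    rw [letterAt_eq_none, hlr]
    · simpa [← FreeGroup.one_eq_mk] using right_of gr sr
    · rintro ⟨e', _ | _⟩ hx
      · exact not_eventually_both_sides (passes_iff.1 (cross.1 hx).2).2 sr
      · exact not_eventually_both_sides (passes_iff.1 (cross.1 hx).2).1 sl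

/-- The lift between two times off the edges changes by the word read between them. -/
theorem lift_eq_mul_mk (hg : T.flatGauge.IsLift γ.periodic g) {c : ℝ}
    (hc : (γ.periodic c : Plane) ∉ T.support) (L : List ℝ) :
    ∀ d, c ≤ d → (γ.periodic d : Plane) ∉ T.support → L.Pairwise (· < ·) →
      (∀ r, r ∈ L ↔ (∃ e l, T.IsVisit γ e l r) ∧ c < r ∧ r < d) →
      g d = g c * FreeGroup.mk (L.filterMap (T.letterAt γ)) := by
  have off {a b : ℝ} (ha : (γ.periodic a : Plane) ∉ T.support)
      (hb : (γ.periodic b : Plane) ∉ T.support)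
      (h : ∀ e l r, T.IsVisit γ e l r → a < l → r < b → False) :
      ∀ t ∈ Set.Icc a b, (γ.periodic t : Plane) ∉ T.support := by
    intro t ht hts
    have h1 : a < t := ht.1.lt_of_ne fun h => ha (h ▸ hts)
    have h2 : t < b := ht.2.lt_of_ne fun h => hb (h ▸ hts)
    obtain ⟨e, l, r, hv, hl, -, -, hr⟩ := exists_isVisit ha hts hb h1 h2
    exact h e l r hv hl hr
  -- Induction on the intersections, splitting off the last one at a time `c'` off the edges, after
  -- all earlier intersections and just before the last begins.
  induction L using List.reverseRecOn with
  | nil =>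
    intro d hcd hd _ hL
    rw [List.filterMap_nil, ← FreeGroup.one_eq_mk, mul_one]
    refine (eq_of_isLift_of_Icc hg hcd (off hc hd fun e l r hv hl hr => ?_)).symm
    exact List.not_mem_nil ((hL r).2 ⟨⟨e, l, hv⟩, hl.trans_le hv.1, hr⟩)
  | append_singleton L r ih =>
    intro d hcd hd hs hL
    obtain ⟨⟨e, l, hv⟩, hcr, hrd⟩ := (hL r).1 (by simp)
    have hLr : ∀ r' ∈ L, r' < r := fun r' hr' =>
      (List.pairwise_append.1 hs).2.2 r' hr' r (by simp)
    have hcl : c < l := lt_of_not_ge fun h => hc (mem_support_of_mem (hv.2.1 c ⟨h, hcr.le⟩))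
    have hLl : ∀ r' ∈ L, r' < l := by
      intro r' hr'
      by_contra! hle
      obtain ⟨⟨e', l', hv'⟩, -, -⟩ := (hL r').1 (by simp [hr'])
      exact (hLr r' hr').ne
        (hv.eq_of_mem hv' ⟨hle, (hLr r' hr').le⟩ ⟨hv'.1, le_rfl⟩).2.2
    have hafter : ∀ t ∈ Set.Ioc r d, (γ.periodic t : Plane) ∉ T.support := by
      intro t ht hts
      have h2 : t < d := ht.2.lt_of_ne fun h => hd (h ▸ hts)
      obtain ⟨e', l', r', hv', -, -, hr, hr'⟩ :=
        exists_isVisit hc hts hd (hcr.trans ht.1) h2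
      have : r' ∈ L ++ [r] := (hL r').2 ⟨⟨e', l', hv'⟩, by linarith [ht.1], hr'⟩
      rcases List.mem_append.1 this with h | h
      · linarith [hLr r' h, ht.1]
      · rw [List.mem_singleton] at h
        linarith [ht.1]
    have hbefore : ∀ᶠ t in 𝓝[<] l, c < t ∧ (∀ r' ∈ L, r' < t) ∧
        (γ.periodic t : Plane) ∉ T.support := by
      have h1 : ∀ᶠ t in 𝓝[<] l, ∀ r' ∈ L.toFinset, r' < t :=
        (L.toFinset.eventually_all).2 fun r' hr' =>
          nhdsWithin_le_nhds (lt_mem_nhds (hLl r' (List.mem_toFinset.1 hr')))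
      filter_upwards [h1, nhdsWithin_le_nhds (lt_mem_nhds hcl), self_mem_nhdsWithin]
        with t h1 h2 h3
      have h3 : t < l := h3
      refine ⟨h2, fun r' hr' => h1 r' (List.mem_toFinset.2 hr'), fun hts => ?_⟩
      obtain ⟨e', l', r', hv', hl, hl', hr, hr'⟩ :=
        exists_isVisit hc hts hd h2 (h3.trans_le (hv.1.trans hrd.le))
      have : r' ∈ L ++ [r] := (hL r').2 ⟨⟨e', l', hv'⟩, h2.trans_le hr, hr'⟩
      rcases List.mem_append.1 this with h | h
      · linarith [h1 r' (List.mem_toFinset.2 h)]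
      · rw [List.mem_singleton] at h
        obtain rfl := h
        linarith [(hv.eq_of_mem hv' ⟨hv.1, le_rfl⟩ ⟨hv'.1, le_rfl⟩).2.1]
    obtain ⟨a, ha, ha'⟩ := hv.eventually_lift_eq hg (hbefore.mono fun t h => h.2.2)
      (eventually_of_mem (Ioc_mem_nhdsGT hrd) hafter)
    obtain ⟨c', hc', ⟨hcc', hLc', hc's⟩, hc'l⟩ :=
      (ha.and (hbefore.and self_mem_nhdsWithin)).exists
    have hc'l : c' < l := hc'l
    obtain ⟨d', hd', hrd'⟩ := (ha'.and (Ioc_mem_nhdsGT hrd)).exists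
    have e1 : g d' = g d := eq_of_isLift_of_Icc hg hrd'.2 fun t ht =>
      hafter t ⟨hrd'.1.trans_le ht.1, ht.2⟩
    have e2 := ih c' hcc'.le hc's (List.pairwise_append.1 hs).1 fun r' => by
      constructor
      · intro hr'
        have := (hL r').1 (by simp [hr'])
        exact ⟨this.1, this.2.1, hLc' r' hr'⟩
      · rintro ⟨h1, h2, h3⟩
        have hlt : r' < r := h3.trans (hc'l.trans_le hv.1)
        have := (hL r').2 ⟨h1, h2, hlt.trans hrd⟩
        rcases List.mem_append.1 this with h | h
        · exact h
        · rw [List.mem_singleton] at h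
          exact (hlt.ne h).elim
    rw [← e1, hd', ← hc', e2, List.filterMap_append, ← FreeGroup.mul_mk, mul_assoc]
    congr 3

end EdgeSystem

/-! ### The holonomy is spelled by the word -/

namespace EdgeSystem

variable {Z : Finset Plane} {T : EdgeSystem Z} {γ : Loop (PuncturedPlane Z)}

theorem mem_sort_visits (h : (T.visits γ).Finite) {r : ℝ} :
    r ∈ (h.image fun v => v.2.2).toFinset.sort (fun a b => a ≤ b) ↔
      (∃ e l, T.IsVisit γ e l r) ∧ 0 ≤ r ∧ r < 1 := by
  rw [Finset.mem_sort, Set.Finite.mem_toFinset, Set.mem_image]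
  constructor
  · rintro ⟨⟨e, l, r⟩, ⟨h1, h2, h3⟩, rfl⟩
    exact ⟨⟨e, l, h1⟩, h2, h3⟩
  · rintro ⟨⟨e, l, h1⟩, h2, h3⟩
    exact ⟨⟨e, l, r⟩, ⟨h1, h2, h3⟩, rfl⟩

theorem IsVisit.exists_add_int {r : ℝ} (h : ∃ e l, T.IsVisit γ e l r) (n : ℤ) :
    ∃ e l, T.IsVisit γ e l (r + n) := by
  obtain ⟨e, l, h⟩ := h
  exact ⟨e, l + n, h.add_int n⟩

/-- If a loop has an intersection, then the right end points of its intersections in `[0, 1)` are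
those in some interval of length one that starts and ends off the edges. -/
theorem exists_period (h : (T.visits γ).Finite) (hne : (T.visits γ).Nonempty) :
    ∃ c : ℝ, (γ.periodic c : Plane) ∉ T.support ∧
      ∀ r, ((∃ e l, T.IsVisit γ e l r) ∧ 0 ≤ r ∧ r < 1) ↔
        (∃ e l, T.IsVisit γ e l r) ∧ c < r ∧ r < c + 1 := by
  -- The earliest intersection `[l, r]` with `0 ≤ r` may begin at a negative time. The period is
  -- therefore started shortly before `l`, late enough that no other right end point of an
  -- intersection comes between.
  obtain ⟨⟨e, l, r⟩, ⟨hv, hr0, hr1⟩, hmin⟩ := h.exists_minimalFor (fun v => v.2.2) _ hne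
  dsimp only at hv hr0 hr1
  have hmin : ∀ r', (∃ e l, T.IsVisit γ e l r') → 0 ≤ r' → r' < 1 → r ≤ r' := by
    rintro r' ⟨e', l', hv'⟩ h0 h1
    by_contra! hlt
    exact hlt.not_ge (hmin (j := (e', l', r')) ⟨hv', h0, h1⟩ hlt.le)
  have hltl : ∀ r', (∃ e l, T.IsVisit γ e l r') → r' < r → r' < l := by
    rintro r' ⟨e', l', hv'⟩ hlt
    by_contra! hle
    exact hlt.ne (hv.eq_of_mem hv' ⟨hle, hlt.le⟩ ⟨hv'.1, le_rfl⟩).2.2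
  have hrl : r - 1 < l := by
    have := IsVisit.exists_add_int ⟨e, l, hv⟩ (-1)
    push_cast at this
    exact hltl (r - 1) this (by linarith)
  -- Were the loop in the edges at all times just before `l`, it would be in `e`, and the visit
  -- could be extended to the left.
  have hfreq : ∃ᶠ t in 𝓝[<] l, (γ.periodic t : Plane) ∉ T.support := by
    intro hev
    have hev' : ∀ᶠ t in 𝓝[<] l, (γ.periodic t : Plane) ∈ (e : Set Plane) := by
      filter_upwards [hev, nhdsWithin_le_nhds ((continuous_coe_periodic γ).continuousAt.eventually
        (eventually_mem_or_side hv.mem_left))] with t h1 h2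
      exact h2.resolve_right fun h => h1 h.1.2
    obtain ⟨a, ha, hsub⟩ := (mem_nhdsLT_iff_exists_Ioo_subset' (sub_one_lt l)).1 hev'
    have ha : a < l := ha
    have := (hv.2.2 ((a + l) / 2) r (by linarith) le_rfl fun t ht => by
      by_cases htl : t < l
      · exact hsub ⟨by linarith [ht.1], htl⟩
      · exact hv.2.1 t ⟨not_lt.1 htl, ht.2⟩).1
    linarith
  -- Shifting by one period reduces the intersections that end at negative times to the finitely
  -- many ones in `visits`.
  have hgap : ∀ᶠ t in 𝓝[<] l, ∀ v ∈ T.visits γ, v.2.2 - 1 < l → v.2.2 - 1 < t := by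
    refine (h.eventually_all).2 fun v _ => ?_
    by_cases hvl : v.2.2 - 1 < l
    · have : ∀ᶠ t in 𝓝[<] l, v.2.2 - 1 < t := nhdsWithin_le_nhds (lt_mem_nhds hvl)
      exact this.mono fun t ht _ => ht
    · exact Eventually.of_forall fun t h => (hvl h).elim
  have hnear : ∀ᶠ t in 𝓝[<] l, r - 1 < t := nhdsWithin_le_nhds (lt_mem_nhds hrl)
  obtain ⟨c, hc, hcgap, hrc, hcl⟩ := (hfreq.and_eventually
    (hgap.and (hnear.and self_mem_nhdsWithin))).exists
  have hcl : c < l := hcl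
  have hempty : ∀ r', (∃ e l, T.IsVisit γ e l r') → c < r' → r ≤ r' := by
    intro r' hr' hcr'
    by_contra! hlt
    have hneg : r' < 0 := by
      by_contra! h0
      exact hlt.not_ge (hmin r' hr' h0 (hlt.trans hr1))
    obtain ⟨e', l', hv'⟩ := IsVisit.exists_add_int hr' 1
    push_cast at hv'
    have := hcgap (e', l', r' + 1) ⟨hv', by dsimp only; linarith, by dsimp only; linarith⟩
    simp only [add_sub_cancel_right] at this
    linarith [this (hltl r' hr' hlt)]
  refine ⟨c, hc, fun r' => ⟨?_, ?_⟩⟩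
  · rintro ⟨hr', h0, h1⟩
    refine ⟨hr', (hcl.trans_le hv.1).trans_le (hmin r' hr' h0 h1), ?_⟩
    by_contra! hle
    have hpre := IsVisit.exists_add_int hr' (-1)
    push_cast at hpre
    have hne : c ≠ r' + -1 := by
      rintro rfl
      obtain ⟨e', l', hv'⟩ := hpre
      exact hc (mem_support_of_mem hv'.mem_right)
    have := hempty _ hpre (lt_of_le_of_ne (by linarith) hne)
    linarith
  · rintro ⟨hr', h0, h1⟩
    have hge := hempty r' hr' h0
    refine ⟨hr', hr0.trans hge, ?_⟩
    by_contra! hle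
    have hpre := IsVisit.exists_add_int hr' (-1)
    push_cast at hpre
    have hlr := hv.1
    linarith [hmin _ hpre (by linarith) (by linarith)]

/-- The holonomy of a loop is read off its word. -/
theorem exists_isLift_of_word (h : (T.visits γ).Finite) :
    ∃ g : unitInterval → FreeGroup T.edges, T.flatGauge.IsLift γ.toMap g ∧
      IsConj ((g 0)⁻¹ * g 1) (FreeGroup.mk (T.word γ h)) ∧
      ((γ.base : Plane) ∉ T.support → (g 0)⁻¹ * g 1 = FreeGroup.mk (T.word γ h)) := by
  obtain ⟨g, hg⟩ := FlatGauge.exists_isLift T.flatGauge ⟨γ.periodic, γ.continuous_periodic⟩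
  change T.flatGauge.IsLift γ.periodic g at hg
  have hword {c : ℝ} (hc : (γ.periodic c : Plane) ∉ T.support)
      (H : ∀ r, ((∃ e l, T.IsVisit γ e l r) ∧ 0 ≤ r ∧ r < 1) ↔
        (∃ e l, T.IsVisit γ e l r) ∧ c < r ∧ r < c + 1) :
      g (c + 1) = g c * FreeGroup.mk (T.word γ h) := by
    refine lift_eq_mul_mk hg hc _ (c + 1) (by linarith) ?_ (Finset.sortedLT_sort _).pairwise
      fun r => (mem_sort_visits h).trans (H r)
    have := γ.periodic_add_int c 1
    rw [Int.cast_one] at this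
    rwa [this]
  obtain ⟨a, ha⟩ : ∃ a, ∀ t, g (t + 1) = a * g t := by
    refine hg.exists_eq_mul (g' := fun t => g (t + 1)) ?_
    have := hg.comp (u := fun t : ℝ => t + 1) (by fun_prop)
    have hper : γ.periodic ∘ (fun t : ℝ => t + 1) = γ.periodic := funext fun t => by
      simpa using γ.periodic_add_int t 1
    rwa [hper] at this
  -- Translation by a period multiplies the lift by a constant on the left, so the holonomies
  -- measured from different starting times are conjugate.
  have hhol (c : ℝ) : IsConj ((g 0)⁻¹ * g 1) ((g c)⁻¹ * g (c + 1)) := by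
    have h1 : g 1 = a * g 0 := by simpa using ha 0
    rw [ha, h1]
    exact isConj_iff.2 ⟨(g c)⁻¹ * g 0, by group⟩
  refine ⟨fun t => g t, ?_, ?_, fun hb => ?_⟩
  · have := hg.comp (u := fun t : unitInterval => (t : ℝ)) continuous_subtype_val
    have hres : γ.periodic ∘ (fun t : unitInterval => (t : ℝ)) = γ.toMap :=
      funext fun t => γ.periodic_coe t
    rwa [hres] at this
  · change IsConj ((g 0)⁻¹ * g 1) _
    by_cases hne : (T.visits γ).Nonempty
    · obtain ⟨c, hc, H⟩ := exists_period h hne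
      have := hhol c
      rwa [hword hc H, inv_mul_cancel_left] at this
    by_cases hc : ∃ c, (γ.periodic c : Plane) ∉ T.support
    · obtain ⟨c, hc⟩ := hc
      have := hhol c
      rwa [hword hc, inv_mul_cancel_left] at this
      have hno : ∀ r, ¬ ∃ e l, T.IsVisit γ e l r := by
        intro r hr
        obtain ⟨e, l, hv⟩ := IsVisit.exists_add_int hr (-⌊r⌋)
        refine hne ⟨(e, l, _), hv, ?_, ?_⟩ <;> dsimp only <;> push_cast
        · linarith [Int.floor_le r]
        · linarith [Int.lt_floor_add_one r]
      simp [hno]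
    -- The loop never leaves the edges. Then the lift is constant and both sides are trivial.
    · push Not at hc
      have hconst : g 0 = g 1 := isPreconnected_univ.eq_of_eventually_eq (fun t _ => by
        rw [nhdsWithin_univ]
        obtain ⟨e, he⟩ := mem_support_iff.1 (hc t)
        filter_upwards [eventually_of_isLift_of_mem hg he,
          (continuous_coe_periodic γ).continuousAt.eventually (eventually_mem_or_side he)]
          with s h1 h2
        refine h1.2 (notMem_side_of_mem (h2.resolve_right fun h => h.1.2 (hc s))).2)
        (Set.mem_univ _) (Set.mem_univ _)
      have hempty : T.word γ h = [] := by
        have : ∀ r, r ∉ (h.image fun v => v.2.2).toFinset.sort (fun a b => a ≤ b) := by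
          intro r hr
          obtain ⟨⟨e, l, hv⟩, h0, h1⟩ := (mem_sort_visits h).1 hr
          exact hne ⟨(e, l, r), hv, h0, h1⟩
        rw [word, List.eq_nil_iff_forall_not_mem.2 this, List.filterMap_nil]
      rw [hempty, hconst, inv_mul_cancel, ← FreeGroup.one_eq_mk]
  · change (g 0)⁻¹ * g 1 = _
    have h0 : (γ.periodic 0 : Plane) ∉ T.support := by
      have := γ.periodic_coe 0
      rw [Set.Icc.coe_zero] at this
      rwa [this]
    -- With the base point off the edges the period can start at time `0`: no intersection ends
    -- there, so including or excluding `0` makes no difference.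
    have h01 := hword h0 fun r => by
      refine and_congr_right fun hr => ?_
      rw [zero_add]
      refine and_congr_left fun _ => ⟨fun h => h.lt_of_ne ?_, le_of_lt⟩
      rintro rfl
      obtain ⟨e, l, hv⟩ := hr
      exact h0 (mem_support_of_mem hv.mem_right)
    rw [zero_add] at h01
    rw [h01, inv_mul_cancel_left]

end EdgeSystem

end Topology

/-! ### Path classes of straight segments -/

section Homotopy

open Topology Filter CategoryTheory

namespace PuncturedPlane

variable {Z : Finset Plane}

/-- The class of a path in the fundamental groupoid. -/
def cls {X : Type*} [TopologicalSpace X] {x y : X} (p : Path x y) :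
    FundamentalGroupoid.mk x ⟶ FundamentalGroupoid.mk y := Path.Homotopic.Quotient.mk p

theorem cls_trans {X : Type*} [TopologicalSpace X] {x y z : X} (p : Path x y) (q : Path y z) :
    cls (p.trans q) = cls p ≫ cls q := rfl

theorem cls_refl {X : Type*} [TopologicalSpace X] (x : X) : cls (Path.refl x) = 𝟙 _ := rfl

theorem cls_eq_iff {X : Type*} [TopologicalSpace X] {x y : X} {p q : Path x y} :
    cls p = cls q ↔ p.Homotopic q := Path.Homotopic.Quotient.eq

instance : PathConnectedSpace (PuncturedPlane Z) := by
  have h : IsPathConnected ((Z : Set Plane)ᶜ) := by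
    refine Set.Countable.isPathConnected_compl_of_one_lt_rank ?_ Z.countable_toSet
    rw [← Module.finrank_eq_rank, finrank_euclideanSpace_fin]
    norm_num
  exact isPathConnected_iff_pathConnectedSpace.1 h

/-- The straight path between two points of the punctured plane. -/
noncomputable def segmentPath {x y : PuncturedPlane Z} (h : segment ℝ (x : Plane) y ⊆ {w | w ∉ Z}) : Path x y where
  toFun t := ⟨AffineMap.lineMap (x : Plane) y (t : ℝ), h (by
    rw [segment_eq_image_lineMap]; exact ⟨t, t.2, rfl⟩)⟩
  source' := by simp
  target' := by simp

open Classical in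
/-- The class of the straight path between two points of the punctured plane (and of an arbitrary
path if there is no straight one). -/
noncomputable def sg (x y : PuncturedPlane Z) :
    FundamentalGroupoid.mk x ⟶ FundamentalGroupoid.mk y :=
  if h : segment ℝ (x : Plane) y ⊆ {w | w ∉ Z} then cls (segmentPath h)
  else cls (PathConnectedSpace.somePath x y)

/-- The points visible from `b` form a star-shaped, hence contractible, set that contains both
paths. All elementary homotopies below come from this. -/
theorem homotopic_of_visible {b y : PuncturedPlane Z} (p q : Path b y)
    (hp : ∀ t, segment ℝ (b : Plane) (p t) ⊆ {w | w ∉ Z})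
    (hq : ∀ t, segment ℝ (b : Plane) (q t) ⊆ {w | w ∉ Z}) : p.Homotopic q := by
  let S : Set Plane := {w | segment ℝ (b : Plane) w ⊆ {w | w ∉ Z}}
  have hb : (b : Plane) ∈ S := by
    simp only [S, Set.mem_ofPred_eq, segment_same, Set.singleton_subset_iff]
    exact b.2
  have hstar : StarConvex ℝ (b : Plane) S := by
    intro w hw a c ha hc hac
    exact ((convex_segment (b : Plane) w).segment_subset (left_mem_segment ℝ _ w)
      ⟨a, c, ha, hc, hac, rfl⟩).trans hw
  have : ContractibleSpace S := hstar.contractibleSpace ⟨_, hb⟩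
  let j : C(S, PuncturedPlane Z) := ⟨fun w => ⟨w, w.2 (right_mem_segment ℝ _ _)⟩, by fun_prop⟩
  have hy : (y : Plane) ∈ S := by
    have := hp 1
    rwa [p.target] at this
  let lift (r : Path b y) (hr : ∀ t, segment ℝ (b : Plane) (r t) ⊆ {w | w ∉ Z}) :
      Path (⟨b, hb⟩ : S) ⟨y, hy⟩ :=
    { toFun := fun t => ⟨r t, hr t⟩
      continuous_toFun := by fun_prop
      source' := by simp
      target' := by simp }
  have := (SimplyConnectedSpace.paths_homotopic (lift p hp) (lift q hq)).map j
  exact this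

theorem segment_subset_of_mem {b y : Plane} (h : segment ℝ b y ⊆ {w | w ∉ Z}) {w : Plane}
    (hw : w ∈ segment ℝ b y) : segment ℝ b w ⊆ {w | w ∉ Z} :=
  ((convex_segment b y).segment_subset (left_mem_segment ℝ b y) hw).trans h

theorem segmentPath_mem {x y : PuncturedPlane Z} (h : segment ℝ (x : Plane) y ⊆ {w | w ∉ Z})
    (t : unitInterval) : (segmentPath h t : Plane) ∈ segment ℝ (x : Plane) y := by
  rw [segment_eq_image_lineMap]; exact ⟨t, t.2, rfl⟩

theorem sg_comp_cls {b y y' : PuncturedPlane Z} (p : Path y y')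
    (hp : ∀ t, segment ℝ (b : Plane) (p t) ⊆ {w | w ∉ Z}) : sg b y ≫ cls p = sg b y' := by
  have hy : segment ℝ (b : Plane) y ⊆ {w | w ∉ Z} := by simpa using hp 0
  have hy' : segment ℝ (b : Plane) y' ⊆ {w | w ∉ Z} := by simpa using hp 1
  rw [sg, sg, dif_pos hy, dif_pos hy', ← cls_trans, cls_eq_iff]
  refine homotopic_of_visible _ _ (fun t => ?_)
    fun t => segment_subset_of_mem hy' (segmentPath_mem hy' t)
  have : (segmentPath hy).trans p t ∈ Set.range ((segmentPath hy).trans p) := ⟨t, rfl⟩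
  rw [Path.trans_range] at this
  rcases this with ⟨s, hs⟩ | ⟨s, hs⟩
  · rw [← hs]; exact segment_subset_of_mem hy (segmentPath_mem hy s)
  · rw [← hs]; exact hp s

theorem sg_comp_sg {b y y' : PuncturedPlane Z}
    (h : ∀ w ∈ segment ℝ (y : Plane) y', w ∉ Z ∧ segment ℝ (b : Plane) w ⊆ {w | w ∉ Z}) :
    sg b y ≫ sg y y' = sg b y' := by
  have hyy : segment ℝ (y : Plane) y' ⊆ {w | w ∉ Z} := fun w hw => (h w hw).1
  rw [sg.eq_1 y y', dif_pos hyy]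
  exact sg_comp_cls _ fun t => (h _ (segmentPath_mem hyy t)).2

theorem sg_self (x : PuncturedPlane Z) : sg x x = 𝟙 _ := by
  have h : sg x x ≫ sg x x = sg x x := sg_comp_sg (by
    simp only [segment_same, Set.mem_singleton_iff, forall_eq, Set.singleton_subset_iff]
    exact ⟨x.2, x.2⟩)
  have h2 := congrArg (fun m => Groupoid.inv (sg x x) ≫ m) h
  simpa using h2

theorem cls_eq_sg {y y' : PuncturedPlane Z} (p : Path y y')
    (hp : ∀ t, segment ℝ (y : Plane) (p t) ⊆ {w | w ∉ Z}) : cls p = sg y y' := by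
  rw [← sg_comp_cls p hp, sg_self, Category.id_comp]

theorem sg_comp_sg_symm {x y : PuncturedPlane Z} (h : segment ℝ (x : Plane) y ⊆ {w | w ∉ Z}) :
    sg x y ≫ sg y x = 𝟙 _ := by
  rw [sg_comp_sg, sg_self]
  intro w hw
  rw [segment_symm] at hw
  exact ⟨h hw, segment_subset_of_mem h hw⟩

end PuncturedPlane

open PuncturedPlane

/-! ### Paths are determined by their holonomy -/

namespace EdgeSystem

variable {Z : Finset Plane} {T : EdgeSystem Z}

variable (T) in
/-- The base point of the cell to the left of an edge. -/
noncomputable def leftBase (e : T.edges) : PuncturedPlane Z :=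
  ⟨T.sideBase e 1, (sideBase_spec e one_ne_zero).1.1⟩

variable (T) in
/-- The base point of the cell to the right of an edge. -/
noncomputable def rightBase (e : T.edges) : PuncturedPlane Z :=
  ⟨T.sideBase e (-1), (sideBase_spec e (by norm_num)).1.1⟩

variable (T) in
/-- A point of an edge. -/
noncomputable def edgePoint (e : T.edges) : PuncturedPlane Z :=
  ⟨(T.straight e).nonempty.some, notMem_punctures (T.straight e).nonempty.some_mem⟩

theorem edgePoint_mem (e : T.edges) : (T.edgePoint e : Plane) ∈ (e : Set Plane) :=
  (T.straight e).nonempty.some_mem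

theorem basePt_notMem (x : PuncturedPlane Z) : T.basePt x ∉ Z :=
  segment_basePt_subset x.2 (left_mem_segment ℝ _ _)

/-- A chosen path class between two points. -/
noncomputable def link (x y : PuncturedPlane Z) :
    FundamentalGroupoid.mk x ⟶ FundamentalGroupoid.mk y :=
  cls (PathConnectedSpace.somePath x y)

variable (T) in
/-- The path class from `o` to `x` through the base point of the cell of `x`. -/
noncomputable def access (o x : PuncturedPlane Z) :
    FundamentalGroupoid.mk o ⟶ FundamentalGroupoid.mk x :=
  link o ⟨T.basePt x, basePt_notMem x⟩ ≫ sg ⟨T.basePt x, basePt_notMem x⟩ x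

theorem access_eq (o : PuncturedPlane Z) {x b : PuncturedPlane Z} (h : T.basePt x = b) :
    T.access o x = link o b ≫ sg b x := by
  obtain ⟨b, hb⟩ := b
  simp only at h
  subst h
  rfl

variable (T) in
/-- The class of a loop that crosses the edge `e` once, from left to right. -/
noncomputable def crossLoop (o : PuncturedPlane Z) (e : T.edges) :
    FundamentalGroupoid.mk o ⟶ FundamentalGroupoid.mk o :=
  link o (T.leftBase e) ≫ sg (T.leftBase e) (T.edgePoint e) ≫
    sg (T.edgePoint e) (T.rightBase e) ≫ Groupoid.inv (link o (T.rightBase e))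

variable (T) in
/-- The class of loops at `o` with a given sequence of crossings. -/
noncomputable def loopClass (o : PuncturedPlane Z) (w : FreeGroup T.edges) :
    FundamentalGroupoid.mk o ⟶ FundamentalGroupoid.mk o :=
  (FreeGroup.lift fun e => (show End (FundamentalGroupoid.mk o) from T.crossLoop o e)⁻¹) w⁻¹

theorem loopClass_one (o : PuncturedPlane Z) : T.loopClass o 1 = 𝟙 _ := by
  rw [loopClass, inv_one, map_one]; rfl

/-- Multiplication in `End` reverses composition; the inversions of the word and of the generators
in `loopClass` undo this. -/
theorem loopClass_mul (o : PuncturedPlane Z) (a b : FreeGroup T.edges) :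
    T.loopClass o (a * b) = T.loopClass o a ≫ T.loopClass o b := by
  rw [loopClass, mul_inv_rev, map_mul]; rfl

theorem loopClass_of (o : PuncturedPlane Z) (e : T.edges) :
    T.loopClass o (FreeGroup.of e) = T.crossLoop o e := by
  rw [loopClass, map_inv, FreeGroup.lift_apply_of, inv_inv]

theorem loopClass_comp_inv (o : PuncturedPlane Z) (a : FreeGroup T.edges) :
    T.loopClass o a ≫ T.loopClass o a⁻¹ = 𝟙 _ := by
  rw [← loopClass_mul, mul_inv_cancel, loopClass_one]

theorem loopClass_inv (o : PuncturedPlane Z) (a : FreeGroup T.edges) :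
    T.loopClass o a⁻¹ = Groupoid.inv (T.loopClass o a) := by
  have h := congrArg (fun m => Groupoid.inv (T.loopClass o a) ≫ m) (loopClass_comp_inv o a)
  simpa using h

/-- The comparison of the accesses to nearby points. -/
theorem exists_ball_access (o x : PuncturedPlane Z) : ∃ r > 0, ∀ y : PuncturedPlane Z,
    (y : Plane) ∈ Metric.ball (x : Plane) r → segment ℝ (x : Plane) y ⊆ {w | w ∉ Z} ∧
      T.access o x ≫ sg x y =
        T.loopClass o (T.localGauge (T.edgeAt x) y)⁻¹ ≫ T.access o y := by
  rcases mem_free_or_exists (T := T) x.2 with hx | ⟨e, hx⟩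
  · obtain ⟨r, hr, hball⟩ := Metric.isOpen_iff.1 (isOpen_cell x.1) x.1 (mem_cell_self hx)
    refine ⟨r, hr, fun y hy => ⟨segment_subset_of_mem_cell (hball hy), ?_⟩⟩
    rw [edgeAt_of_mem_free hx, localGauge, inv_one, loopClass_one, Category.id_comp]
    let b : PuncturedPlane Z := ⟨T.basePt x, basePt_notMem x⟩
    rw [access_eq o (b := b) rfl, access_eq o (b := b) (basePt_eq_of_mem_cell (hball hy)),
      Category.assoc, sg_comp_sg]
    intro w hw
    have hb : T.cell b = T.cell x := cell_eq_of_mem (basePt_mem_cell hx)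
    have hwc : w ∈ T.cell b := by
      rw [hb]; exact convex_cell.segment_subset (mem_cell_self hx) (hball hy) hw
    exact ⟨(cell_subset_free hwc).1, segment_subset_of_mem_cell hwc⟩
  · obtain ⟨r, hr, hball⟩ := exists_ball_basePt hx
    refine ⟨r, hr, fun y hy => ?_⟩
    have hmem : ∀ w ∈ segment ℝ (x : Plane) y, w ∈ Metric.ball (x : Plane) r := fun w hw =>
      (convex_ball _ r).segment_subset (Metric.mem_ball_self hr) hy hw
    have hcr : ∀ w ∈ segment ℝ (x : Plane) y, ∃ θ : ℝ, 0 ≤ θ ∧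
        cross (T.dir e) (w - x) = θ * cross (T.dir e) (y - x) := by
      intro w hw
      obtain ⟨θ, h0, -, rfl⟩ := mem_segment_iff_add.1 hw
      exact ⟨θ, h0, by rw [add_sub_cancel_left, cross_smul]⟩
    refine ⟨fun w hw => (hball w (hmem w hw)).1, ?_⟩
    have hxb : T.basePt x = T.leftBase e := basePt_of_mem hx
    rw [edgeAt_of_mem hx]
    rcases le_or_gt 0 (cross (T.dir e) ((y : Plane) - x)) with hc | hc
    · rw [localGauge_of_notMem_rightSide (by rw [mem_rightSide_iff hx]; exact hc.not_gt), inv_one,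
        loopClass_one, Category.id_comp, access_eq o hxb,
        access_eq o (b := T.leftBase e) ((hball y hy).2.1 hc), Category.assoc, sg_comp_sg]
      intro w hw
      obtain ⟨θ, h0, hθ⟩ := hcr w hw
      obtain ⟨h1, h2, -⟩ := hball w (hmem w hw)
      refine ⟨h1, ?_⟩
      have : (T.leftBase e : Plane) = T.basePt w := (h2 (by rw [hθ]; positivity)).symm
      rw [this]
      exact segment_basePt_subset h1
    · rw [localGauge_of_mem_rightSide ((mem_rightSide_iff hx).2 hc), inv_inv, loopClass_of,
        access_eq o hxb, access_eq o (b := T.rightBase e) ((hball y hy).2.2.2 hc), crossLoop]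
      -- The crossing at `x` is compared with the standard crossing at `edgePoint`: all points
      -- between the two on the edge are visible from both side bases.
      have hedge : ∀ w ∈ segment ℝ (T.edgePoint e : Plane) x, w ∈ (e : Set Plane) := fun w hw =>
        (T.straight e).convex.segment_subset (edgePoint_mem e) hx hw
      have kA : sg (T.rightBase e) x ≫ sg x y = sg (T.rightBase e) y := sg_comp_sg fun w hw => by
        obtain ⟨θ, h0, hθ⟩ := hcr w hw
        obtain ⟨h1, -, h3, -⟩ := hball w (hmem w hw)
        exact ⟨h1, h3 (by rw [hθ]; exact mul_nonpos_of_nonneg_of_nonpos h0 hc.le)⟩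
      have kB : sg (T.rightBase e) (T.edgePoint e) ≫ sg (T.edgePoint e) x =
          sg (T.rightBase e) x := sg_comp_sg fun w hw =>
        ⟨notMem_punctures (hedge w hw), segment_sideBase_subset (by norm_num) (hedge w hw)⟩
      have kC : sg (T.leftBase e) (T.edgePoint e) ≫ sg (T.edgePoint e) x =
          sg (T.leftBase e) x := sg_comp_sg fun w hw =>
        ⟨notMem_punctures (hedge w hw), segment_sideBase_subset one_ne_zero (hedge w hw)⟩
      have kD : sg (T.edgePoint e) (T.rightBase e) ≫ sg (T.rightBase e) (T.edgePoint e) = 𝟙 _ :=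
        sg_comp_sg_symm (by
          rw [segment_symm]
          exact segment_sideBase_subset (by norm_num) (edgePoint_mem e))
      simp only [Category.assoc, Groupoid.inv_eq_inv, IsIso.inv_hom_id_assoc]
      rw [← kA, ← kB, Category.assoc, reassoc_of% kD, reassoc_of% kC]

/-- The class of a path is determined by its end points and its holonomy. -/
theorem access_comp_cls (o : PuncturedPlane Z) {a b : PuncturedPlane Z} (p : Path a b)
    {g : unitInterval → FreeGroup T.edges} (hg : T.flatGauge.IsLift p g) :
    T.access o a ≫ cls p = T.loopClass o ((g 0)⁻¹ * g 1) ≫ T.access o b := by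
  -- The end points become values of `f`, so that subpaths of `p` have matching types.
  obtain ⟨f, rfl, rfl⟩ := p
  set p : Path (f.toFun 0) (f.toFun 1) := ⟨f, rfl, rfl⟩ with hp
  -- The path up to time `t`, closed up by the accesses and corrected by the lift. This is locally
  -- constant in `t`, and its values at `0` and `1` give the claim.
  let D (t : unitInterval) : FundamentalGroupoid.mk o ⟶ FundamentalGroupoid.mk o :=
    (T.access o (p 0) ≫ cls (p.subpath 0 t) ≫ Groupoid.inv (T.access o (p t))) ≫
      T.loopClass o (g t)⁻¹
  have hD : IsLocallyConstant D := by
    rw [IsLocallyConstant.iff_eventually_eq]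
    intro t₀
    obtain ⟨r, hr, hball⟩ := exists_ball_access (T := T) o (p t₀)
    have hcont : Continuous fun t => (p t : Plane) := by fun_prop
    have h1 : ∀ᶠ t in 𝓝 t₀, (p t : Plane) ∈ Metric.ball (p t₀ : Plane) r :=
      hcont.continuousAt.eventually_mem (Metric.ball_mem_nhds _ hr)
    have h2 : ∀ᶠ t in 𝓝 t₀, ∀ s ∈ Set.uIcc t₀ t, (p s : Plane) ∈ Metric.ball (p t₀ : Plane) r := by
      have : Tendsto (fun t => Set.uIcc t₀ t) (𝓝 t₀) (𝓝 t₀).smallSets := by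
        exact tendsto_const_nhds.uIcc tendsto_id
      exact (tendsto_smallSets_iff.1 this) _ h1
    filter_upwards [h1, h2, hg t₀] with t ht ht2 htg
    -- A short piece of the path stays in a ball whose points are visible from `p t₀`, so it is
    -- homotopic to the straight path.
    have hseg : cls (p.subpath t₀ t) = sg (p t₀) (p t) := by
      refine cls_eq_sg _ fun s => (hball _ ?_).1
      have : p.subpath t₀ t s ∈ Set.range (p.subpath t₀ t) := ⟨s, rfl⟩
      rw [Path.range_subpath] at this
      obtain ⟨u, hu, hus⟩ := this
      rw [← hus]
      exact ht2 u hu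
    have hsplit : cls (p.subpath 0 t) = cls (p.subpath 0 t₀) ≫ cls (p.subpath t₀ t) := by
      rw [← cls_trans]
      exact (cls_eq_iff.2 ⟨Path.Homotopy.subpathTransSubpath p 0 t₀ t⟩).symm
    have hloc := (hball _ ht).2
    have htg' : g t₀ = g t * T.localGauge (T.edgeAt (p t₀)) (p t) := htg.symm
    have key : sg (p t₀) (p t) = Groupoid.inv (T.access o (p t₀)) ≫
        T.loopClass o (T.localGauge (T.edgeAt (p t₀)) (p t))⁻¹ ≫ T.access o (p t) := by
      rw [← hloc]; simp
    simp only [D]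
    rw [hsplit, hseg, key, htg', mul_inv_rev, loopClass_mul]
    simp
  have h01 := hD.apply_eq_of_preconnectedSpace 0 1
  simp only [D] at h01
  have e0 : cls (p.subpath 0 0) = 𝟙 _ := by rw [Path.subpath_self]; rfl
  have e1 : cls (p.subpath 0 1) = cls p := by rw [Path.subpath_zero_one]; rfl
  rw [e0, e1, Category.id_comp, Groupoid.comp_inv, Category.id_comp] at h01
  have h2 := congrArg (fun m => m ≫ T.loopClass o (g 1) ≫ T.access o (p 1)) h01
  simp only [Category.assoc] at h2
  rw [← Category.assoc (T.loopClass o (g 1)⁻¹), ← loopClass_mul, inv_mul_cancel, loopClass_one,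
    Category.id_comp, Groupoid.inv_comp, Category.comp_id] at h2
  rw [loopClass_mul, Category.assoc]
  exact h2.symm

end EdgeSystem

/-! ### From conjugate path classes to free homotopies -/

namespace Path

variable {Y : Type*} [TopologicalSpace Y] {x y z : Y}

theorem trans_extend_of_le_half (p : Path x y) (q : Path y z) {u : ℝ} (h0 : 0 ≤ u)
    (h1 : u ≤ 1 / 2) : (p.trans q).extend u = p.extend (2 * u) := by
  rw [Path.extend_apply _ ⟨h0, by linarith⟩]
  exact if_pos h1

theorem trans_extend_of_half_le (p : Path x y) (q : Path y z) {u : ℝ} (h0 : 1 / 2 ≤ u)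
    (h1 : u ≤ 1) : (p.trans q).extend u = q.extend (2 * u - 1) := by
  rcases h0.eq_or_lt with rfl | h0
  · rw [trans_extend_of_le_half p q (by norm_num) le_rfl]
    norm_num
  · rw [Path.extend_apply _ ⟨by linarith, h1⟩]
    exact if_neg (not_le.2 h0)

end Path

namespace Loop

variable {Y : Type*} [TopologicalSpace Y]

/-- A loop as a path from its base point to itself. -/
def path (γ : Loop Y) : Path γ.base γ.base := ⟨γ.toMap, rfl, γ.closed.symm⟩

/-- A loop at `y` is freely homotopic to its conjugate by a path from `y`. -/
theorem freelyHomotopic_of_conj {γ₀ γ₁ : Loop Y} (δ : Path γ₀.base γ₁.base)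
    (h : ((δ.symm.trans γ₀.path).trans δ).Homotopic γ₁.path) : γ₀.FreelyHomotopic γ₁ := by
  set Γ := (δ.symm.trans γ₀.path).trans δ with hΓ
  have hfirst : ∀ u : ℝ, 0 ≤ u → u ≤ 1 / 4 → Γ.extend u = δ.extend (1 - 4 * u) := by
    intro u h0 h1
    rw [hΓ, Path.trans_extend_of_le_half _ _ h0 (by linarith),
      Path.trans_extend_of_le_half _ _ (by linarith) (by linarith), Path.extend_symm_apply]
    ring_nf
  have hmid : ∀ u : ℝ, 1 / 4 ≤ u → u ≤ 1 / 2 → Γ.extend u = γ₀.path.extend (4 * u - 1) := by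
    intro u h0 h1
    rw [hΓ, Path.trans_extend_of_le_half _ _ (by linarith) (by linarith),
      Path.trans_extend_of_half_le _ _ (by linarith) (by linarith)]
    ring_nf
  have hlast : ∀ u : ℝ, 1 / 2 ≤ u → u ≤ 1 → Γ.extend u = δ.extend (2 * u - 1) :=
    fun u h0 h1 => Path.trans_extend_of_half_le _ _ h0 h1
  -- At time `s` the loop is `Γ` on the window `[(1 - s) / 4, (1 + s) / 2]`, which grows from the
  -- part `γ₀` to all of `Γ`. Both ends of the window are mapped to `δ s`.
  have hfree : ContinuousMap.HomotopicWith γ₀.toMap Γ.toContinuousMap (fun f => f 0 = f 1) := by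
    refine ⟨⟨⟨⟨fun p => Γ.extend ((1 - (p.1 : ℝ)) / 4 + (1 / 4 + 3 / 4 * (p.1 : ℝ)) * p.2),
      by fun_prop⟩, fun t => ?_, fun t => ?_⟩, fun s => ?_⟩⟩
    · have h0 := t.2.1
      have h1 := t.2.2
      change Γ.extend ((1 - (0 : ℝ)) / 4 + (1 / 4 + 3 / 4 * (0 : ℝ)) * t) = γ₀.path t
      rw [hmid _ (by linarith) (by linarith)]
      have : 4 * ((1 - (0 : ℝ)) / 4 + (1 / 4 + 3 / 4 * (0 : ℝ)) * t) - 1 = t := by ring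
      rw [this]
      exact Path.extend_apply _ t.2
    · change Γ.extend ((1 - (1 : ℝ)) / 4 + (1 / 4 + 3 / 4 * (1 : ℝ)) * t) = Γ t
      have : (1 - (1 : ℝ)) / 4 + (1 / 4 + 3 / 4 * (1 : ℝ)) * t = t := by ring
      rw [this]
      exact Path.extend_apply _ t.2
    · have h0 := s.2.1
      have h1 := s.2.2
      change Γ.extend ((1 - (s : ℝ)) / 4 + (1 / 4 + 3 / 4 * (s : ℝ)) * (0 : ℝ)) =
        Γ.extend ((1 - (s : ℝ)) / 4 + (1 / 4 + 3 / 4 * (s : ℝ)) * (1 : ℝ))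
      rw [hfirst _ (by linarith) (by linarith), hlast _ (by linarith) (by linarith)]
      congr 1; ring
  refine hfree.trans ?_
  obtain ⟨F⟩ := h
  refine ⟨⟨F.toHomotopy, fun s => ?_⟩⟩
  change F (s, 0) = F (s, 1)
  rw [Path.Homotopy.source, Path.Homotopy.target]

end Loop

/-! ### Holonomy as a complete invariant -/

namespace EdgeSystem

variable {Z : Finset Plane} {T : EdgeSystem Z} {γ₀ γ₁ : Loop (PuncturedPlane Z)}
  {g₀ g₁ : unitInterval → FreeGroup T.edges}

/-- One direction is the invariance of holonomy. Conversely, `access_comp_cls` expresses both path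
classes by the same formula, and the common access can be cancelled. -/
theorem homotopic_iff_holonomy_eq (hg₀ : T.flatGauge.IsLift γ₀.toMap g₀)
    (hg₁ : T.flatGauge.IsLift γ₁.toMap g₁) (hb : γ₀.base = γ₁.base) :
    γ₀.Homotopic γ₁ ↔ (g₀ 0)⁻¹ * g₀ 1 = (g₁ 0)⁻¹ * g₁ 1 := by
  constructor
  · rintro ⟨F⟩
    have hs0 : ∀ s, F (s, 0) = γ₀.toMap 0 := fun s => F.eq_fst s (.inl rfl)
    have hs1 : ∀ s, F (s, 1) = γ₀.toMap 1 := fun s => F.eq_fst s (.inr rfl)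
    refine (FlatGauge.IsLift.holonomy_of_homotopy T.flatGauge
      (F.toHomotopy : C(unitInterval × unitInterval, PuncturedPlane Z)) (fun s => ?_)
      (g₀ := g₀) (g₁ := g₁) ?_ ?_).2 fun s => ?_
    · exact (hs0 s).trans (γ₀.closed.trans (hs1 s).symm)
    · have h : (fun t => F (0, t)) = γ₀.toMap := funext fun t => F.apply_zero t
      change T.flatGauge.IsLift (fun t => F (0, t)) g₀
      rwa [h]
    · have h : (fun t => F (1, t)) = γ₁.toMap := funext fun t => F.apply_one t
      change T.flatGauge.IsLift (fun t => F (1, t)) g₁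
      rwa [h]
    · exact (hs0 s).trans (hs0 0).symm
  · intro h
    let p₁ : Path γ₀.base γ₀.base := ⟨γ₁.toMap, hb.symm, γ₁.closed.symm.trans hb.symm⟩
    have e0 := access_comp_cls γ₀.base γ₀.path hg₀
    have e1 := access_comp_cls γ₀.base p₁ hg₁
    rw [h, ← e1] at e0
    exact cls_eq_iff.1 ((cancel_epi _).1 e0)

theorem freelyHomotopic_iff_isConj_holonomy (hg₀ : T.flatGauge.IsLift γ₀.toMap g₀)
    (hg₁ : T.flatGauge.IsLift γ₁.toMap g₁) :
    γ₀.FreelyHomotopic γ₁ ↔ IsConj ((g₀ 0)⁻¹ * g₀ 1) ((g₁ 0)⁻¹ * g₁ 1) := by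
  constructor
  · rintro ⟨F⟩
    refine (FlatGauge.IsLift.holonomy_of_homotopy T.flatGauge
      (F.toHomotopy : C(unitInterval × unitInterval, PuncturedPlane Z)) (fun s => F.prop s)
      (g₀ := g₀) (g₁ := g₁) ?_ ?_).1
    · have h : (fun t => F (0, t)) = γ₀.toMap := funext fun t => F.apply_zero t
      change T.flatGauge.IsLift (fun t => F (0, t)) g₀
      rwa [h]
    · have h : (fun t => F (1, t)) = γ₁.toMap := funext fun t => F.apply_one t
      change T.flatGauge.IsLift (fun t => F (1, t)) g₁
      rwa [h]
  · intro h
    obtain ⟨c, hc⟩ := isConj_iff.1 h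
    set o := γ₀.base
    have e0 := access_comp_cls o γ₀.path hg₀
    have e1 := access_comp_cls o γ₁.path hg₁
    -- A path with holonomy class `c⁻¹` between the base points; conjugation by it turns the loop
    -- class of `x` into that of `c * x * c⁻¹`.
    obtain ⟨δ, hδ⟩ : ∃ δ : Path γ₀.base γ₁.base, cls δ =
        Groupoid.inv (T.access o γ₀.base) ≫ T.loopClass o c⁻¹ ≫ T.access o γ₁.base :=
      Path.Homotopic.Quotient.mk_surjective _
    refine Loop.freelyHomotopic_of_conj δ (cls_eq_iff.1 ?_)
    have hsymm : cls δ.symm = Groupoid.inv (cls δ) := by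
      have : cls δ ≫ cls δ.symm = 𝟙 _ := by
        rw [← cls_trans, ← cls_refl, cls_eq_iff]
        exact ⟨(Path.Homotopy.reflTransSymm δ).symm⟩
      have h2 := congrArg (fun m => Groupoid.inv (cls δ) ≫ m) this
      simpa using h2
    have e0' : cls γ₀.path = Groupoid.inv (T.access o γ₀.base) ≫
        T.loopClass o ((g₀ 0)⁻¹ * g₀ 1) ≫ T.access o γ₀.base := by rw [← e0]; simp
    have e1' : cls γ₁.path = Groupoid.inv (T.access o γ₁.base) ≫
        T.loopClass o ((g₁ 0)⁻¹ * g₁ 1) ≫ T.access o γ₁.base := by rw [← e1]; simp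
    rw [cls_trans, cls_trans, hsymm, hδ, e0', e1', ← hc]
    generalize (g₀ 0)⁻¹ * g₀ 1 = x
    rw [loopClass_mul, loopClass_mul, loopClass_inv]
    simp

end EdgeSystem

end Homotopy

theorem lemma5p4 (Z : Finset Plane) (T : EdgeSystem Z) (γ₀ γ₁ : Loop (PuncturedPlane Z))
    (h₀ : (T.visits γ₀).Finite) (h₁ : (T.visits γ₁).Finite) :
    (γ₀.base = γ₁.base → (γ₀.base : Plane) ∉ T.support →
      (γ₀.Homotopic γ₁ ↔ T.reducedWord γ₀ h₀ = T.reducedWord γ₁ h₁)) ∧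
    (γ₀.FreelyHomotopic γ₁ ↔
      cyclicReductions (T.word γ₀ h₀) = cyclicReductions (T.word γ₁ h₁)) := by
  classical
  obtain ⟨g₀, hg₀, hc₀, he₀⟩ := EdgeSystem.exists_isLift_of_word h₀
  obtain ⟨g₁, hg₁, hc₁, he₁⟩ := EdgeSystem.exists_isLift_of_word h₁
  refine ⟨fun hb hs => ?_, ?_⟩
  · rw [EdgeSystem.homotopic_iff_holonomy_eq hg₀ hg₁ hb, he₀ hs, he₁ (hb ▸ hs),
      EdgeSystem.reducedWord, EdgeSystem.reducedWord, ← FreeGroup.toWord_mk, ← FreeGroup.toWord_mk,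
      FreeGroup.toWord_inj]
  · rw [EdgeSystem.freelyHomotopic_iff_isConj_holonomy hg₀ hg₁, cyclicReductions_eq_iff_isConj]
    exact ⟨fun h => (hc₀.symm.trans h).trans hc₁, fun h => (hc₀.trans h).trans hc₁.symm⟩
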